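/- **Setting.** A *looped ReLU network* $\theta$ consists of a state dimension $n\ge 3$ and a feedforward network $f_\theta:\mathbb R^n\to\mathbb R^n$ with any number $L\ge 1$ of affine layers (weight matrices and bias vectors), arbitrary hidden widths, and coordinatewise ReLU between consecutive layers. It is run in exact real arithmetic from $x_0=0$ by $x_{t+1}=f_\theta(x_t)$. At each time $t\ge 1$: if $(x_t)_1>0$ the network halts; otherwise, if $(x_t)_2>0$, the bit $\mathbf 1[(x_t)_3>0]$ is appended to the output. The network *outputs* $s\in\{0,1\}^*$ if it halts and the bits appended before halting form $s$. Write $\|\theta\|_0$ for the number of non-zero weights and biases of $\theta$ and $\|\theta\|_p=(\sum_i|\theta_i|^p)^{1/p}$. Fix a precision $(\delta,M)$, where $0<\delta\le M<\infty$ and $\delta$ is a computable real number, and let $\Theta_{\delta,M}$ be the set of looped ReLU networks all of whose weights and biases lie in $\delta\mathbb Z\cap[-M,M]$. For $s\in\{0,1\}^*$ and $p\in[1,\infty)$ let $$\mathcal N(s)=\inf\{\|\theta\|_0:\theta\in\Theta_{\delta,M},\ \theta\text{ outputs }s\},\qquad \mathcal N_p(s)=\inf\{\|\theta\|_p:\theta\in\Theta_{\delta,M},\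 \theta\text{ outputs }s\}.$$ Let $U$ be a universal self-delimiting machine, that is, a partial computable function $\{0,1\}^*\rightharpoonup\{0,1\}^*$ with prefix-free domain such that for every partial computable $\varphi$ with prefix-free domain there is a constant $c$ such that whenever $\varphi(p)=s$ there is $q$ with $U(q)=s$ and $|q|\le|p|+c$. Let $K(s)=\min\{|p|:U(p)=s\}$ be the prefix Kolmogorov complexity. **Theorem.** There are constants $c_U,c_d\ge 0$, depending only on $U$ and $(\delta,M)$, such that for every $s\in\{0,1\}^*$ both $K(s)$ and $\mathcal N(s)$ are finite and $$\mathcal N(s)\le K(s)+c_U,\qquad K(s)\le c_d\,\mathcal N(s)\log_2\mathcal N(s)+c_d .$$ Moreover, for every $p\in[1,\infty)$, every $\theta\in\Theta_{\delta,M}$ satisfies $\delta^p\|\theta\|_0\le\|\theta\|_p^p\le M^p\|\theta\|_0$, and, with the same constants, for every $s\in\{0,1\}^*$, $$\mathcal N_p(s)^p\le M^p\,(K(s)+c_U),\qquad K(s)\le \frac{c_d}{\delta^p}\,\mathcal N_p(s)^p\,\log_2\!\Big(\frac{\mathcal N_p(s)^p}{\delta^p}\Big)+c_d .$$ -/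

import Mathlib

noncomputable section

namespace LoopedReLU

/-! ### Feedforward ReLU networks -/

/-- The parameters (weight matrices and bias vectors) of a feedforward network `ℝᵐ → ℝⁿ` with
at least one layer. `last A b` is a single affine layer; `layer A b N` is an affine layer,
followed by ReLU, followed by the network `N`. The depth and the hidden widths are arbitrary. -/
inductive FFN : ℕ → ℕ → Type
  | last {m n : ℕ} (A : Matrix (Fin n) (Fin m) ℝ) (b : Fin n → ℝ) : FFN m n
  | layer {m h n : ℕ} (A : Matrix (Fin h) (Fin m) ℝ) (b : Fin h → ℝ) (N : FFN h n) : FFN m n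

/-- Coordinatewise `x ↦ max x 0`. -/
def relu {n : ℕ} (x : Fin n → ℝ) : Fin n → ℝ := fun i => max (x i) 0

/-- The function computed by a feedforward network. There is no ReLU after the last layer. -/
def FFN.eval : {m n : ℕ} → FFN m n → (Fin m → ℝ) → (Fin n → ℝ)
  | _, _, .last A b, x => A.mulVec x + b
  | _, _, .layer A b N, x => N.eval (relu (A.mulVec x + b))

/-- The entries of one weight matrix and one bias vector, with multiplicity. -/
def layerParams {m n : ℕ} (A : Matrix (Fin n) (Fin m) ℝ) (b : Fin n → ℝ) : Multiset ℝ :=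
  (Finset.univ : Finset (Fin n × Fin m)).val.map (fun ij => A ij.1 ij.2) +
    (Finset.univ : Finset (Fin n)).val.map b

/-- All entries of the parameter vector, with multiplicity. -/
def FFN.params : {m n : ℕ} → FFN m n → Multiset ℝ
  | _, _, .last A b => layerParams A b
  | _, _, .layer A b N => layerParams A b + N.params

/-! ### Looped networks -/

/-- A looped network: a feedforward block `ℝⁿ → ℝⁿ`, where `ℝⁿ` has the three channels. -/
structure LoopedNet where
  /-- the state dimension -/
  n : ℕ
  three_le : 3 ≤ n
  /-- the block that is iterated -/
  block : FFN n n

namespace LoopedNet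

variable (θ : LoopedNet)

/-- The state `x_t`, where `x_0 = 0` and `x_{t+1} = f_θ(x_t)`. -/
def state (t : ℕ) : Fin θ.n → ℝ := θ.block.eval^[t] 0

/-- First coordinate of the state at time `t`. -/
def haltCh (t : ℕ) : ℝ := θ.state t ⟨0, by have := θ.three_le; omega⟩

/-- Second coordinate of the state at time `t`. -/
def emitCh (t : ℕ) : ℝ := θ.state t ⟨1, by have := θ.three_le; omega⟩

/-- Third coordinate of the state at time `t`. -/
def bitCh (t : ℕ) : ℝ := θ.state t ⟨2, by have := θ.three_le; omega⟩

open Classical in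
/-- The bits (none or one) appended to the output at a time `t` at which the run goes on. -/
def emitted (t : ℕ) : List Bool :=
  if 0 < θ.emitCh t then [decide (0 < θ.bitCh t)] else []

/-- The network halts, at time `τ ≥ 1`, and the bits appended at the times `1, …, τ - 1`
form `s`. -/
def Outputs (s : List Bool) : Prop :=
  ∃ τ : ℕ, 1 ≤ τ ∧ 0 < θ.haltCh τ ∧ (∀ t, 1 ≤ t → t < τ → ¬ 0 < θ.haltCh t) ∧
    (List.range' 1 (τ - 1)).flatMap θ.emitted = s

/-- Every parameter lies in `δℤ ∩ [-M, M]`. -/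
def HasPrecision (δ M : ℝ) : Prop :=
  ∀ w ∈ θ.block.params, (∃ k : ℤ, w = δ * k) ∧ |w| ≤ M

open Classical in
/-- The number `‖θ‖₀` of non-zero parameters. -/
def l0 : ℕ := (θ.block.params.filter (fun w => w ≠ 0)).card

/-- The number `‖θ‖_p ^ p`, the sum of the `p`-th powers of the absolute values of the
parameters. -/
def lpPow (p : ℝ) : ℝ := (θ.block.params.map (fun w => |w| ^ p)).sum

/-- The `L_p` norm `‖θ‖_p` of the parameter vector. -/
def lpNorm (p : ℝ) : ℝ := θ.lpPow p ^ (1 / p)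

end LoopedNet

/-- Neural complexity: the least number of non-zero parameters of a network with precision
`(δ, M)` that outputs `s`, and `⊤` if there is none. -/
def neuralComplexity (δ M : ℝ) (s : List Bool) : ℕ∞ :=
  ⨅ θ : LoopedNet, ⨅ _ : θ.HasPrecision δ M ∧ θ.Outputs s, (θ.l0 : ℕ∞)

/-- The infimum of the `L_p` norms of the networks with precision `(δ, M)` that output `s`. -/
def lpComplexity (δ M p : ℝ) (s : List Bool) : ℝ :=
  sInf {r : ℝ | ∃ θ : LoopedNet, θ.HasPrecision δ M ∧ θ.Outputs s ∧ θ.lpNorm p = r}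

/-! ### Prefix Kolmogorov complexity -/

/-- No program on which the machine halts is a proper prefix of another one. -/
def IsPrefixFree (φ : List Bool →. List Bool) : Prop :=
  ∀ p q : List Bool, (φ p).Dom → (φ q).Dom → p <+: q → p = q

/-- A universal self-delimiting machine: a partial computable function with prefix-free domain
that simulates every other one with programs longer by at most a constant. (This is implied by
the existence, for each `φ`, of a string `w` with `U (w ++ p) = φ p` for all `p`.) -/
structure IsUniversalPrefixMachine (U : List Bool →. List Bool) : Prop where
  partrec : Partrec U
  prefixFree : IsPrefixFree U
  universal : ∀ φ : List Bool →. List Bool, Partrec φ → IsPrefixFree φ →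
    ∃ c : ℕ, ∀ p s : List Bool, s ∈ φ p → ∃ q : List Bool, s ∈ U q ∧ q.length ≤ p.length + c

/-- The length of a shortest program for `s` on the machine `U`. -/
def kolmogorov (U : List Bool →. List Bool) (s : List Bool) : ℕ∞ :=
  ⨅ p : List Bool, ⨅ _ : s ∈ U p, (p.length : ℕ∞)

/-- A real number is computable if dyadic approximations of it can be computed to any
precision. -/
def IsComputableReal (x : ℝ) : Prop :=
  ∃ f : ℕ → ℤ, Computable f ∧ ∀ k : ℕ, |x - (f k : ℝ) / 2 ^ k| ≤ 1 / 2 ^ k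

end LoopedReLU

end

/-
For `N ≤ K + c`, compile `U` to a fixed machine with finitely many stacks and store the stacks as
decimal fractions with sparse digits, so that a fixed ReLU network performs a step of the machine.
The program is read from a chain of units along which a single `1` travels. A cell of the chain
costs three parameters and holds three bits, whence the leading coefficient `1`. All weights are
`±δ`: larger integer weights are replaced by copies of units, and the resulting power of `δ` is a
common positive factor of all states, which the thresholds at zero do not see.

For `K ≤ c N log N + c`, a network of precision `(δ, M)` is a list of `O(N)` edges of weight `±δ`
between named units, and once the units are renamed it has a self-delimiting code of `O(N log N)`
bits. The code is run exactly: every state is an integer polynomial in `δ`, and the signs of such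
values are computable, because `δ` is computable and its integer relations are the multiples of a
single polynomial.
-/

noncomputable section

namespace LoopedReLU

section StackMachine

open Turing Turing.PartrecToTM2

/-! ### Stack machines with an output tape -/

/-- An instruction of a machine with stacks indexed by `K`, stack alphabet `Γ` and states `Q`. The
top symbol that `pop` and `peek` pass on is `none` when the stack is empty. -/
inductive Instr (K Γ Q : Type*)
  | push (k : K) (a : Γ) (q : Q)
  | pop (k : K) (f : Option Γ → Q)
  | peek (k : K) (f : Option Γ → Q)
  | emit (b : Bool) (q : Q)
  | halt

/-- Every state to which the instruction can lead satisfies `F`. -/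
def Instr.Leads {K Γ Q : Type*} (F : Q → Prop) : Instr K Γ Q → Prop
  | .push _ _ q => F q
  | .pop _ f => ∀ o, F (f o)
  | .peek _ f => ∀ o, F (f o)
  | .emit _ q => F q
  | .halt => True

/-- Renaming of the states. -/
def Instr.map {K Γ Q Q' : Type*} (φ : Q → Q') : Instr K Γ Q → Instr K Γ Q'
  | .push k a q => .push k a (φ q)
  | .pop k f => .pop k (fun o => φ (f o))
  | .peek k f => .peek k (fun o => φ (f o))
  | .emit b q => .emit b (φ q)
  | .halt => .halt

/-- Started in state `q` with stacks `S`, the machine `M` emits exactly `s` and halts. -/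
inductive Produces {K Γ Q : Type*} [DecidableEq K] (M : Q → Instr K Γ Q) :
    Q → (K → List Γ) → List Bool → Prop
  | push {q S s k a q'} (h : M q = .push k a q')
      (H : Produces M q' (Function.update S k (a :: S k)) s) : Produces M q S s
  | pop {q S s k f} (h : M q = .pop k f)
      (H : Produces M (f (S k).head?) (Function.update S k (S k).tail) s) : Produces M q S s
  | peek {q S s k f} (h : M q = .peek k f)
      (H : Produces M (f (S k).head?) S s) : Produces M q S s
  | emit {q S s b q'} (h : M q = .emit b q') (H : Produces M q' S s) : Produces M q S (b :: s)
  | halt {q S} (h : M q = .halt) : Produces M q S []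

theorem Produces.map {K Γ Q Q' : Type*} [DecidableEq K] {M : Q → Instr K Γ Q}
    {M' : Q' → Instr K Γ Q'} {F : Q → Prop} (φ : Q → Q') (hF : ∀ q, F q → (M q).Leads F)
    (hM : ∀ q, F q → M' (φ q) = (M q).map φ) {q : Q} {S : K → List Γ} {s : List Bool}
    (H : Produces M q S s) (hq : F q) : Produces M' (φ q) S s := by
  induction H with
  | push h _ ih =>
    have hlead := hF _ hq
    have himage := hM _ hq
    rw [h] at hlead himage
    exact .push himage (ih hlead)
  | pop h _ ih =>
    have hlead := hF _ hq
    have himage := hM _ hq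
    rw [h] at hlead himage
    exact .pop himage (ih (hlead _))
  | peek h _ ih =>
    have hlead := hF _ hq
    have himage := hM _ hq
    rw [h] at hlead himage
    exact .peek himage (ih (hlead _))
  | emit h _ ih =>
    have hlead := hF _ hq
    have himage := hM _ hq
    rw [h] at hlead himage
    exact .emit himage (ih hlead)
  | halt h =>
    have himage := hM _ hq
    rw [h] at himage
    exact .halt himage

theorem exists_fintype_produces_of_leads.{u} {K Γ : Type*} {Q : Type u} [DecidableEq K]
    {M : Q → Instr K Γ Q} {F : Finset Q} (hF : ∀ q ∈ F, (M q).Leads (· ∈ F)) {q₀ : Q}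
    (h₀ : q₀ ∈ F) :
    ∃ (Q' : Type u) (_ : Fintype Q') (_ : DecidableEq Q') (M' : Q' → Instr K Γ Q') (q₀' : Q'),
      ∀ S s, Produces M q₀ S s → Produces M' q₀' S s := by
  classical
  let φ : Q → {q // q ∈ F} := fun q => if h : q ∈ F then ⟨q, h⟩ else ⟨q₀, h₀⟩
  refine ⟨{q // q ∈ F}, inferInstance, inferInstance, fun q => (M q.1).map φ, φ q₀, ?_⟩
  refine fun S s H => H.map (F := (· ∈ F)) φ hF (fun q hq => ?_) h₀
  simp only [hq, ↓reduceDIte, φ]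

/-! ### Binary words as numbers -/

/-- The number whose binary digits, least significant first, are `w` followed by a leading `1`, by
which a word is encoded as an input or a value of a function on `ℕ`. -/
def wordNum (w : List Bool) : ℕ := w.foldr (fun b n => 2 * n + b.toNat) 1

/-- The binary numeral of `wordNum w`, the form in which `Turing.PartrecToTM2` represents it. -/
def wordPosNum (w : List Bool) : PosNum :=
  w.foldr (fun b n => cond b n.bit1 n.bit0) PosNum.one

/-- The stack symbol of a bit. -/
def bitSym (b : Bool) : Γ' := cond b Γ'.bit1 Γ'.bit0

/-- The stack content that consists of the word `w` and the end marker of `Turing.PartrecToTM2`. -/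
def terminated (w : List Bool) : List Γ' := w.map bitSym ++ [Γ'.cons]

theorem bitSym_injective : Function.Injective bitSym := by decide

theorem terminated_injective : Function.Injective terminated := fun _ _ h =>
  bitSym_injective.list_map (List.append_cancel_right h)

theorem cast_wordPosNum (w : List Bool) : (wordPosNum w : ℕ) = wordNum w := by
  induction w with
  | nil => rfl
  | cons b w ih =>
    simp only [wordPosNum, wordNum, List.foldr_cons] at ih ⊢
    cases b <;> simp [PosNum.cast_bit0, PosNum.cast_bit1, ih] <;> ring

theorem trPosNum_wordPosNum (w : List Bool) :
    trPosNum (wordPosNum w) = (w ++ [true]).map bitSym := by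
  induction w with
  | nil => rfl
  | cons b w ih =>
    simp only [wordPosNum, List.foldr_cons] at ih ⊢
    cases b <;> simp [trPosNum, ih, bitSym]

theorem trList_wordNum (w : List Bool) : trList [wordNum w] = terminated (w ++ [true]) := by
  have hnum : (wordNum w : Num) = Num.pos (wordPosNum w) := by
    rw [← cast_wordPosNum, ← PosNum.cast_to_num, ← Num.cast_pos, Num.of_to_nat,
      PosNum.cast_to_num]
  simp [trList, trNat, hnum, trNum, trPosNum_wordPosNum, terminated]

theorem wordNum_injective : Function.Injective wordNum := fun v w h =>
  List.append_cancel_right (terminated_injective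
    ((trList_wordNum v).symm.trans ((congrArg (fun n => trList [n]) h).trans (trList_wordNum w))))

/-! ### Partial recursive functions on stack machines -/

/-- Statements of the `TM2` programs to which Mathlib compiles partial recursive functions. -/
abbrev Prog := (TM2.Stmt (fun _ : K' => Γ') Λ' (Option Γ') : Type)

/-- States of the compiled machine: a pending statement together with the local variable, and the
states of a final phase that emits the number on the main stack. That phase delays every bit by one
step (`buffer`), because the last bit is the leading `1` of `wordNum` and must not be emitted. -/
inductive RunState
  | run (q : Prog) (v : Option Γ')
  | first
  | buffer (b : Bool)
  | flush (b c : Bool)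
  | done

/-- The instruction for a pending `TM2` statement. A `peek` that ignores what it reads stands for
the statements that do not touch the stacks. -/
def runInstr : Prog → Option Γ' → Instr K' Γ' RunState
  | .push k f q, v => .push k (f v) (.run q v)
  | .peek k f q, v => .peek k (fun o => .run q (f v o))
  | .pop k f q, v => .pop k (fun o => .run q (f v o))
  | .load a q, v => .peek K'.main (fun _ => .run q (a v))
  | .branch f q₁ q₂, v => .peek K'.main (fun _ => .run (cond (f v) q₁ q₂) v)
  | .goto l, v => .peek K'.main (fun _ => .run (tr (l v)) v)
  | .halt, _ => .peek K'.main (fun _ => .first)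

/-- The machine that runs Mathlib's `TM2` programs and emits the number they leave behind. -/
def runMachine : RunState → Instr K' Γ' RunState
  | .run q v => runInstr q v
  | .first => .pop K'.main (fun o => match o with
      | some Γ'.bit0 => .buffer false
      | some Γ'.bit1 => .buffer true
      | _ => .done)
  | .buffer b => .pop K'.main (fun o => match o with
      | some Γ'.bit0 => .flush b false
      | some Γ'.bit1 => .flush b true
      | _ => .done)
  | .flush b c => .emit b (.buffer c)
  | .done => .halt

/-- The state of the compiled machine that corresponds to a `TM2` configuration. -/
def cfgState (c : TM2.Cfg (fun _ : K' => Γ') Λ' (Option Γ')) : RunState :=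
  match c.l with
  | some l => .run (tr l) c.var
  | none => .first

theorem produces_run_of_stepAux (q : Prog) (v : Option Γ') (S : K' → List Γ') (s : List Bool)
    (H : Produces runMachine (cfgState (TM2.stepAux q v S)) (TM2.stepAux q v S).stk s) :
    Produces runMachine (.run q v) S s := by
  induction q generalizing v S with
  | push k f q ih => exact .push (k := k) (a := f v) (q' := .run q v) rfl (ih _ _ H)
  | peek k f q ih => exact .peek (k := k) (f := fun o => .run q (f v o)) rfl (ih _ _ H)
  | pop k f q ih => exact .pop (k := k) (f := fun o => .run q (f v o)) rfl (ih _ _ H)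
  | load a q ih => exact .peek (k := K'.main) (f := fun _ => .run q (a v)) rfl (ih _ _ H)
  | branch f q₁ q₂ ih₁ ih₂ =>
    refine .peek (k := K'.main) (f := fun _ => .run (cond (f v) q₁ q₂) v) rfl ?_
    rw [TM2.stepAux] at H
    cases hb : f v <;> simp only [hb, cond_true, cond_false] at H ⊢
    · exact ih₂ _ _ H
    · exact ih₁ _ _ H
  | goto l => exact .peek (k := K'.main) (f := fun _ => .run (tr (l v)) v) rfl H
  | halt => exact .peek (k := K'.main) (f := fun _ => .first) rfl H

theorem produces_cfgState_of_reaches {a b : TM2.Cfg (fun _ : K' => Γ') Λ' (Option Γ')}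
    {s : List Bool} (h : StateTransition.Reaches (TM2.step tr) a b)
    (H : Produces runMachine (cfgState b) b.stk s) : Produces runMachine (cfgState a) a.stk s := by
  induction h using Relation.ReflTransGen.head_induction_on with
  | refl => exact H
  | @head a c hac _ ih =>
    obtain ⟨l, v, S⟩ := a
    cases l with
    | none => simp [TM2.step] at hac
    | some l =>
      simp only [TM2.step, Option.mem_def, Option.some.injEq] at hac
      subst hac
      exact produces_run_of_stepAux _ _ _ _ ih

theorem produces_buffer (b : Bool) (l : List Bool) :
    Produces runMachine (.buffer b) (K'.elim (terminated (l ++ [true])) [] [] []) (b :: l) := by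
  induction l generalizing b with
  | nil => exact .pop rfl (.emit (b := b) (q' := .buffer true) rfl (.pop rfl (.halt rfl)))
  | cons c l ih =>
    refine .pop rfl ?_
    have hflush : Produces runMachine (.flush b c)
      (K'.elim (terminated (l ++ [true])) [] [] []) (b :: c :: l) := .emit rfl (ih c)
    cases c <;> simpa [terminated, bitSym] using hflush

theorem produces_first (s : List Bool) :
    Produces runMachine .first (K'.elim (terminated (s ++ [true])) [] [] []) s := by
  cases s with
  | nil => exact .pop rfl (.pop rfl (.halt rfl))
  | cons b l =>
    refine .pop rfl ?_
    have hbuffer := produces_buffer b l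
    cases b <;> simpa [terminated, bitSym] using hbuffer

open Classical in
/-- The states that the compiled machine can visit while it runs a program with labels in `S`. -/
def visited (S : Finset Λ') : Finset RunState :=
  ((S.biUnion fun l => TM2.stmts₁ (tr l)) ×ˢ (Finset.univ : Finset (Option Γ'))).image
      (fun x => RunState.run x.1 x.2) ∪
    ({.first, .buffer false, .buffer true, .flush false false, .flush false true,
      .flush true false, .flush true true, .done} : Finset RunState)

theorem run_mem_visited {S : Finset Λ'} {q : Prog} {v : Option Γ'} :
    RunState.run q v ∈ visited S ↔ ∃ l ∈ S, q ∈ TM2.stmts₁ (tr l) := by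
  simp only [visited, Finset.mem_union, Finset.mem_image, Finset.mem_product, Finset.mem_biUnion,
    Finset.mem_univ, and_true, Finset.mem_insert, Finset.mem_singleton, reduceCtorEq, or_false,
    Prod.exists, RunState.run.injEq]
  constructor
  · rintro ⟨a, _, h, rfl, _⟩
    exact h
  · exact fun h => ⟨q, v, h, rfl, rfl⟩

theorem leads_visited_of_run {S : Finset Λ'} (hS : ∀ l ∈ S, TM2.SupportsStmt S (tr l)) {q : Prog}
    {v : Option Γ'} (hq : RunState.run q v ∈ visited S) :
    (runInstr q v).Leads (· ∈ visited S) := by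
  obtain ⟨l, hl, hql⟩ := run_mem_visited.1 hq
  have hsup := TM2.stmts₁_supportsStmt_mono hql (hS l hl)
  have hsub : ∀ q' ∈ TM2.stmts₁ q, ∀ v', RunState.run q' v' ∈ visited S := fun q' h v' =>
    run_mem_visited.2 ⟨l, hl, TM2.stmts₁_trans hql h⟩
  cases q with
  | push k f q => exact hsub q (by simp [TM2.stmts₁, TM2.stmts₁_self]) _
  | peek k f q => exact fun o => hsub q (by simp [TM2.stmts₁, TM2.stmts₁_self]) _
  | pop k f q => exact fun o => hsub q (by simp [TM2.stmts₁, TM2.stmts₁_self]) _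
  | load a q => exact fun _ => hsub q (by simp [TM2.stmts₁, TM2.stmts₁_self]) _
  | branch f q₁ q₂ =>
    refine fun _ => hsub _ ?_ _
    simp only [TM2.stmts₁, Finset.mem_insert, Finset.mem_union]
    cases f v
    · exact .inr (.inr TM2.stmts₁_self)
    · exact .inr (.inl TM2.stmts₁_self)
  | goto l' => exact fun _ => run_mem_visited.2 ⟨l' v, hsup v, TM2.stmts₁_self⟩
  | halt => exact fun _ => by simp [visited]

theorem leads_visited {S : Finset Λ'} (hS : ∀ l ∈ S, TM2.SupportsStmt S (tr l)) :
    ∀ q ∈ visited S, (runMachine q).Leads (· ∈ visited S)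
  | .run _ _, hq => leads_visited_of_run hS hq
  | .first, _ => fun o => by rcases o with _ | (_ | _ | _ | _) <;> simp [visited]
  | .buffer b, _ => fun o => by
    rcases o with _ | (_ | _ | _ | _) <;> cases b <;> simp [visited]
  | .flush b c, _ => by cases c <;> simp [visited, runMachine, Instr.Leads]
  | .done, _ => trivial

theorem exists_stackMachine_of_partrec {g : ℕ →. ℕ} (hg : Partrec g) :
    ∃ (Q : Type) (_ : Fintype Q) (_ : DecidableEq Q) (M : Q → Instr K' Γ' Q) (q₀ : Q),
      ∀ w s, wordNum s ∈ g (wordNum w) →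
        Produces M q₀ (K'.elim (terminated (w ++ [true])) [] [] []) s := by
  obtain ⟨c, hc⟩ := ToPartrec.Code.exists_code (Nat.Partrec'.part_iff₁.2 hg)
  have hsup := tr_supports c Cont'.halt
  obtain ⟨Q, i₁, i₂, M, q₀, hM⟩ := exists_fintype_produces_of_leads (leads_visited hsup.2)
    (run_mem_visited (v := none).2 ⟨_, hsup.1, TM2.stmts₁_self⟩)
  refine ⟨Q, i₁, i₂, M, q₀, fun w s hs => hM _ _ ?_⟩
  have hcode : [wordNum s] ∈ c.eval [wordNum w] := by
    rw [hc ⟨[wordNum w], rfl⟩]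
    exact Part.mem_map (fun x => [x]) hs
  have heval : halt [wordNum s] ∈ StateTransition.eval (TM2.step tr) (init c [wordNum w]) := by
    rw [tr_eval]
    exact Part.mem_map _ hcode
  have hfirst : Produces runMachine (cfgState (halt [wordNum s])) (halt [wordNum s]).stk s := by
    have := produces_first s
    rwa [← trList_wordNum] at this
  rw [← trList_wordNum]
  exact produces_cfgState_of_reaches (StateTransition.mem_eval.1 heval).1 hfirst

end StackMachine

section Realization

/-! ### Counting parameters -/

/-- The contribution of a parameter to `‖θ‖₀`. -/
def nonzeroCount (w : ℝ) : ℕ := if w = 0 then 0 else 1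

theorem card_filter_ne_zero (s : Multiset ℝ) [DecidablePred fun w : ℝ => w ≠ 0] :
    (s.filter (fun w => w ≠ 0)).card = (s.map nonzeroCount).sum := by
  induction s using Multiset.induction with
  | empty => rfl
  | cons a s ih =>
    by_cases h : a = 0
    · simp [h, ih, nonzeroCount]
    · rw [Multiset.filter_cons_of_pos (p := fun w : ℝ => w ≠ 0) _ h]
      simp [h, ih, nonzeroCount, add_comm]

theorem LoopedNet.l0_eq_sum (θ : LoopedNet) : θ.l0 = (θ.block.params.map nonzeroCount).sum :=
  @card_filter_ne_zero θ.block.params _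

theorem sum_map_layerParams {α : Type*} [AddCommMonoid α] {m n : ℕ}
    (A : Matrix (Fin n) (Fin m) ℝ) (b : Fin n → ℝ) (f : ℝ → α) :
    ((layerParams A b).map f).sum = (∑ i, ∑ j, f (A i j)) + ∑ i, f (b i) := by
  rw [layerParams, Multiset.map_add, Multiset.sum_add, Multiset.map_map, Multiset.map_map]
  congr 1
  exact Fintype.sum_prod_type' (fun i j => f (A i j))

theorem forall_mem_layerParams {m n : ℕ} {A : Matrix (Fin n) (Fin m) ℝ} {b : Fin n → ℝ}
    {P : ℝ → Prop} :
    (∀ w ∈ layerParams A b, P w) ↔ (∀ i j, P (A i j)) ∧ ∀ i, P (b i) := by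
  simp only [layerParams, Multiset.mem_add, or_imp, forall_and, Multiset.forall_mem_map_iff,
    Finset.mem_val, Finset.mem_univ, forall_const, Prod.forall]

theorem nonzeroCount_mul_intCast_le (δ : ℝ) (k : ℤ) : nonzeroCount (δ * k) ≤ k.natAbs := by
  unfold nonzeroCount
  split_ifs with h
  · exact Nat.zero_le _
  · exact Int.natAbs_pos.2 fun hk => h (by rw [hk, Int.cast_zero, mul_zero])

/-! ### Networks with one hidden layer -/

section OneHiddenLayer

variable {X Y : Type*} [Fintype X]

/-- The hidden values of a network without biases that has one hidden layer. -/
def hiddenVal (W₁ : Y → X → ℤ) (u : X → ℝ) (y : Y) : ℝ := max (∑ x, (W₁ y x : ℝ) * u x) 0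

/-- One iteration of a network without biases that has one hidden layer. Unlike the networks of the
theorem it starts in a state of our choice, and its integer weights are not bounded. -/
def homStep [Fintype Y] (W₁ : Y → X → ℤ) (W₂ : X → Y → ℤ) (u : X → ℝ) (x : X) : ℝ :=
  ∑ y, (W₂ x y : ℝ) * hiddenVal W₁ u y

/-- The iterates of `homStep`, started in `u₀`. -/
def traj [Fintype Y] (W₁ : Y → X → ℤ) (W₂ : X → Y → ℤ) (u₀ : X → ℤ) : ℕ → X → ℝ
  | 0 => fun x => (u₀ x : ℝ)
  | t + 1 => homStep W₁ W₂ (traj W₁ W₂ u₀ t)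

end OneHiddenLayer

section TwoLayerBlock

variable {S H : Type*}

/-- The block with one hidden layer whose state units `S` and hidden units `H` are numbered by `e`
and `f`, and whose parameters are `δ` times the given integers. -/
def twoLayerBlock (δ : ℝ) {n h : ℕ} (e : S ≃ Fin n) (f : H ≃ Fin h) (A₁ : H → S → ℤ)
    (b₁ : H → ℤ) (A₂ : S → H → ℤ) (b₂ : S → ℤ) : FFN n n :=
  .layer (Matrix.of fun i j => δ * A₁ (f.symm i) (e.symm j)) (fun i => δ * b₁ (f.symm i))
    (.last (Matrix.of fun i j => δ * A₂ (e.symm i) (f.symm j)) (fun i => δ * b₂ (e.symm i)))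

variable {δ : ℝ} {n h : ℕ} (e : S ≃ Fin n) (f : H ≃ Fin h) {A₁ : H → S → ℤ} {b₁ : H → ℤ}
  {A₂ : S → H → ℤ} {b₂ : S → ℤ}

theorem twoLayerBlock_eval [Fintype S] [Fintype H] (v : Fin n → ℝ) (s : S) :
    (twoLayerBlock δ e f A₁ b₁ A₂ b₂).eval v (e s) =
      (∑ y, δ * A₂ s y * max ((∑ x, δ * A₁ y x * v (e x)) + δ * b₁ y) 0) + δ * b₂ s := by
  simp only [twoLayerBlock, FFN.eval, relu, Matrix.mulVec, dotProduct, Pi.add_apply,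
    Equiv.symm_apply_apply, Matrix.of_apply]
  congr 1
  rw [← Equiv.sum_comp f]
  refine Finset.sum_congr rfl fun y _ => ?_
  rw [← Equiv.sum_comp e]
  simp only [Equiv.symm_apply_apply]

theorem twoLayerBlock_precision {M : ℝ} (hδ : 0 ≤ δ) (hM : δ ≤ M)
    (hA₁ : ∀ y x, (A₁ y x).natAbs ≤ 1) (hb₁ : ∀ y, (b₁ y).natAbs ≤ 1)
    (hA₂ : ∀ x y, (A₂ x y).natAbs ≤ 1) (hb₂ : ∀ x, (b₂ x).natAbs ≤ 1) :
    ∀ w ∈ (twoLayerBlock δ e f A₁ b₁ A₂ b₂).params, (∃ k : ℤ, w = δ * k) ∧ |w| ≤ M := by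
  have hunit : ∀ k : ℤ, k.natAbs ≤ 1 → (∃ j : ℤ, δ * k = δ * j) ∧ |δ * k| ≤ M := by
    intro k hk
    have hk' : |(k : ℝ)| ≤ 1 := by
      rw [← Int.cast_abs, Int.abs_eq_natAbs]
      exact_mod_cast hk
    refine ⟨⟨k, rfl⟩, ?_⟩
    rw [abs_mul, abs_of_nonneg hδ]
    exact (mul_le_of_le_one_right hδ hk').trans hM
  intro w hw
  rcases Multiset.mem_add.1 hw with hw | hw
  · exact forall_mem_layerParams (P := fun w => (∃ j : ℤ, w = δ * j) ∧ |w| ≤ M).2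
      ⟨fun _ _ => hunit _ (hA₁ _ _), fun _ => hunit _ (hb₁ _)⟩ w hw
  · exact forall_mem_layerParams (P := fun w => (∃ j : ℤ, w = δ * j) ∧ |w| ≤ M).2
      ⟨fun _ _ => hunit _ (hA₂ _ _), fun _ => hunit _ (hb₂ _)⟩ w hw

theorem sum_nonzeroCount_twoLayerBlock_le [Fintype S] [Fintype H] :
    ((twoLayerBlock δ e f A₁ b₁ A₂ b₂).params.map nonzeroCount).sum ≤
      ((∑ y, ∑ x, (A₁ y x).natAbs) + ∑ y, (b₁ y).natAbs) +
        ((∑ x, ∑ y, (A₂ x y).natAbs) + ∑ x, (b₂ x).natAbs) := by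
  simp only [twoLayerBlock, FFN.params, Multiset.map_add, Multiset.sum_add, sum_map_layerParams,
    Matrix.of_apply]
  rw [← Equiv.sum_comp f, ← Equiv.sum_comp f, ← Equiv.sum_comp e (fun i => ∑ j, _),
    ← Equiv.sum_comp e (fun i => nonzeroCount _)]
  simp only [Equiv.symm_apply_apply]
  gcongr with y _ y _ x _ x _
  · rw [← Equiv.sum_comp e]
    simp only [Equiv.symm_apply_apply]
    exact Finset.sum_le_sum fun _ _ => nonzeroCount_mul_intCast_le _ _
  · exact nonzeroCount_mul_intCast_le _ _
  · rw [← Equiv.sum_comp f]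
    simp only [Equiv.symm_apply_apply]
    exact Finset.sum_le_sum fun _ _ => nonzeroCount_mul_intCast_le _ _
  · exact nonzeroCount_mul_intCast_le _ _

end TwoLayerBlock

/-! ### Replacing integer weights by copies of units -/

/-- The weight `w` spread over copies of its source: the `c`-th copy gets the weight `±1` if
`c < |w|`. Since `M` may be as small as `δ`, larger integer weights are not available. -/
def spread (w : ℤ) (c : ℕ) : ℤ := if c < w.natAbs then w.sign else 0

theorem natAbs_spread (w : ℤ) (c : ℕ) : (spread w c).natAbs = if c < w.natAbs then 1 else 0 := by
  unfold spread
  split_ifs with h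
  · exact Int.natAbs_sign_of_ne_zero (Int.natAbs_pos.1 (c.zero_le.trans_lt h))
  · rfl

theorem natAbs_spread_le_one (w : ℤ) (c : ℕ) : (spread w c).natAbs ≤ 1 := by
  rw [natAbs_spread]
  split_ifs <;> omega

theorem sum_spread {w : ℤ} {m : ℕ} (h : w.natAbs ≤ m) : ∑ c : Fin m, spread w c = w := by
  have hfilter : (Finset.range m).filter (fun c => c < w.natAbs) = Finset.range w.natAbs := by
    ext c
    simp only [Finset.mem_filter, Finset.mem_range]
    omega
  rw [Fin.sum_univ_eq_sum_range (fun c => spread w c)]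
  unfold spread
  rw [Finset.sum_ite, Finset.sum_const_zero, add_zero, Finset.sum_const, hfilter,
    Finset.card_range, nsmul_eq_mul, mul_comm]
  exact Int.sign_mul_natAbs w

theorem sum_natAbs_spread_le (w : ℤ) (m : ℕ) : ∑ c : Fin m, (spread w c).natAbs ≤ w.natAbs := by
  rw [Fin.sum_univ_eq_sum_range (fun c => (spread w c).natAbs)]
  simp only [natAbs_spread]
  rw [← Finset.card_filter]
  calc _ ≤ (Finset.range w.natAbs).card :=
        Finset.card_le_card fun c hc => Finset.mem_range.2 (Finset.mem_filter.1 hc).2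
    _ = w.natAbs := Finset.card_range _

theorem exists_equiv_fin_three {S : Type*} [Finite S] {s : Fin 3 → S}
    (hs : Function.Injective s) :
    ∃ (n : ℕ) (_ : 3 ≤ n) (e : S ≃ Fin n), ∀ i : Fin 3, (e (s i) : ℕ) = i := by
  cases nonempty_fintype S
  have hcard : 3 ≤ Fintype.card S := by simpa using Fintype.card_le_of_injective s hs
  let e₀ := Fintype.equivFin S
  let ι : Fin 3 → Fin (Fintype.card S) := Fin.castLE hcard
  obtain ⟨σ, hσ⟩ := Equiv.Perm.exists_extending_pair (e₀ ∘ s) ι (e₀.injective.comp hs)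
    (Fin.castLE_injective hcard)
  exact ⟨_, hcard, e₀.trans σ, fun i => congrArg Fin.val (hσ i)⟩

section CopyBlock

variable {X Y : Type*} (W₁ : Y → X → ℤ) (W₂ : X → Y → ℤ) (u₀ : X → ℤ) (mX : X → ℕ) (mY : Y → ℕ)
  (m : ℕ)

/-- State units: `mX x` copies of each state variable `x`, and `m` units that are `0` at time `0`
and have the value `δ` from time `1` on. -/
abbrev StateUnit (mX : X → ℕ) (m : ℕ) : Type _ := (Σ x, Fin (mX x)) ⊕ Fin m

/-- Hidden units: `mY y` copies of each hidden variable `y`, and a unit that fires only at time `0`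
and thereby writes the initial state. -/
abbrev HiddenUnit (mY : Y → ℕ) : Type _ := (Σ y, Fin (mY y)) ⊕ Unit

/-- Weights of the first layer. -/
def copyWeights₁ : HiddenUnit mY → StateUnit mX m → ℤ
  | .inl y, .inl x => spread (W₁ y.1 x.1) x.2
  | .inl _, .inr _ => 0
  | .inr _, .inl _ => 0
  | .inr _, .inr _ => -1

/-- Biases of the first layer. -/
def copyBias₁ : HiddenUnit mY → ℤ
  | .inl _ => 0
  | .inr _ => 1

/-- Weights of the second layer. -/
def copyWeights₂ : StateUnit mX m → HiddenUnit mY → ℤ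
  | .inl x, .inl y => spread (W₂ x.1 y.1) y.2
  | .inl x, .inr _ => u₀ x.1
  | .inr _, _ => 0

/-- Biases of the second layer. -/
def copyBias₂ : StateUnit mX m → ℤ
  | .inl _ => 0
  | .inr _ => 1

/-- The block with parameters in `{-δ, 0, δ}` that simulates `homStep W₁ W₂`, started in `u₀`, by
means of copies of the units. -/
def copyBlock (δ : ℝ) {n h : ℕ} (e : StateUnit mX m ≃ Fin n) (f : HiddenUnit mY ≃ Fin h) :
    FFN n n :=
  twoLayerBlock δ e f (copyWeights₁ W₁ mX mY m) (copyBias₁ mY) (copyWeights₂ W₂ u₀ mX mY m)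
    (copyBias₂ mX m)

variable {W₁ W₂ u₀ mX mY m} {δ : ℝ} {n h : ℕ} (e : StateUnit mX m ≃ Fin n)
  (f : HiddenUnit mY ≃ Fin h)

theorem copyBlock_precision {M : ℝ} (hδ : 0 ≤ δ) (hM : δ ≤ M) (h₀ : ∀ x, (u₀ x).natAbs ≤ 1) :
    ∀ w ∈ (copyBlock W₁ W₂ u₀ mX mY m δ e f).params, (∃ k : ℤ, w = δ * k) ∧ |w| ≤ M := by
  refine twoLayerBlock_precision e f hδ hM ?_ ?_ ?_ ?_
  · rintro (_ | _) (_ | _) <;> simp [copyWeights₁, natAbs_spread_le_one]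
  · rintro (_ | _) <;> simp [copyBias₁]
  · rintro (x | _) (_ | _) <;> simp [copyWeights₂, natAbs_spread_le_one, h₀]
  · rintro (_ | _) <;> simp [copyBias₂]

theorem copyBlock_eval_const [Finite X] [Finite Y] (v : Fin n → ℝ) (c : Fin m) :
    (copyBlock W₁ W₂ u₀ mX mY m δ e f).eval v (e (.inr c)) = δ := by
  cases nonempty_fintype X
  cases nonempty_fintype Y
  simp [copyBlock, twoLayerBlock_eval, copyWeights₂, copyBias₂]

variable [Fintype X] [Fintype Y]

theorem copyBlock_eval_copy (h₂ : ∀ x y, (W₂ x y).natAbs ≤ mY y) (v : Fin n → ℝ)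
    (x : Σ x, Fin (mX x)) :
    (copyBlock W₁ W₂ u₀ mX mY m δ e f).eval v (e (.inl x)) =
      δ * (∑ y, (W₂ x.1 y : ℝ) *
        max (δ * ∑ x' : X, ∑ c : Fin (mX x'), (spread (W₁ y x') c : ℝ) * v (e (.inl ⟨x', c⟩))) 0) +
      δ * u₀ x.1 * max (δ - δ * ∑ c, v (e (.inr c))) 0 := by
  have hspread : ∀ y, ∑ c : Fin (mY y), δ * (spread (W₂ x.1 y) c : ℝ) = δ * W₂ x.1 y := fun y => by
    rw [← Finset.mul_sum, ← Int.cast_sum, sum_spread (h₂ _ _)]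
  simp only [copyBlock, twoLayerBlock_eval, Fintype.sum_sum_type, copyWeights₁, copyWeights₂,
    copyBias₁, copyBias₂, Fintype.sum_sigma, Finset.univ_unique, Finset.sum_singleton,
    Int.cast_zero, mul_zero, zero_mul, Finset.sum_const_zero, add_zero, zero_add,
    Int.cast_neg, Int.cast_one, mul_one, mul_neg, neg_mul, Finset.sum_neg_distrib]
  congr 1
  · rw [Finset.mul_sum]
    refine Finset.sum_congr rfl fun y _ => ?_
    rw [← Finset.sum_mul, hspread, mul_assoc]
    simp only [Finset.mul_sum, mul_assoc]
  · rw [Finset.mul_sum, neg_add_eq_sub]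

theorem copyBlock_iterate (hδ : 0 ≤ δ) (h₁ : ∀ y x, (W₁ y x).natAbs ≤ mX x)
    (h₂ : ∀ x y, (W₂ x y).natAbs ≤ mY y) (hm : 1 ≤ m * δ) (t : ℕ) (x : Σ x, Fin (mX x)) :
    (copyBlock W₁ W₂ u₀ mX mY m δ e f).eval^[t + 1] 0 (e (.inl x)) =
      δ ^ (2 * (t + 1)) * traj W₁ W₂ u₀ t x.1 := by
  induction t generalizing x with
  | zero =>
    rw [zero_add, Function.iterate_one, copyBlock_eval_copy e f h₂]
    simp [traj, max_eq_left hδ]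
    ring
  | succ t ih =>
    set v := (copyBlock W₁ W₂ u₀ mX mY m δ e f).eval^[t + 1] 0 with hv
    have hconst : ∀ c, v (e (.inr c)) = δ := fun c => by
      rw [hv, Function.iterate_succ_apply', copyBlock_eval_const]
    have hstart : max (δ - δ * ∑ c : Fin m, v (e (.inr c))) 0 = 0 := by
      simp only [hconst, Finset.sum_const, Finset.card_univ, Fintype.card_fin, nsmul_eq_mul]
      exact max_eq_right (sub_nonpos.2 (le_mul_of_one_le_right hδ hm))
    have hhidden : ∀ y, max (δ * ∑ x' : X, ∑ c : Fin (mX x'),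
        (spread (W₁ y x') c : ℝ) * v (e (.inl ⟨x', c⟩))) 0 =
        δ * δ ^ (2 * (t + 1)) * hiddenVal W₁ (traj W₁ W₂ u₀ t) y := fun y => by
      simp only [ih, ← Finset.sum_mul, ← Int.cast_sum, sum_spread (h₁ _ _)]
      rw [hiddenVal, mul_max_of_nonneg _ _ (by positivity), mul_zero, mul_assoc, Finset.mul_sum,
        Finset.mul_sum, Finset.mul_sum]
      congr 1
      exact Finset.sum_congr rfl fun x' _ => by ring
    rw [Function.iterate_succ_apply', copyBlock_eval_copy e f h₂, hstart, mul_zero, add_zero]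
    rw [Finset.sum_congr rfl fun y _ => congrArg ((W₂ x.1 y : ℝ) * ·) (hhidden y)]
    rw [traj, homStep, Finset.mul_sum, Finset.mul_sum]
    exact Finset.sum_congr rfl fun y _ => by ring

theorem sum_nonzeroCount_copyBlock_le :
    ((copyBlock W₁ W₂ u₀ mX mY m δ e f).params.map nonzeroCount).sum ≤
      (∑ y, mY y * ∑ x, (W₁ y x).natAbs) + (∑ x, mX x * ∑ y, (W₂ x y).natAbs) +
        (∑ x, mX x * (u₀ x).natAbs) + (2 * m + 1) := by
  have hfirst : ∑ y, mY y * ∑ x, ∑ c : Fin (mX x), (spread (W₁ y x) c).natAbs ≤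
      ∑ y, mY y * ∑ x, (W₁ y x).natAbs := by
    gcongr
    exact sum_natAbs_spread_le _ _
  have hsecond : ∑ x, mX x * ∑ y, ∑ c : Fin (mY y), (spread (W₂ x y) c).natAbs ≤
      ∑ x, mX x * ∑ y, (W₂ x y).natAbs := by
    gcongr
    exact sum_natAbs_spread_le _ _
  refine (sum_nonzeroCount_twoLayerBlock_le e f).trans ?_
  simp only [Fintype.sum_sum_type, copyWeights₁, copyWeights₂, copyBias₁, copyBias₂,
    Fintype.sum_sigma, Finset.univ_unique, Finset.sum_singleton, Int.natAbs_zero,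
    Finset.sum_const_zero, add_zero, zero_add, Int.natAbs_neg, Int.natAbs_one, Finset.sum_const,
    Finset.card_univ, Fintype.card_fin, smul_eq_mul, mul_one, Finset.sum_add_distrib,
    Finset.card_singleton, one_mul]
  omega

end CopyBlock

/-- The scalar `δ ^ (2 * t)` accumulates because each of the two layers multiplies by `δ`. It is
harmless, since the three channels are only tested for positivity. -/
theorem exists_loopedNet_traj {X Y : Type*} [Fintype X] [Fintype Y] {W₁ : Y → X → ℤ}
    {W₂ : X → Y → ℤ} {u₀ : X → ℤ} {mX : X → ℕ} {mY : Y → ℕ} {m : ℕ} {δ M : ℝ}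
    (hδ : 0 ≤ δ) (hM : δ ≤ M)
    (h₁ : ∀ y x, (W₁ y x).natAbs ≤ mX x) (h₂ : ∀ x y, (W₂ x y).natAbs ≤ mY y)
    (h₀ : ∀ x, (u₀ x).natAbs ≤ 1) (hm : 1 ≤ m * δ) {ch : Fin 3 → X}
    (hch : Function.Injective ch) (hpos : ∀ i, 0 < mX (ch i)) :
    ∃ θ : LoopedNet, θ.HasPrecision δ M ∧
      θ.l0 ≤ (∑ y, mY y * ∑ x, (W₁ y x).natAbs) + (∑ x, mX x * ∑ y, (W₂ x y).natAbs) +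
        (∑ x, mX x * (u₀ x).natAbs) + (2 * m + 1) ∧
      ∀ t, θ.haltCh (t + 1) = δ ^ (2 * (t + 1)) * traj W₁ W₂ u₀ t (ch 0) ∧
        θ.emitCh (t + 1) = δ ^ (2 * (t + 1)) * traj W₁ W₂ u₀ t (ch 1) ∧
        θ.bitCh (t + 1) = δ ^ (2 * (t + 1)) * traj W₁ W₂ u₀ t (ch 2) := by
  let s : Fin 3 → StateUnit mX m := fun i => .inl ⟨ch i, ⟨0, hpos i⟩⟩
  have hs : Function.Injective s := fun i j h => by
    simp only [s, Sum.inl.injEq, Sigma.mk.injEq] at h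
    exact hch h.1
  obtain ⟨n, hn, e, he⟩ := exists_equiv_fin_three hs
  let f := Fintype.equivFin (HiddenUnit mY)
  have hchannel : ∀ (i : Fin 3) (h : (i : ℕ) < n) t,
      (copyBlock W₁ W₂ u₀ mX mY m δ e f).eval^[t + 1] 0 ⟨i, h⟩ =
        δ ^ (2 * (t + 1)) * traj W₁ W₂ u₀ t (ch i) := fun i h t => by
    rw [← copyBlock_iterate e f hδ h₁ h₂ hm t ⟨ch i, ⟨0, hpos i⟩⟩]
    exact congrArg _ (Fin.ext (he i).symm)
  refine ⟨⟨n, hn, copyBlock W₁ W₂ u₀ mX mY m δ e f⟩, copyBlock_precision e f hδ hM h₀, ?_,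
    fun t => ⟨hchannel 0 _ t, hchannel 1 _ t, hchannel 2 _ t⟩⟩
  rw [LoopedNet.l0_eq_sum]
  exact sum_nonzeroCount_copyBlock_le e f

end Realization

/-! ### Stacks as real numbers -/

section Stacks

open Turing.PartrecToTM2

/-- The digit of a stack symbol. -/
def symDigit : Γ' → ℕ
  | .bit0 => 1
  | .bit1 => 2
  | .cons => 3
  | .consₗ => 4

/-- The digit on top of a stack, `0` for an empty stack. -/
def topDigit : Option Γ' → ℕ
  | none => 0
  | some a => symDigit a

theorem topDigit_injective : Function.Injective topDigit := by
  intro a b h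
  rcases a with _ | (_ | _ | _ | _) <;> rcases b with _ | (_ | _ | _ | _) <;>
    simp_all [topDigit, symDigit]

theorem topDigit_le_four (o : Option Γ') : topDigit o ≤ 4 := by
  rcases o with _ | (_ | _ | _ | _) <;> simp [topDigit, symDigit]

/-- The contents of a stack as a decimal fraction with digits `2`, `4`, `6`, `8`. The gaps between
the digits allow a ReLU network to read the top of the stack, as in the simulation of Turing
machines by Siegelmann and Sontag. -/
def stackVal : List Γ' → ℝ
  | [] => 0
  | a :: l => (2 * symDigit a + stackVal l) / 10

theorem stackVal_nonneg (l : List Γ') : 0 ≤ stackVal l := by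
  induction l with
  | nil => exact le_rfl
  | cons a l ih => simp only [stackVal]; positivity

theorem stackVal_le_one (l : List Γ') : stackVal l ≤ 1 := by
  induction l with
  | nil => simp [stackVal]
  | cons a l ih =>
    have hdigit : (symDigit a : ℝ) ≤ 4 := by exact_mod_cast topDigit_le_four (some a)
    simp only [stackVal]
    linarith

theorem ten_mul_stackVal (l : List Γ') :
    10 * stackVal l = 2 * topDigit l.head? + stackVal l.tail := by
  cases l with
  | nil => simp [stackVal, topDigit]
  | cons a l => simp [stackVal, topDigit]; ring

theorem max_stackVal_sub_max_stackVal (l : List Γ') (m : ℕ) :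
    max (10 * stackVal l - (2 * m + 1)) 0 - max (10 * stackVal l - (2 * m + 2)) 0 =
      if m + 1 ≤ topDigit l.head? then 1 else 0 := by
  have hval := ten_mul_stackVal l
  have hnonneg := stackVal_nonneg l.tail
  have hle := stackVal_le_one l.tail
  split_ifs with h
  · have h' : (m : ℝ) + 1 ≤ topDigit l.head? := by exact_mod_cast h
    rw [max_eq_left (by linarith), max_eq_left (by linarith)]
    ring
  · have h' : (topDigit l.head? : ℝ) ≤ m := by exact_mod_cast Nat.lt_succ_iff.1 (not_le.1 h)
    rw [max_eq_right (by linarith), max_eq_right (by linarith), sub_zero]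

end Stacks

/-! ### The simulating network -/

section Simulation

open Turing.PartrecToTM2
open Finsupp (single)

instance : Fintype K' := ⟨{.main, .rev, .aux, .stack}, fun k => by cases k <;> simp⟩

/-- A block of three program bits. A cell of the program chain costs three parameters, so it must
hold three bits. -/
abbrev Triple : Type := Bool × Bool × Bool

/-- State variables of the simulating network, without the chain that holds the program. All of
them are scaled by the value of `ref`. -/
inductive SimVar (Q : Type*)
  /-- the scale `1000 ^ t` -/
  | ref
  /-- grows faster than `ref` once the program is loaded, and starts the machine on reaching it -/
  | timer
  /-- signals the end of the program chain -/
  | fin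
  /-- signals that the current cell of the chain holds the triple `j` -/
  | kind (j : Triple)
  /-- the control state is `q` -/
  | st (q : Q)
  /-- the three channels -/
  | out (i : Fin 3)
  /-- the contents of stack `k` -/
  | stk (k : K')
  deriving DecidableEq, Fintype

/-- Hidden variables of the simulating network, without chain and collectors. -/
inductive SimHid (Q : Type*)
  /-- fires when the machine is to be started -/
  | start
  /-- thresholds that read the top of the stack if the control state is `q` -/
  | thr (q : Q) (d : Fin 4) (b : Bool)
  /-- the contents of stack `k` if the control state is `q`, and `0` otherwise -/
  | gate (q : Q) (k : K')
  | ref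
  | timer
  | fin
  | kind (j : Triple)
  | st (q : Q)
  | stk (k : K')
  deriving Fintype

/-- Three bits as decimal digits, scaled by `1000`. -/
def tripleVal (j : Triple) : ℤ :=
  1000 * (200 * symDigit (bitSym j.1) + 20 * symDigit (bitSym j.2.1) +
    2 * symDigit (bitSym j.2.2))

/-- The value of an integer linear form. -/
abbrev formVal {α : Type*} (u : α → ℝ) : (α →₀ ℤ) →ₗ[ℤ] ℝ := Finsupp.linearCombination ℤ u

theorem formVal_eq_sum {α : Type*} [Fintype α] (u : α → ℝ) (f : α →₀ ℤ) :
    formVal u f = ∑ a, (f a : ℝ) * u a := by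
  rw [Finsupp.linearCombination_apply, Finsupp.sum_fintype _ _ (by simp)]
  simp only [zsmul_eq_mul]

section Weights

variable {Q : Type*} (M : Q → Instr K' Γ' Q) {L : List Triple}

/-- The stack read by a state, where states that read no stack get an arbitrary one. -/
def readStack (q : Q) : K' :=
  match M q with
  | .push k _ _ => k
  | .pop k _ => k
  | .peek k _ => k
  | .emit _ _ => .main
  | .halt => .main

/-- The forms of the hidden variables. -/
def hidForm : SimHid Q → SimVar Q →₀ ℤ
  | .ref => single .ref 1
  | .timer => single .timer 1
  | .start => single .timer 10 - single .ref 9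
  | .fin => single .fin 1
  | .kind j => single (.kind j) 1
  | .st q => single (.st q) 1
  | .stk k => single (.stk k) 1
  | .gate q k => single (.stk k) 1 - single .ref 1 + single (.st q) 1
  | .thr q d b => single (.stk (readStack M q)) 10 -
      single .ref (2 * (d : ℕ) + 1 + b.toNat + 10 : ℤ) + single (.st q) 10

/-- The form with value `1` if the machine is in state `q` and the digit on top of the stack that
`q` reads is at least `m`. -/
def topForm (q : Q) : ℕ → SimHid Q →₀ ℤ
  | 0 => single (.st q) 1
  | m + 1 => if h : m < 4 then single (.thr q ⟨m, h⟩ false) 1 - single (.thr q ⟨m, h⟩ true) 1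
      else 0

/-- The change of stack `k` in state `q`, scaled by `1000`. -/
def stackForm (q : Q) (k : K') : SimHid Q →₀ ℤ :=
  match M q with
  | .push k' a _ => if k' = k then
      single (.st q) (200 * symDigit a : ℤ) - single (.gate q k) 900 else 0
  | .pop k' _ => if k' = k then
      single (.gate q k) 9000 - ∑ m ∈ Finset.range 4, (2000 : ℤ) • topForm q (m + 1) else 0
  | _ => 0

variable [DecidableEq Q]

/-- The form with value `1` if the machine is in state `q` and `f` sends the top of the stack that
`q` reads to the state `q'`. -/
def readForm (q : Q) (f : Option Γ' → Q) (q' : Q) : SimHid Q →₀ ℤ :=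
  ∑ o, if f o = q' then topForm q (topDigit o) - topForm q (topDigit o + 1) else 0

/-- The form with value `1` if the machine goes from state `q` to state `q'`. -/
def transForm (q q' : Q) : SimHid Q →₀ ℤ :=
  match M q with
  | .push _ _ p => if p = q' then single (.st q) 1 else 0
  | .pop _ f => readForm q f q'
  | .peek _ f => readForm q f q'
  | .emit _ p => if p = q' then single (.st q) 1 else 0
  | .halt => 0

/-- The forms of the three channels. -/
def outForm (q : Q) (i : Fin 3) : SimHid Q →₀ ℤ :=
  match M q with
  | .emit b _ => if i = 1 ∨ (i = 2 ∧ b = true) then single (.st q) 1 else 0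
  | .halt => if i = 0 then single (.st q) 1 else 0
  | _ => 0

/-- The forms of the state variables. -/
def varForm [Fintype Q] (q₀ : Q) : SimVar Q → SimHid Q →₀ ℤ
  | .ref => single .ref 1000
  | .timer => single .timer 10000 - single .start 10000 + single .fin 1
  | .fin => 0
  | .kind _ => 0
  | .st q' => (1000 : ℤ) • (∑ q, transForm M q q') + if q' = q₀ then single .start 1000 else 0
  | .stk k => single (.stk k) 1000 + (∑ q, stackForm M q k) +
      if k = .main then (∑ j, single (.kind j) (tripleVal j)) +
        single .fin (1000 * (200 * symDigit .cons) : ℤ) else 0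
  | .out i => ∑ q, outForm M q i

variable (L)

/-- State variables including the program chain, along which a single `1` travels. -/
abbrev FullVar (Q : Type*) (L : List Triple) : Type _ := SimVar Q ⊕ Fin (L.length + 1)

/-- Hidden variables including the chain and, for each triple, a collector of the cells of the
chain that hold it. -/
abbrev FullHid (Q : Type*) (L : List Triple) : Type _ := SimHid Q ⊕ Triple ⊕ Fin (L.length + 1)

/-- Weights of the first layer. -/
def fullW₁ : FullHid Q L → FullVar Q L → ℤ
  | .inl h, .inl v => hidForm M h v
  | .inl _, .inr _ => 0
  | .inr _, .inl _ => 0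
  | .inr (.inl j), .inr i => if L[i.1]? = some j then 1 else 0
  | .inr (.inr i'), .inr i => if i' = i then 1 else 0

/-- Weights of the second layer. -/
def fullW₂ [Fintype Q] (q₀ : Q) : FullVar Q L → FullHid Q L → ℤ
  | .inl v, .inl h => varForm M q₀ v h
  | .inl v, .inr (.inl j) => if v = .kind j then 1 else 0
  | .inl v, .inr (.inr i) => if v = .fin ∧ i = Fin.last _ then 1 else 0
  | .inr _, .inl _ => 0
  | .inr _, .inr (.inl _) => 0
  | .inr i, .inr (.inr i') => if i'.1 + 1 = i.1 then 1 else 0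

/-- The initial values. -/
def fullInit : FullVar Q L → ℤ
  | .inl v => if v = .ref then 1 else 0
  | .inr i => if i.1 = 0 then 1 else 0

variable [Fintype Q] (q₀ : Q)

/-- The hidden values of the simulating network. -/
def simHid (u : FullVar Q L → ℝ) : FullHid Q L → ℝ := hiddenVal (fullW₁ M L) u

/-- One iteration of the simulating network. -/
def simStep (u : FullVar Q L → ℝ) : FullVar Q L → ℝ := homStep (fullW₁ M L) (fullW₂ M L q₀) u

/-- The trajectory of the simulating network. -/
def simTraj : ℕ → FullVar Q L → ℝ := traj (fullW₁ M L) (fullW₂ M L q₀) (fullInit L)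

end Weights

section Step

variable {Q : Type*} [Fintype Q] (M : Q → Instr K' Γ' Q) {L : List Triple} (u : FullVar Q L → ℝ)

/-- The value of a form of hidden variables. -/
abbrev hidVal : (SimHid Q →₀ ℤ) →ₗ[ℤ] ℝ := formVal fun h => simHid M L u (.inl h)

theorem simHid_inl (h : SimHid Q) :
    simHid M L u (.inl h) = max (formVal (fun v => u (.inl v)) (hidForm M h)) 0 := by
  rw [simHid, hiddenVal, Fintype.sum_sum_type, formVal_eq_sum]
  simp [fullW₁]

theorem simHid_collector (j : Triple) : simHid M L u (.inr (.inl j)) =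
    max (∑ i : Fin (L.length + 1), if L[i.1]? = some j then u (.inr i) else 0) 0 := by
  rw [simHid, hiddenVal, Fintype.sum_sum_type]
  simp [fullW₁]

theorem simHid_chain (i : Fin (L.length + 1)) :
    simHid M L u (.inr (.inr i)) = max (u (.inr i)) 0 := by
  rw [simHid, hiddenVal, Fintype.sum_sum_type]
  simp [fullW₁]

variable [DecidableEq Q] (q₀ : Q)

theorem simStep_inl (v : SimVar Q) : simStep M L q₀ u (.inl v) =
    hidVal M u (varForm M q₀ v) +
      ((∑ j, if v = .kind j then simHid M L u (.inr (.inl j)) else 0) +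
        if v = .fin then simHid M L u (.inr (.inr (Fin.last _))) else 0) := by
  rw [simStep, homStep, Fintype.sum_sum_type, Fintype.sum_sum_type, hidVal, formVal_eq_sum]
  congr 2
  · simp [fullW₂, simHid]
  · by_cases hv : v = .fin <;> simp [fullW₂, simHid, hv]

theorem simStep_chain_zero (i : Fin (L.length + 1)) (hi : i.1 = 0) :
    simStep M L q₀ u (.inr i) = 0 := by
  rw [simStep, homStep, Fintype.sum_sum_type, Fintype.sum_sum_type]
  simp [fullW₂, hi]

theorem simStep_chain_succ {i i' : Fin (L.length + 1)} (hi : i'.1 + 1 = i.1) :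
    simStep M L q₀ u (.inr i) = max (u (.inr i')) 0 := by
  have hpred : ∀ k : Fin (L.length + 1), k.1 + 1 = i.1 ↔ k = i' := fun k => by
    rw [Fin.ext_iff]
    omega
  rw [simStep, homStep, Fintype.sum_sum_type, Fintype.sum_sum_type, ← simHid_chain M u i']
  simp [fullW₂, simHid, hpred]

/-- The values `u` encode, at scale `R`, the stacks `S` and the control state `qo`, where `none`
means that the machine has not been started yet. -/
structure Control (u : FullVar Q L → ℝ) (R : ℝ) (qo : Option Q) (S : K' → List Γ') : Prop where
  pos : 0 < R
  ref : u (.inl .ref) = R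
  st : ∀ q, u (.inl (.st q)) = if qo = some q then R else 0
  stk : ∀ k, u (.inl (.stk k)) = R * stackVal (S k)

variable {M u} {R : ℝ} {qo : Option Q} {S : K' → List Γ'} {q : Q}

namespace Control

theorem hid_ref (hc : Control u R qo S) : simHid M L u (.inl .ref) = R := by
  simp [simHid_inl, hidForm, hc.ref, hc.pos.le]

theorem hid_st (hc : Control u R qo S) (q : Q) :
    simHid M L u (.inl (.st q)) = if qo = some q then R else 0 := by
  simp only [simHid_inl, hidForm, Finsupp.linearCombination_single, one_smul, hc.st]
  split_ifs
  · exact max_eq_left hc.pos.le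
  · exact max_self _

theorem hid_stk (hc : Control u R qo S) (k : K') :
    simHid M L u (.inl (.stk k)) = R * stackVal (S k) := by
  simp [simHid_inl, hidForm, hc.stk, mul_nonneg hc.pos.le (stackVal_nonneg (S k))]

theorem hid_gate (hc : Control u R qo S) (q : Q) (k : K') :
    simHid M L u (.inl (.gate q k)) = if qo = some q then R * stackVal (S k) else 0 := by
  have hnonneg := mul_nonneg hc.pos.le (stackVal_nonneg (S k))
  have hle := mul_le_mul_of_nonneg_left (stackVal_le_one (S k)) hc.pos.le
  simp only [simHid_inl, hidForm, Finsupp.linearCombination_single, one_smul, hc.st, hc.stk,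
    hc.ref, map_add, map_sub]
  split_ifs
  · rw [max_eq_left (by linarith)]
    ring
  · rw [max_eq_right (by linarith)]

theorem hid_thr (hc : Control u R qo S) (q : Q) (d : Fin 4) (b : Bool) :
    simHid M L u (.inl (.thr q d b)) = if qo = some q then
      R * max (10 * stackVal (S (readStack M q)) - (2 * (d : ℕ) + 1 + b.toNat)) 0 else 0 := by
  have hpos := hc.pos
  have hle := mul_le_mul_of_nonneg_left (stackVal_le_one (S (readStack M q))) hpos.le
  simp only [simHid_inl, hidForm, Finsupp.linearCombination_single, hc.st, hc.stk, hc.ref,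
    map_add, map_sub, zsmul_eq_mul]
  push_cast
  split_ifs
  · rw [mul_max_of_nonneg _ _ hpos.le, mul_zero]
    congr 1
    ring
  · have hthr : 0 ≤ (2 * ((d : ℕ) : ℝ) + 1 + (b.toNat : ℝ)) * R := by positivity
    exact max_eq_right (by linarith)

theorem top_inactive (hc : Control u R qo S) (hq : qo ≠ some q) (m : ℕ) :
    hidVal M u (topForm q m) = 0 := by
  cases m with
  | zero => simp [topForm, hc.hid_st, hq]
  | succ m =>
    rw [topForm]
    split_ifs
    · simp [hc.hid_thr, hq]
    · exact map_zero _

theorem top_active (hc : Control u R (some q) S) (m : ℕ) :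
    hidVal M u (topForm q m) =
      if m ≤ topDigit (S (readStack M q)).head? then R else 0 := by
  cases m with
  | zero => simp [topForm, hc.hid_st]
  | succ m =>
    have hread := max_stackVal_sub_max_stackVal (S (readStack M q)) m
    have htop := topDigit_le_four (S (readStack M q)).head?
    rw [topForm]
    split_ifs with hm hle hle
    · simp only [map_sub, Finsupp.linearCombination_single, one_smul, hc.hid_thr, if_true,
        Bool.toNat_false, Bool.toNat_true, Nat.cast_zero, Nat.cast_one, add_zero, add_assoc,
        one_add_one_eq_two]
      rw [← mul_sub, hread, if_pos hle, mul_one]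
    · simp only [map_sub, Finsupp.linearCombination_single, one_smul, hc.hid_thr, if_true,
        Bool.toNat_false, Bool.toNat_true, Nat.cast_zero, Nat.cast_one, add_zero, add_assoc,
        one_add_one_eq_two]
      rw [← mul_sub, hread, if_neg hle, mul_zero]
    · omega
    · exact map_zero _

theorem top_sub_top (hc : Control u R (some q) S) (o : Option Γ') :
    hidVal M u (topForm q (topDigit o) - topForm q (topDigit o + 1)) =
      if o = (S (readStack M q)).head? then R else 0 := by
  rw [map_sub, hc.top_active, hc.top_active]
  by_cases ho : o = (S (readStack M q)).head?
  · simp [ho]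
  · have hdigit := topDigit_injective.ne ho
    rw [if_neg ho]
    split_ifs <;> first | omega | simp

theorem read_inactive (hc : Control u R qo S) (hq : qo ≠ some q) (f : Option Γ' → Q) (q' : Q) :
    hidVal M u (readForm q f q') = 0 := by
  rw [readForm, map_sum]
  refine Finset.sum_eq_zero fun o _ => ?_
  split_ifs
  · rw [map_sub, hc.top_inactive hq, hc.top_inactive hq, sub_zero]
  · exact map_zero _

theorem read_active (hc : Control u R (some q) S) (f : Option Γ' → Q) (q' : Q) :
    hidVal M u (readForm q f q') = if f (S (readStack M q)).head? = q' then R else 0 := by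
  rw [readForm, map_sum, Finset.sum_eq_single (S (readStack M q)).head?]
  · rw [apply_ite (hidVal M u), hc.top_sub_top, if_pos rfl, map_zero]
  · intro o _ ho
    rw [apply_ite (hidVal M u), hc.top_sub_top, if_neg ho, map_zero, ite_self]
  · exact fun h => absurd (Finset.mem_univ _) h

theorem trans_inactive (hc : Control u R qo S) (hq : qo ≠ some q) (q' : Q) :
    hidVal M u (transForm M q q') = 0 := by
  unfold transForm
  cases M q with
  | push k a p => simp only; split_ifs <;> simp [hc.hid_st, hq]
  | pop k f => exact hc.read_inactive hq f q'
  | peek k f => exact hc.read_inactive hq f q'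
  | emit b p => simp only; split_ifs <;> simp [hc.hid_st, hq]
  | halt => exact map_zero _

theorem stack_inactive (hc : Control u R qo S) (hq : qo ≠ some q) (k : K') :
    hidVal M u (stackForm M q k) = 0 := by
  unfold stackForm
  cases M q with
  | push k' a p =>
    simp only
    split_ifs
    · simp only [map_sub, Finsupp.linearCombination_single, hc.hid_st, hc.hid_gate, hq, if_false,
        smul_zero, sub_zero]
    · exact map_zero _
  | pop k' f =>
    simp only
    split_ifs
    · simp only [map_sub, map_sum, map_smul, hc.top_inactive hq]
      simp [hc.hid_gate, hq]
    · exact map_zero _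
  | peek k f => exact map_zero _
  | emit b p => exact map_zero _
  | halt => exact map_zero _

theorem out_inactive (hc : Control u R qo S) (hq : qo ≠ some q) (i : Fin 3) :
    hidVal M u (outForm M q i) = 0 := by
  unfold outForm
  cases M q with
  | push k a p => exact map_zero _
  | pop k f => exact map_zero _
  | peek k f => exact map_zero _
  | emit b p => simp only; split_ifs <;> simp [hc.hid_st, hq]
  | halt => simp only; split_ifs <;> simp [hc.hid_st, hq]

end Control

theorem sum_eq_elim_of_inactive {ι : Type*} [Fintype ι] {g : ι → ℝ} {io : Option ι}
    (hg : ∀ i, io ≠ some i → g i = 0) : ∑ i, g i = io.elim 0 g := by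
  cases io with
  | none => exact Finset.sum_eq_zero fun i _ => hg i (Option.some_ne_none i).symm
  | some i =>
    exact Fintype.sum_eq_single i fun j hj => hg j fun h => hj (Option.some_injective _ h).symm

namespace Control

theorem step_ref (hc : Control u R qo S) : simStep M L q₀ u (.inl .ref) = 1000 * R := by
  simp [simStep_inl, varForm, hc.hid_ref]

theorem step_st (hc : Control u R qo S) (q' : Q) :
    simStep M L q₀ u (.inl (.st q')) =
      1000 * qo.elim 0 (fun q => hidVal M u (transForm M q q')) +
        if q' = q₀ then 1000 * simHid M L u (.inl .start) else 0 := by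
  rw [simStep_inl, varForm, map_add, map_smul, map_sum,
    sum_eq_elim_of_inactive fun q hq => hc.trans_inactive hq q']
  simp only [reduceCtorEq, if_false, Finset.sum_const_zero, add_zero]
  split_ifs <;> simp

theorem step_stk (hc : Control u R qo S) (k : K') :
    simStep M L q₀ u (.inl (.stk k)) =
      1000 * R * stackVal (S k) + qo.elim 0 (fun q => hidVal M u (stackForm M q k)) +
        if k = .main then (∑ j, (tripleVal j : ℝ) * simHid M L u (.inl (.kind j))) +
          600000 * simHid M L u (.inl .fin) else 0 := by
  rw [simStep_inl, varForm, map_add, map_add, map_sum,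
    sum_eq_elim_of_inactive fun q hq => hc.stack_inactive hq k]
  simp only [reduceCtorEq, if_false, Finset.sum_const_zero, add_zero,
    Finsupp.linearCombination_single, zsmul_eq_mul, hc.hid_stk]
  split_ifs
  · simp only [map_add, map_sum, Finsupp.linearCombination_single, zsmul_eq_mul, symDigit]
    push_cast
    ring
  · rw [map_zero]
    push_cast
    ring

theorem step_out (hc : Control u R qo S) (i : Fin 3) :
    simStep M L q₀ u (.inl (.out i)) = qo.elim 0 fun q => hidVal M u (outForm M q i) := by
  rw [simStep_inl, varForm, map_sum, sum_eq_elim_of_inactive fun q hq => hc.out_inactive hq i]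
  simp

end Control

/-- The variables that load the program and start the machine are `0`. -/
structure Quiet (u : FullVar Q L → ℝ) : Prop where
  timer : u (.inl .timer) = 0
  fin : u (.inl .fin) = 0
  kind : ∀ j, u (.inl (.kind j)) = 0
  chain : ∀ i, u (.inr i) = 0

theorem Quiet.start (hu : Quiet u) (hc : Control u R qo S) :
    simHid M L u (.inl .start) = 0 := by
  have hpos := hc.pos
  simp only [simHid_inl, hidForm, map_sub, Finsupp.linearCombination_single, hu.timer, hc.ref,
    zsmul_eq_mul, mul_zero, zero_sub]
  exact max_eq_right (by push_cast; linarith)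

theorem Quiet.step (hu : Quiet u) (hc : Control u R qo S) : Quiet (simStep M L q₀ u) where
  timer := by
    simp only [simStep_inl, varForm, map_sub, map_add, Finsupp.linearCombination_single,
      hu.start hc]
    simp [simHid_inl, hidForm, hu.timer, hu.fin]
  fin := by simp [simStep_inl, varForm, simHid_chain, hu.chain]
  kind j := by simp [simStep_inl, varForm, simHid_collector, hu.chain]
  chain i := by
    by_cases hi : i.1 = 0
    · exact simStep_chain_zero _ _ _ i hi
    · rw [simStep_chain_succ _ _ _ (i' := ⟨i.1 - 1, by omega⟩) (Nat.succ_pred hi), hu.chain,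
        max_self]

/-- The values `u` encode, at scale `R`, the running machine in state `q` with stacks `S`. -/
structure Running (u : FullVar Q L → ℝ) (R : ℝ) (q : Q) (S : K' → List Γ') : Prop where
  control : Control u R (some q) S
  quiet : Quiet u

namespace Running

theorem of_step (hr : Running u R q S) {q' : Q} {S' : K' → List Γ'}
    (hst : ∀ p, hidVal M u (transForm M q p) = if q' = p then R else 0)
    (hstk : ∀ k, hidVal M u (stackForm M q k) =
      1000 * R * (stackVal (S' k) - stackVal (S k))) :
    Running (simStep M L q₀ u) (1000 * R) q' S' where
  control :=
    { pos := mul_pos (by norm_num) hr.control.pos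
      ref := hr.control.step_ref q₀
      st := fun p => by
        rw [hr.control.step_st, Option.elim_some, hst, hr.quiet.start hr.control]
        simp
      stk := fun k => by
        have hfin : simHid M L u (.inl .fin) = 0 := by simp [simHid_inl, hidForm, hr.quiet.fin]
        have hkind : ∀ j, simHid M L u (.inl (.kind j)) = 0 := fun j => by
          simp [simHid_inl, hidForm, hr.quiet.kind]
        rw [hr.control.step_stk, Option.elim_some, hstk, hfin]
        simp only [hkind, mul_zero, Finset.sum_const_zero, add_zero, ite_self]
        ring }
  quiet := hr.quiet.step q₀ hr.control

theorem push (hr : Running u R q S) {k : K'} {a : Γ'} {q' : Q} (h : M q = .push k a q') :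
    Running (simStep M L q₀ u) (1000 * R) q' (Function.update S k (a :: S k)) := by
  refine hr.of_step q₀ (fun p => ?_) fun k' => ?_
  · simp only [transForm, h]
    split_ifs <;> simp [hr.control.hid_st]
  · simp only [stackForm, h]
    by_cases hk : k = k'
    · subst hk
      simp only [if_true, map_sub, Finsupp.linearCombination_single, zsmul_eq_mul,
        hr.control.hid_st, hr.control.hid_gate, Function.update_self, stackVal]
      push_cast
      ring
    · simp [hk, Function.update_of_ne (Ne.symm hk)]

theorem pop (hr : Running u R q S) {k : K'} {f : Option Γ' → Q} (h : M q = .pop k f) :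
    Running (simStep M L q₀ u) (1000 * R) (f (S k).head?)
      (Function.update S k (S k).tail) := by
  obtain rfl : readStack M q = k := by simp [readStack, h]
  refine hr.of_step q₀ (fun p => ?_) fun k' => ?_
  · simp only [transForm, h]
    exact hr.control.read_active f p
  · simp only [stackForm, h]
    by_cases hk : readStack M q = k'
    · subst hk
      have hdigit : ∑ m ∈ Finset.range 4,
          (if m + 1 ≤ topDigit (S (readStack M q)).head? then R else 0) =
            topDigit (S (readStack M q)).head? * R := by
        rcases (S (readStack M q)).head? with _ | (_ | _ | _ | _) <;>
          simp [Finset.sum_range_succ, topDigit, symDigit] <;> ring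
      simp only [if_true, map_sub, map_sum, map_smul, Finsupp.linearCombination_single,
        hr.control.hid_gate, hr.control.top_active, Function.update_self]
      rw [← Finset.smul_sum, hdigit, zsmul_eq_mul, zsmul_eq_mul]
      push_cast
      linear_combination 1000 * R * ten_mul_stackVal (S (readStack M q))
    · simp [hk, Function.update_of_ne (Ne.symm hk)]

theorem peek (hr : Running u R q S) {k : K'} {f : Option Γ' → Q} (h : M q = .peek k f) :
    Running (simStep M L q₀ u) (1000 * R) (f (S k).head?) S := by
  obtain rfl : readStack M q = k := by simp [readStack, h]
  refine hr.of_step q₀ (fun p => ?_) fun k' => ?_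
  · simp only [transForm, h]
    exact hr.control.read_active f p
  · simp [stackForm, h]

theorem emit (hr : Running u R q S) {b : Bool} {q' : Q} (h : M q = .emit b q') :
    Running (simStep M L q₀ u) (1000 * R) q' S := by
  refine hr.of_step q₀ (fun p => ?_) fun k' => ?_
  · simp only [transForm, h]
    split_ifs <;> simp [hr.control.hid_st]
  · simp [stackForm, h]

theorem out (hr : Running u R q S) (i : Fin 3) :
    simStep M L q₀ u (.inl (.out i)) = match M q with
      | .emit b _ => if i = 1 ∨ (i = 2 ∧ b = true) then R else 0
      | .halt => if i = 0 then R else 0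
      | _ => 0 := by
  rw [hr.control.step_out, Option.elim_some, outForm]
  cases M q with
  | push k a p => exact map_zero _
  | pop k f => exact map_zero _
  | peek k f => exact map_zero _
  | emit b p => simp only; split_ifs <;> simp [hr.control.hid_st]
  | halt => simp only; split_ifs <;> simp [hr.control.hid_st]

end Running

end Step

end Simulation

/-! ### The output of a running machine -/

section Output

open Classical in
/-- The bits emitted at time `t`, given the values of the last two channels. -/
def emittedAt (e b : ℕ → ℝ) (t : ℕ) : List Bool :=
  if 0 < e t then [decide (0 < b t)] else []

/-- Observed from time `t` on, the channels `h`, `e`, `b` output `s` and halt. -/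
def HaltsWith (h e b : ℕ → ℝ) (t : ℕ) (s : List Bool) : Prop :=
  ∃ τ, t ≤ τ ∧ 0 < h τ ∧ (∀ i, t ≤ i → i < τ → ¬ 0 < h i) ∧
    (List.range' t (τ - t)).flatMap (emittedAt e b) = s

theorem LoopedNet.outputs_iff (θ : LoopedNet) (s : List Bool) :
    θ.Outputs s ↔ HaltsWith θ.haltCh θ.emitCh θ.bitCh 1 s := Iff.rfl

namespace HaltsWith

variable {h e b : ℕ → ℝ} {t : ℕ} {s : List Bool}

theorem of_pos (ht : 0 < h t) : HaltsWith h e b t [] :=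
  ⟨t, le_rfl, ht, fun _ hti hit => absurd hti (not_le.2 hit), by simp⟩

theorem cons (hs : HaltsWith h e b (t + 1) s) (ht : h t ≤ 0) :
    HaltsWith h e b t (emittedAt e b t ++ s) := by
  obtain ⟨τ, hle, hhalt, hrun, rfl⟩ := hs
  refine ⟨τ, by omega, hhalt, fun i hi hiτ => ?_, ?_⟩
  · rcases hi.eq_or_lt with rfl | hi
    · exact not_lt.2 ht
    · exact hrun i hi hiτ
  · rw [show τ - t = (τ - (t + 1)) + 1 by omega, List.range'_succ, List.flatMap_cons]

theorem of_succ (hs : HaltsWith h e b (t + 1) s) (hh : h t ≤ 0) (he : e t ≤ 0) :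
    HaltsWith h e b t s := by
  simpa only [emittedAt, if_neg (not_lt.2 he), List.nil_append] using hs.cons hh

theorem of_le {t₀ : ℕ} (hs : HaltsWith h e b t s) (ht : t₀ ≤ t)
    (hh : ∀ i, i < t → h i ≤ 0) (he : ∀ i, i < t → e i ≤ 0) : HaltsWith h e b t₀ s := by
  induction t, ht using Nat.le_induction with
  | base => exact hs
  | succ t _ ih =>
    exact ih (hs.of_succ (hh t t.lt_succ_self) (he t t.lt_succ_self))
      (fun i hi => hh i (hi.trans t.lt_succ_self)) fun i hi => he i (hi.trans t.lt_succ_self)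

theorem shift {h' e' b' c : ℕ → ℝ} (hc : ∀ t, 0 < c t)
    (hh : ∀ t, h' (t + 1) = c t * h t) (he : ∀ t, e' (t + 1) = c t * e t)
    (hb : ∀ t, b' (t + 1) = c t * b t) (hs : HaltsWith h e b t s) :
    HaltsWith h' e' b' (t + 1) s := by
  obtain ⟨τ, hle, hhalt, hrun, rfl⟩ := hs
  have hpos : ∀ a t, 0 < c t * a ↔ 0 < a := fun a t => mul_pos_iff_of_pos_left (hc t)
  refine ⟨τ + 1, by omega, by rwa [hh, hpos], fun i hi hiτ => ?_, ?_⟩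
  · obtain ⟨i, rfl⟩ := Nat.exists_eq_add_of_le' (Nat.one_le_of_lt hi)
    rw [hh, hpos]
    exact hrun i (by omega) (by omega)
  · rw [Nat.add_sub_add_right, add_comm t 1, ← List.map_add_range', List.flatMap_map]
    refine congrArg (fun f => List.flatMap f _) (funext fun i => ?_)
    simp only [emittedAt, add_comm 1 i, he, hb, hpos]

end HaltsWith

open Turing.PartrecToTM2

variable {Q : Type*} [Fintype Q] [DecidableEq Q] {M : Q → Instr K' Γ' Q} {q₀ : Q}
  {L : List Triple}

/-- The three channels of the simulating network output `s`, observed from time `t` on. -/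
abbrev ChannelsHaltWith (x : ℕ → FullVar Q L → ℝ) (t : ℕ) (s : List Bool) : Prop :=
  HaltsWith (fun t => x t (.inl (.out 0))) (fun t => x t (.inl (.out 1)))
    (fun t => x t (.inl (.out 2))) t s

theorem Running.output {x : ℕ → FullVar Q L → ℝ} (hx : ∀ t, x (t + 1) = simStep M L q₀ (x t))
    {q : Q} {S : K' → List Γ'} {s : List Bool} (hs : Produces M q S s) {t : ℕ} {R : ℝ}
    (hr : Running (x t) R q S) : ChannelsHaltWith x (t + 1) s := by
  have hout := fun i => (hx t ▸ hr.out (M := M) q₀ i : x (t + 1) (.inl (.out i)) = _)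
  induction hs generalizing t R with
  | push h _ ih =>
    have hr' := hx t ▸ hr.push q₀ h
    simp only [h] at hout
    exact (ih hr' fun i => hx _ ▸ hr'.out q₀ i).of_succ (hout 0).le (hout 1).le
  | pop h _ ih =>
    have hr' := hx t ▸ hr.pop q₀ h
    simp only [h] at hout
    exact (ih hr' fun i => hx _ ▸ hr'.out q₀ i).of_succ (hout 0).le (hout 1).le
  | peek h _ ih =>
    have hr' := hx t ▸ hr.peek q₀ h
    simp only [h] at hout
    exact (ih hr' fun i => hx _ ▸ hr'.out q₀ i).of_succ (hout 0).le (hout 1).le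
  | @emit q S s b q' h _ ih =>
    have hr' := hx t ▸ hr.emit q₀ h
    simp only [h] at hout
    have hbit : emittedAt (fun t => x t (.inl (.out 1))) (fun t => x t (.inl (.out 2))) (t + 1) =
        [b] := by
      cases b <;> simp [emittedAt, hout, hr.control.pos]
    rw [← List.singleton_append, ← hbit]
    exact (ih hr' fun i => hx _ ▸ hr'.out q₀ i).cons (by simp [hout])
  | halt h =>
    simp only [h] at hout
    exact .of_pos (by simp [hout, hr.control.pos])

end Output

/-! ### Loading the program -/

section Load

open Turing.PartrecToTM2

/-- The word on the main stack once the program `L` is loaded. -/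
def loadedWord (L : List Triple) : List Γ' :=
  terminated (L.flatMap fun j => [j.1, j.2.1, j.2.2])

theorem length_loadedWord (L : List Triple) : (loadedWord L).length = 3 * L.length + 1 := by
  simp [loadedWord, terminated, mul_comm]

theorem loadedWord_cons (j : Triple) (L : List Triple) :
    loadedWord (j :: L) = bitSym j.1 :: bitSym j.2.1 :: bitSym j.2.2 :: loadedWord L := rfl

theorem stackVal_take_loadedWord (L : List Triple) (m : ℕ) :
    1000 ^ (m + 2) * stackVal ((loadedWord L).take (3 * (m + 1))) =
      1000 ^ (m + 2) * stackVal ((loadedWord L).take (3 * m)) +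
        ((∑ j, if L[m]? = some j then (tripleVal j : ℝ) else 0) +
          if m = L.length then 600000 else 0) := by
  induction L generalizing m with
  | nil =>
    cases m with
    | zero => simp [loadedWord, terminated, stackVal, symDigit]; norm_num
    | succ m => simp [loadedWord, terminated, mul_add]
  | cons j L ih =>
    cases m with
    | zero =>
      simp [loadedWord_cons, stackVal, tripleVal]
      ring
    | succ m =>
      simp only [loadedWord_cons, mul_add, mul_one, List.take_succ_cons, stackVal,
        List.getElem?_cons_succ, List.length_cons, Nat.succ_inj] at ih ⊢
      linear_combination ih m

/-- The stacks after `n` iterations of the loading phase. Nothing is loaded in the first of them, in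
which the chain only passes its first triple to the variables `kind`. -/
def loadedStacks (L : List Triple) (n : ℕ) : K' → List Γ' :=
  K'.elim ((loadedWord L).take (3 * (n - 1))) [] [] []

theorem loadedStacks_of_lt (hn : L.length + 1 < n) :
    loadedStacks L n = K'.elim (loadedWord L) [] [] [] := by
  rw [loadedStacks, List.take_of_length_le]
  rw [length_loadedWord]
  omega

variable {Q : Type*} [DecidableEq Q] {L : List Triple} {n : ℕ} {u : FullVar Q L → ℝ}

/-- The values `u` after `n` iterations of the loading phase. -/
structure Loading (L : List Triple) (n : ℕ) (u : FullVar Q L → ℝ) : Prop where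
  control : Control u (1000 ^ n) none (loadedStacks L n)
  timer : u (.inl .timer) = if L.length + 2 ≤ n then 10000 ^ (n - (L.length + 2)) else 0
  fin : u (.inl .fin) = if n = L.length + 1 then 1 else 0
  kind : ∀ j, u (.inl (.kind j)) = if 0 < n ∧ L[n - 1]? = some j then 1 else 0
  chain : ∀ i, u (.inr i) = if n = i.1 then 1 else 0

theorem Loading.timer_eq_ref (hl : Loading L (4 * L.length + 8) u) :
    u (.inl .timer) = 1000 ^ (4 * L.length + 8) := by
  rw [hl.timer, if_pos (by omega), show (10000 : ℝ) = 10 ^ 4 by norm_num,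
    show (1000 : ℝ) = 10 ^ 3 by norm_num, ← pow_mul, ← pow_mul]
  congr 1
  omega

variable [Fintype Q] (M : Q → Instr K' Γ' Q) (q₀ : Q)

theorem loading_zero : Loading L 0 (simTraj M L q₀ 0) where
  control :=
    { pos := by norm_num
      ref := by simp [simTraj, traj, fullInit]
      st := fun q => by simp [simTraj, traj, fullInit]
      stk := fun k => by cases k <;> simp [simTraj, traj, fullInit, loadedStacks, stackVal] }
  timer := by simp [simTraj, traj, fullInit]
  fin := by simp [simTraj, traj, fullInit]
  kind j := by simp [simTraj, traj, fullInit]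
  chain i := by simp [simTraj, traj, fullInit, eq_comm]

namespace Loading

theorem step_chain (hl : Loading L n u) (i : Fin (L.length + 1)) :
    simStep M L q₀ u (.inr i) = if n + 1 = i.1 then 1 else 0 := by
  by_cases hi : i.1 = 0
  · rw [simStep_chain_zero _ _ _ i hi, hi, if_neg n.succ_ne_zero]
  · have hnonneg : (0 : ℝ) ≤ if n = i.1 - 1 then 1 else 0 := by positivity
    rw [simStep_chain_succ _ _ _ (i' := ⟨i.1 - 1, by omega⟩) (Nat.succ_pred hi), hl.chain,
      max_eq_left hnonneg]
    exact if_congr (show n = i.1 - 1 ↔ n + 1 = i.1 by omega) rfl rfl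

theorem step_kind (hl : Loading L n u) (j : Triple) :
    simStep M L q₀ u (.inl (.kind j)) = if L[n]? = some j then 1 else 0 := by
  have hcell : ∀ i : Fin (L.length + 1), (if L[i.1]? = some j then u (.inr i) else 0) =
      if n = i.1 then (if L[n]? = some j then (1 : ℝ) else 0) else 0 := fun i => by
    rw [hl.chain]
    by_cases hi : n = i.1 <;> simp [hi]
  simp only [simStep_inl, varForm, map_zero, reduceCtorEq, if_false, SimVar.kind.injEq,
    Finset.sum_ite_eq, Finset.mem_univ, if_true, zero_add, add_zero, simHid_collector, hcell]
  by_cases hn : n < L.length + 1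
  · rw [Fintype.sum_eq_single ⟨n, hn⟩ fun i hi => if_neg fun h => hi (Fin.ext h.symm), if_pos rfl]
    split_ifs <;> simp
  · rw [Finset.sum_eq_zero fun i _ => if_neg (by omega), List.getElem?_eq_none (by omega)]
    simp

theorem step_fin (hl : Loading L n u) :
    simStep M L q₀ u (.inl .fin) = if n + 1 = L.length + 1 then 1 else 0 := by
  simp only [simStep_inl, varForm, map_zero, reduceCtorEq, if_false, if_true,
    Finset.sum_const_zero, zero_add, simHid_chain, hl.chain, Fin.val_last]
  split_ifs <;> first | omega | simp

theorem step_stk (hl : Loading L n u) (k : K') :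
    simStep M L q₀ u (.inl (.stk k)) =
      1000 ^ (n + 1) * stackVal (loadedStacks L (n + 1) k) := by
  have hfin : simHid M L u (.inl .fin) = if n = L.length + 1 then 1 else 0 := by
    simp only [simHid_inl, hidForm, Finsupp.linearCombination_single, one_smul, hl.fin]
    split_ifs <;> simp
  have hkind : ∀ j, simHid M L u (.inl (.kind j)) =
      if 0 < n ∧ L[n - 1]? = some j then 1 else 0 := fun j => by
    simp only [simHid_inl, hidForm, Finsupp.linearCombination_single, one_smul, hl.kind]
    split_ifs <;> simp
  rw [hl.control.step_stk, hfin]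
  simp only [hkind, Option.elim_none, add_zero]
  by_cases hk : k = .main
  · subst hk
    cases n with
    | zero => simp [loadedStacks, stackVal]
    | succ m =>
      have htake := stackVal_take_loadedWord L m
      simp only [loadedStacks, K'.elim, Nat.add_sub_cancel, Nat.succ_pos, true_and, Nat.succ_inj,
        mul_ite, mul_one, mul_zero, if_true]
      rw [htake]
      ring
  · cases k <;> simp [loadedStacks, stackVal] at hk ⊢

theorem start_eq_zero (hl : Loading L n u) (hn : n < 4 * L.length + 8) :
    simHid M L u (.inl .start) = 0 := by
  simp only [simHid_inl, hidForm, map_sub, Finsupp.linearCombination_single, zsmul_eq_mul,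
    hl.timer, hl.control.ref]
  have hpos := hl.control.pos
  apply max_eq_right
  push_cast
  split_ifs with hload
  · have hlate : (10 : ℝ) * 10000 ^ (n - (L.length + 2)) ≤ 1000 ^ n := by
      rw [show (10000 : ℝ) = 10 ^ 4 by norm_num, show (1000 : ℝ) = 10 ^ 3 by norm_num, ← pow_mul,
        ← pow_mul, ← pow_succ']
      exact pow_le_pow_right₀ (by norm_num) (by omega)
    linarith
  · linarith

theorem start_eq_ref (hl : Loading L (4 * L.length + 8) u) :
    simHid M L u (.inl .start) = 1000 ^ (4 * L.length + 8) := by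
  have hpos := hl.control.pos
  simp only [simHid_inl, hidForm, map_sub, Finsupp.linearCombination_single, zsmul_eq_mul,
    hl.timer_eq_ref, hl.control.ref]
  push_cast
  rw [max_eq_left (by linarith)]
  ring

theorem step_timer (hl : Loading L n u) :
    simStep M L q₀ u (.inl .timer) =
      (if L.length + 2 ≤ n + 1 then 10000 ^ (n + 1 - (L.length + 2)) else 0) -
        10000 * simHid M L u (.inl .start) := by
  have htimer : simHid M L u (.inl .timer) = u (.inl .timer) := by
    have hnonneg : 0 ≤ u (.inl .timer) := by rw [hl.timer]; positivity
    simp [simHid_inl, hidForm, hnonneg]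
  have hfin : simHid M L u (.inl .fin) = u (.inl .fin) := by
    have hnonneg : 0 ≤ u (.inl .fin) := by rw [hl.fin]; positivity
    simp [simHid_inl, hidForm, hnonneg]
  simp only [simStep_inl, varForm, map_add, map_sub, Finsupp.linearCombination_single, htimer,
    hfin, hl.timer, hl.fin, reduceCtorEq, if_false, Finset.sum_const_zero, add_zero, zsmul_eq_mul]
  push_cast
  rcases lt_trichotomy n (L.length + 1) with h | h | h
  · rw [if_neg (by omega), if_neg (by omega), if_neg (by omega)]
    ring
  · subst h
    simp
    ring
  · rw [if_pos (by omega), if_neg (by omega), if_pos (by omega),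
      show n - (L.length + 1) = n - (L.length + 2) + 1 by omega, pow_succ]
    ring

theorem step (hl : Loading L n u) (hn : n < 4 * L.length + 8) :
    Loading L (n + 1) (simStep M L q₀ u) where
  control :=
    { pos := by positivity
      ref := by rw [hl.control.step_ref, pow_succ']
      st := fun q => by
        rw [hl.control.step_st, hl.start_eq_zero M hn]
        simp
      stk := hl.step_stk M q₀ }
  timer := by rw [hl.step_timer, hl.start_eq_zero M hn, mul_zero, sub_zero]
  fin := hl.step_fin M q₀
  kind j := by rw [hl.step_kind, Nat.add_sub_cancel]; simp only [Nat.succ_pos, true_and]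
  chain := hl.step_chain M q₀

theorem running (hl : Loading L (4 * L.length + 8) u) :
    Running (simStep M L q₀ u) (1000 ^ (4 * L.length + 9)) q₀
      (K'.elim (loadedWord L) [] [] []) where
  control :=
    { pos := by positivity
      ref := by rw [hl.control.step_ref, ← pow_succ']
      st := fun q => by
        rw [hl.control.step_st, hl.start_eq_ref, ← pow_succ']
        simp [eq_comm]
      stk := fun k => by rw [hl.step_stk, loadedStacks_of_lt (by omega)] }
  quiet :=
    { timer := by
        rw [hl.step_timer, hl.start_eq_ref, ← hl.timer_eq_ref, hl.timer, if_pos (by omega),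
          if_pos (by omega), ← pow_succ', sub_eq_zero]
        congr 1
        omega
      fin := by rw [hl.step_fin, if_neg (by omega)]
      kind := fun j => by rw [hl.step_kind, List.getElem?_eq_none (by omega)]; simp
      chain := fun i => by rw [hl.step_chain, if_neg (by omega)] }

end Loading

theorem loading_simTraj (hn : n ≤ 4 * L.length + 8) : Loading L n (simTraj M L q₀ n) := by
  induction n with
  | zero => exact loading_zero M q₀
  | succ n ih => exact (ih (by omega)).step M q₀ hn

theorem simTraj_output {s : List Bool}
    (hs : Produces M q₀ (K'.elim (loadedWord L) [] [] []) s) :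
    ChannelsHaltWith (simTraj M L q₀) 0 s := by
  have hrun : ChannelsHaltWith (simTraj M L q₀) (4 * L.length + 10) s :=
    Running.output (fun _ => rfl) hs ((loading_simTraj M q₀ le_rfl).running M q₀)
  have hsilent : ∀ i < 4 * L.length + 10, ∀ c, simTraj M L q₀ i (.inl (.out c)) = 0 := by
    intro i hi c
    cases i with
    | zero => simp [simTraj, traj, fullInit]
    | succ n => exact (loading_simTraj M q₀ (by omega)).control.step_out q₀ c
  exact hrun.of_le (Nat.zero_le _) (fun i hi => (hsilent i hi 0).le) fun i hi =>
    (hsilent i hi 1).le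

end Load

/-! ### Networks from programs -/

section Count

open Turing.PartrecToTM2

theorem sum_natAbs_ite_le_one {α : Type*} [Fintype α] (P : α → Prop) [DecidablePred P]
    (hP : ∀ a b, P a → P b → a = b) : ∑ a, (if P a then (1 : ℤ) else 0).natAbs ≤ 1 := by
  have hcard : ∑ a, (if P a then (1 : ℤ) else 0).natAbs = (Finset.univ.filter P).card := by
    rw [Finset.card_filter]
    exact Finset.sum_congr rfl fun a _ => by split_ifs <;> rfl
  rw [hcard, Finset.card_le_one]
  simp only [Finset.mem_filter, Finset.mem_univ, true_and]
  exact fun a ha b hb => hP a b ha hb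

/-- The number of units that represent a variable: `C` in the fixed part of the network, but only
one in the part that grows with the program. -/
def mult {α β : Type*} (C : ℕ) : α ⊕ β → ℕ
  | .inl _ => C
  | .inr _ => 1

theorem natAbs_fullInit_le {Q : Type*} [DecidableEq Q] (L : List Triple)
    (v : FullVar Q L) : (fullInit L v).natAbs ≤ 1 := by
  rcases v with v | i <;> simp only [fullInit] <;> split_ifs <;> simp

section Bounds

variable {Q : Type*} [Fintype Q] (M : Q → Instr K' Γ' Q) (L : List Triple) (C : ℕ)

theorem sum_natAbs_fullW₁_le :
    ∑ h, mult C h * ∑ v, (fullW₁ M L h v).natAbs ≤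
      (∑ h, C * ∑ v, (hidForm M h v).natAbs) + (2 * L.length + 1) := by
  have hcollect (i : Fin (L.length + 1)) :
      ∑ j : Triple, (if L[i.1]? = some j then (1 : ℤ) else 0).natAbs ≤
        if i.1 < L.length then 1 else 0 := by
    split_ifs with hi
    · exact sum_natAbs_ite_le_one _ fun j j' hj hj' => Option.some.inj (hj.symm.trans hj')
    · simp [List.getElem?_eq_none (not_lt.1 hi)]
  have hcollectors : ∑ j : Triple, ∑ i : Fin (L.length + 1),
      (if L[i.1]? = some j then (1 : ℤ) else 0).natAbs ≤ L.length := by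
    rw [Finset.sum_comm]
    calc _ ≤ ∑ i : Fin (L.length + 1), if i.1 < L.length then 1 else 0 :=
          Finset.sum_le_sum fun i _ => hcollect i
      _ = L.length := by
          rw [Fin.sum_univ_castSucc]
          simp
  have hchain : ∑ i' : Fin (L.length + 1), ∑ i : Fin (L.length + 1),
      (if i' = i then (1 : ℤ) else 0).natAbs ≤ L.length + 1 := by
    refine (Finset.sum_le_card_nsmul _ _ 1 fun i' _ => ?_).trans_eq (by simp)
    exact sum_natAbs_ite_le_one _ fun i j hi hj => hi.symm.trans hj
  simp only [Fintype.sum_sum_type, mult, fullW₁, one_mul, Int.natAbs_zero, Finset.sum_const_zero,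
    zero_add, add_zero]
  omega

variable [DecidableEq Q] (q₀ : Q)

/-- A bound on all weights between the variables that do not belong to the program chain. Each of
these variables is represented by this many units. -/
def copies : ℕ :=
  1 + ∑ h : SimHid Q, ∑ v, (hidForm M h v).natAbs + ∑ v : SimVar Q, ∑ h, (varForm M q₀ v h).natAbs

theorem copies_pos : 0 < copies M q₀ := by
  unfold copies
  omega

theorem le_sum_sum {α β : Type*} [Fintype α] [Fintype β] (f : α → β → ℕ) (a : α) (b : β) :
    f a b ≤ ∑ a, ∑ b, f a b :=
  (Finset.single_le_sum (f := f a) (fun _ _ => Nat.zero_le _) (Finset.mem_univ b)).trans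
    (Finset.single_le_sum (f := fun a => ∑ b, f a b) (fun _ _ => Nat.zero_le _)
      (Finset.mem_univ a))

theorem natAbs_hidForm_le (h : SimHid Q) (v : SimVar Q) :
    (hidForm M h v).natAbs ≤ copies M q₀ := by
  have hle := le_sum_sum (fun h v => (hidForm M h v).natAbs) h v
  unfold copies
  omega

theorem natAbs_varForm_le (v : SimVar Q) (h : SimHid Q) :
    (varForm M q₀ v h).natAbs ≤ copies M q₀ := by
  have hle := le_sum_sum (fun v h => (varForm M q₀ v h).natAbs) v h
  unfold copies
  omega

theorem natAbs_fullW₁_le (h : FullHid Q L) (v : FullVar Q L) :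
    (fullW₁ M L h v).natAbs ≤ mult (copies M q₀) v := by
  rcases h with h | j | i <;> rcases v with v | i'
  case inl.inl => exact natAbs_hidForm_le M q₀ h v
  all_goals
    simp only [fullW₁, mult]
    try split_ifs
    all_goals simp

theorem natAbs_fullW₂_le (v : FullVar Q L) (h : FullHid Q L) :
    (fullW₂ M L q₀ v h).natAbs ≤ mult (copies M q₀) h := by
  rcases v with v | i <;> rcases h with h | j | i'
  case inl.inl => exact natAbs_varForm_le M q₀ v h
  all_goals
    simp only [fullW₂, mult]
    try split_ifs
    all_goals simp

theorem sum_natAbs_fullW₂_le :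
    ∑ v, mult C v * ∑ h, (fullW₂ M L q₀ v h).natAbs ≤
      (∑ v, C * (∑ h, (varForm M q₀ v h).natAbs + 2)) + L.length := by
  have hkind (v : SimVar Q) : ∑ j, (if v = .kind j then (1 : ℤ) else 0).natAbs ≤ 1 :=
    sum_natAbs_ite_le_one _ fun j j' hj hj' => SimVar.kind.inj (hj.symm.trans hj')
  have hfin (v : SimVar Q) : ∑ i : Fin (L.length + 1),
      (if v = .fin ∧ i = Fin.last _ then (1 : ℤ) else 0).natAbs ≤ 1 :=
    sum_natAbs_ite_le_one _ fun i j hi hj => hi.2.trans hj.2.symm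
  have hchain : ∑ i : Fin (L.length + 1), ∑ i' : Fin (L.length + 1),
      (if i'.1 + 1 = i.1 then (1 : ℤ) else 0).natAbs ≤ L.length := by
    calc _ ≤ ∑ i : Fin (L.length + 1), if i.1 = 0 then 0 else 1 :=
          Finset.sum_le_sum fun i _ => by
            split_ifs with hi
            · simp [hi]
            · exact sum_natAbs_ite_le_one _ fun a b ha hb => Fin.ext (by omega)
      _ = L.length := by
          rw [Fin.sum_univ_succ]
          simp
  simp only [Fintype.sum_sum_type, mult, fullW₂, one_mul, Int.natAbs_zero, Finset.sum_const_zero,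
    zero_add]
  refine add_le_add (Finset.sum_le_sum fun v _ => Nat.mul_le_mul_left _ ?_) hchain
  exact Nat.add_le_add_left (add_le_add (hkind v) (hfin v)) _

theorem sum_natAbs_fullInit_le :
    ∑ v, mult C v * (fullInit (Q := Q) L v).natAbs ≤ C + 1 := by
  have hvars : ∑ v : SimVar Q, (if v = .ref then (1 : ℤ) else 0).natAbs ≤ 1 :=
    sum_natAbs_ite_le_one _ fun _ _ ha hb => ha.trans hb.symm
  have hchain : ∑ i : Fin (L.length + 1), (if i.1 = 0 then (1 : ℤ) else 0).natAbs ≤ 1 :=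
    sum_natAbs_ite_le_one _ fun a b ha hb => Fin.ext (ha.trans hb.symm)
  simp only [Fintype.sum_sum_type, mult, fullInit, one_mul, ← Finset.mul_sum]
  exact add_le_add ((Nat.mul_le_mul_left C hvars).trans_eq (mul_one C)) hchain

end Bounds

theorem exists_net_of_machine {Q : Type*} [Finite Q] (M : Q → Instr K' Γ' Q) (q₀ : Q)
    {δ B : ℝ} (hδ : 0 < δ) (hB : δ ≤ B) :
    ∃ c : ℕ, ∀ (L : List Triple) (s : List Bool),
      Produces M q₀ (K'.elim (loadedWord L) [] [] []) s →
      ∃ θ : LoopedNet, θ.HasPrecision δ B ∧ θ.Outputs s ∧ θ.l0 ≤ 3 * L.length + c := by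
  classical
  cases nonempty_fintype Q
  obtain ⟨m, hm⟩ : ∃ m : ℕ, 1 ≤ m * δ := by
    obtain ⟨m, hm⟩ := exists_nat_ge (1 / δ)
    exact ⟨m, (div_le_iff₀ hδ).1 hm⟩
  let C := copies M q₀
  refine ⟨(∑ h, C * ∑ v, (hidForm M h v).natAbs) +
    (∑ v, C * (∑ h, (varForm M q₀ v h).natAbs + 2)) + C + (2 * m + 3), fun L s hs => ?_⟩
  obtain ⟨θ, hprec, hl0, hch⟩ := exists_loopedNet_traj hδ.le hB (natAbs_fullW₁_le M L q₀)
    (natAbs_fullW₂_le M L q₀)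
    (natAbs_fullInit_le L) hm (ch := fun i => .inl (.out i)) (fun i j h => by simpa using h)
    fun _ => copies_pos M q₀
  refine ⟨θ, hprec, ?_, ?_⟩
  · rw [LoopedNet.outputs_iff]
    exact HaltsWith.shift (c := fun t => δ ^ (2 * (t + 1))) (fun t => by positivity)
      (fun t => (hch t).1) (fun t => (hch t).2.1) (fun t => (hch t).2.2) (simTraj_output M q₀ hs)
  · have h₁ := sum_natAbs_fullW₁_le M L C
    have h₂ := sum_natAbs_fullW₂_le M L C q₀
    have h₀ := sum_natAbs_fullInit_le (Q := Q) L C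
    refine (hl0.trans (add_le_add_left (add_le_add (add_le_add h₁ h₂) h₀) _)).trans ?_
    omega

end Count

section Padding

open Turing.PartrecToTM2

/-- A word padded to a prescribed residue of its length. -/
def padWord (j : ℕ) (p : List Bool) : List Bool := List.replicate j false ++ true :: p

theorem length_padWord (j : ℕ) (p : List Bool) : (padWord j p).length = j + p.length + 1 := by
  simp [padWord, add_assoc]

theorem eq_of_padWord_eq {j j' : ℕ} {p p' : List Bool} (h : padWord j p = padWord j' p') :
    p = p' := by
  have hdrop : ∀ j p, (padWord j p).dropWhile (fun b => !b) = true :: p := fun j p => by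
    rw [padWord, List.dropWhile_append_of_pos fun b hb => by simp [List.eq_of_mem_replicate hb],
      List.dropWhile_cons_of_neg (by simp)]
  simpa [hdrop] using congrArg (List.dropWhile fun b => !b) h

theorem primrec_wordNum : Primrec wordNum := by
  have : Primrec fun w : List Bool => w.foldr (fun b n => 2 * n + b.toNat) 1 :=
    Primrec.list_foldr (h := fun _ (x : Bool × ℕ) => 2 * x.2 + x.1.toNat) Primrec.id
      (Primrec.const 1)
      (Primrec.nat_add.comp (Primrec.nat_mul.comp (Primrec.const 2) (Primrec.snd.comp Primrec.snd))
        ((Primrec.dom_bool Bool.toNat).comp (Primrec.fst.comp Primrec.snd))).to₂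
  exact this

theorem primrec_padWord (j : ℕ) : Primrec (padWord j) :=
  Primrec.list_append.comp (Primrec.const _) (Primrec.list_cons.comp (Primrec.const _) Primrec.id)

/-- The `k`-th word, if one of its paddings is encoded by `n`: stage `k` of the search that inverts
the padding. -/
def unpadStage (n k : ℕ) : Option (List Bool) :=
  (Encodable.decode (α := List Bool) k).bind fun p =>
    if wordNum (padWord 0 p) = n ∨ wordNum (padWord 1 p) = n ∨ wordNum (padWord 2 p) = n then
      some p else none

theorem computable_unpadStage : Computable₂ unpadStage := by
  have h : ∀ j, PrimrecPred fun x : (ℕ × ℕ) × List Bool => wordNum (padWord j x.2) = x.1.1 :=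
    fun j => Primrec.eq.comp (primrec_wordNum.comp ((primrec_padWord j).comp Primrec.snd))
      (Primrec.fst.comp Primrec.fst)
  have : Primrec fun x : ℕ × ℕ => unpadStage x.1 x.2 :=
    Primrec.option_bind (Primrec.decode.comp Primrec.snd)
      (Primrec.ite ((h 0).or ((h 1).or (h 2))) (Primrec.option_some.comp Primrec.snd)
        (Primrec.const none)).to₂
  exact this.to_comp

theorem eq_of_mem_unpadStage {j k : ℕ} {p p' : List Bool}
    (h : p' ∈ unpadStage (wordNum (padWord j p)) k) : p' = p := by
  obtain ⟨q, -, hq⟩ := Option.bind_eq_some_iff.1 h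
  split_ifs at hq with hpad
  rw [← Option.some.inj hq]
  rcases hpad with hpad | hpad | hpad <;> exact eq_of_padWord_eq (wordNum_injective hpad)

theorem mem_rfindOpt_unpadStage {j : ℕ} (hj : j < 3) (p : List Bool) :
    p ∈ Nat.rfindOpt (unpadStage (wordNum (padWord j p))) := by
  have hdom : (Nat.rfindOpt (unpadStage (wordNum (padWord j p)))).Dom := by
    refine Nat.rfindOpt_dom.2 ⟨Encodable.encode p, p, ?_⟩
    interval_cases j <;> simp [unpadStage]
  obtain ⟨k, hk⟩ := Nat.rfindOpt_spec (Part.get_mem hdom)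
  exact (Part.get_eq_iff_mem hdom).1 (eq_of_mem_unpadStage hk)

theorem exists_triples (T : ℕ) (w : List Bool) (hw : w.length = 3 * T) :
    ∃ L : List Triple, L.length = T ∧ L.flatMap (fun j => [j.1, j.2.1, j.2.2]) = w := by
  induction T generalizing w with
  | zero => exact ⟨[], rfl, by simpa [eq_comm] using hw⟩
  | succ T ih =>
    obtain ⟨a, b, c, w, rfl⟩ : ∃ a b c w', w = a :: b :: c :: w' := by
      match w, hw with
      | a :: b :: c :: w, _ => exact ⟨a, b, c, w, rfl⟩
    obtain ⟨L, rfl, rfl⟩ := ih w (by simp only [List.length_cons] at hw; omega)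
    exact ⟨(a, b, c) :: L, rfl, rfl⟩

theorem exists_net_of_program {δ B : ℝ} (hδ : 0 < δ) (hB : δ ≤ B) {U : List Bool →. List Bool}
    (hU : Partrec U) : ∃ c : ℕ, ∀ p s : List Bool, s ∈ U p →
      ∃ θ : LoopedNet, θ.HasPrecision δ B ∧ θ.Outputs s ∧ θ.l0 ≤ p.length + c := by
  have hg : Partrec fun n => ((Nat.rfindOpt (unpadStage n)).bind U).map wordNum :=
    ((Partrec.rfindOpt computable_unpadStage).bind (hU.comp Computable.snd).to₂).map
      (primrec_wordNum.to_comp.comp Computable.snd).to₂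
  obtain ⟨Q, _, _, M, q₀, hM⟩ := exists_stackMachine_of_partrec hg
  obtain ⟨c, hc⟩ := exists_net_of_machine M q₀ hδ hB
  refine ⟨c + 4, fun p s hs => ?_⟩
  obtain ⟨j, hj, T, hT⟩ : ∃ j < 3, ∃ T, p.length + 2 + j = 3 * T :=
    ⟨(2 * (p.length + 2)) % 3, by omega, (p.length + 2 + (2 * (p.length + 2)) % 3) / 3, by omega⟩
  have hlen : (padWord j p ++ [true]).length = 3 * T := by
    rw [List.length_append, length_padWord, List.length_singleton]
    omega
  obtain ⟨L, rfl, hL⟩ := exists_triples T _ hlen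
  obtain ⟨θ, hprec, hout, hl0⟩ := hc L s (by
    rw [loadedWord, hL]
    exact hM _ _ (Part.mem_map _ (Part.mem_bind (mem_rfindOpt_unpadStage hj p) hs)))
  exact ⟨θ, hprec, hout, by omega⟩

end Padding

/-! ### The sign of integer polynomials at a computable real -/

open Polynomial Filter Topology

section Relations

variable {R K : Type*} [CommRing R] [IsDomain R] [NormalizedGCDMonoid R] [Field K] [Algebra R K]
  [IsFractionRing R K]

theorem exists_isPrimitive_associated_map {f : K[X]} (hf : f ≠ 0) :
    ∃ g : R[X], g.IsPrimitive ∧ Associated (g.map (algebraMap R K)) f := by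
  obtain ⟨b, hb, hmap⟩ := IsLocalization.integerNormalization_spec (nonZeroDivisors R) f
  set m := IsLocalization.integerNormalization (nonZeroDivisors R) f
  have hne : ∀ {a : R}, a ≠ 0 → algebraMap R K a ≠ 0 := fun ha =>
    (map_ne_zero_iff _ (IsFractionRing.injective R K)).2 ha
  have hb0 : b ≠ 0 := nonZeroDivisors.ne_zero hb
  have hm0 : m.content ≠ 0 := by
    rw [Ne, content_eq_zero_iff]
    intro hm
    rw [hm, Polynomial.map_zero, algebra_compatible_smul K, eq_comm, smul_eq_zero] at hmap
    exact hmap.elim (hne hb0) hf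
  have heq : C (algebraMap R K m.content) * m.primPart.map (algebraMap R K) =
      C (algebraMap R K b) * f := by
    rw [← smul_eq_C_mul (algebraMap R K b), algebraMap_smul, ← hmap]
    conv_rhs => rw [m.eq_C_content_mul_primPart, Polynomial.map_mul, map_C]
  refine ⟨_, m.isPrimitive_primPart, Associated.trans
    (associated_unit_mul_left _ _ (isUnit_C.2 (hne hm0).isUnit)).symm ?_⟩
  rw [heq]
  exact associated_unit_mul_left _ _ (isUnit_C.2 (hne hb0).isUnit)

variable (K) in
theorem exists_aeval_eq_zero_iff_dvd {B : Type*} [Ring B] [Algebra R B] [Algebra K B]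
    [IsScalarTower R K B] (x : B) : ∃ g : R[X], ∀ q : R[X], aeval x q = 0 ↔ g ∣ q := by
  by_cases hx : IsIntegral K x
  · obtain ⟨g, hg, hassoc⟩ := exists_isPrimitive_associated_map (R := R) (minpoly.ne_zero hx)
    refine ⟨g, fun q => ?_⟩
    rw [← aeval_map_algebraMap K, ← minpoly.dvd_iff, ← hassoc.dvd_iff_dvd_left]
    exact ⟨hg.dvd_of_fraction_map_dvd_fraction_map, Polynomial.map_dvd _⟩
  · refine ⟨0, fun q => ?_⟩
    rw [← aeval_map_algebraMap K, ← minpoly.dvd_iff, minpoly.eq_zero hx, zero_dvd_iff,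
      zero_dvd_iff, Polynomial.map_eq_zero_iff (IsFractionRing.injective R K)]

end Relations

/-- A list of signed monomials: `(true, j)` stands for `X ^ j` and `(false, j)` for `-X ^ j`. Such
lists represent integer polynomials as finite data. -/
abbrev SignedSum : Type := List (Bool × ℕ)

/-- The sign coded by a bit. -/
def sgn (b : Bool) : ℤ := if b then 1 else -1

theorem sgn_beq (a b : Bool) : sgn (a == b) = sgn a * sgn b := by
  cases a <;> cases b <;> rfl

theorem sgn_not (a : Bool) : sgn (!a) = -sgn a := by
  cases a <;> rfl

namespace SignedSum

/-- The polynomial denoted by a list of signed monomials. -/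
def toPoly (l : SignedSum) : ℤ[X] := (l.map fun x => monomial x.2 (sgn x.1)).sum

/-- The value of a list of signed monomials at a real number. -/
def val (δ : ℝ) (l : SignedSum) : ℝ := (l.map fun x => (sgn x.1 : ℝ) * δ ^ x.2).sum

@[simp] theorem toPoly_nil : toPoly [] = 0 := rfl

@[simp] theorem toPoly_cons (x : Bool × ℕ) (l : SignedSum) :
    toPoly (x :: l) = monomial x.2 (sgn x.1) + toPoly l := rfl

@[simp] theorem toPoly_append (l m : SignedSum) : toPoly (l ++ m) = toPoly l + toPoly m := by
  simp [toPoly]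

@[simp] theorem val_nil (δ : ℝ) : val δ [] = 0 := rfl

@[simp] theorem val_cons (δ : ℝ) (x : Bool × ℕ) (l : SignedSum) :
    val δ (x :: l) = sgn x.1 * δ ^ x.2 + val δ l := rfl

@[simp] theorem val_append (δ : ℝ) (l m : SignedSum) : val δ (l ++ m) = val δ l + val δ m := by
  simp [val]

theorem aeval_toPoly (δ : ℝ) (l : SignedSum) : aeval δ (toPoly l) = val δ l := by
  induction l with
  | nil => simp
  | cons x l ih => simp [ih, aeval_monomial]

theorem coeff_toPoly (l : SignedSum) (j : ℕ) :
    (toPoly l).coeff j = (l.count (true, j) : ℤ) - l.count (false, j) := by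
  induction l with
  | nil => simp
  | cons x l ih =>
    obtain ⟨b, i⟩ := x
    rw [toPoly_cons, coeff_add, ih, coeff_monomial, List.count_cons, List.count_cons]
    by_cases h : i = j <;> cases b <;> simp [h, sgn] <;> ring

theorem toPoly_eq_zero_iff (l : SignedSum) :
    toPoly l = 0 ↔ ∀ x ∈ l, l.count (true, x.2) = l.count (false, x.2) := by
  have hcoeff : toPoly l = 0 ↔ ∀ j, l.count (true, j) = l.count (false, j) := by
    simp only [Polynomial.ext_iff, coeff_toPoly, coeff_zero, sub_eq_zero, Nat.cast_inj]
  refine hcoeff.trans ⟨fun h x _ => h x.2, fun h j => ?_⟩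
  by_cases htrue : (true, j) ∈ l
  · exact h _ htrue
  by_cases hfalse : (false, j) ∈ l
  · exact h _ hfalse
  rw [List.count_eq_zero_of_not_mem htrue, List.count_eq_zero_of_not_mem hfalse]

theorem toPoly_surjective : Function.Surjective toPoly := by
  intro q
  induction q using Polynomial.induction_on' with
  | add p q hp hq =>
    obtain ⟨l, rfl⟩ := hp
    obtain ⟨m, rfl⟩ := hq
    exact ⟨l ++ m, toPoly_append _ _⟩
  | monomial n a =>
    have hreplicate (b : Bool) (k : ℕ) :
        toPoly (List.replicate k (b, n)) = monomial n (k * sgn b) := by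
      rw [toPoly, List.map_replicate, List.sum_replicate, ← map_nsmul, nsmul_eq_mul]
    rcases Int.eq_nat_or_neg a with ⟨k, rfl | rfl⟩
    · exact ⟨_, (hreplicate true k).trans (by simp [sgn])⟩
    · exact ⟨_, (hreplicate false k).trans (by simp [sgn])⟩

/-- The product of two lists of signed monomials, term by term. -/
def mul (l m : SignedSum) : SignedSum :=
  l.flatMap fun x => m.map fun y => (x.1 == y.1, x.2 + y.2)

theorem toPoly_mul (l m : SignedSum) : toPoly (mul l m) = toPoly l * toPoly m := by
  have hterm (x : Bool × ℕ) : toPoly (m.map fun y => (x.1 == y.1, x.2 + y.2)) =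
      monomial x.2 (sgn x.1) * toPoly m := by
    induction m with
    | nil => simp
    | cons y m ih => simp [ih, mul_add, monomial_mul_monomial, sgn_beq]
  induction l with
  | nil => simp [mul]
  | cons x l ih =>
    simp only [mul, List.flatMap_cons, toPoly_append] at ih ⊢
    rw [hterm, ih, toPoly_cons, add_mul]

/-- The negative of a list of signed monomials. -/
def neg (l : SignedSum) : SignedSum := l.map fun x => (!x.1, x.2)

theorem val_neg (δ : ℝ) (l : SignedSum) : val δ (neg l) = -val δ l := by
  induction l with
  | nil => simp [neg]
  | cons x l ih =>
    simp only [neg, List.map_cons, val_cons] at ih ⊢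
    rw [ih, sgn_not]
    push_cast
    ring

theorem exists_val_eq_zero_iff_dvd (δ : ℝ) :
    ∃ g : SignedSum, ∀ l, val δ l = 0 ↔ toPoly g ∣ toPoly l := by
  obtain ⟨q, hq⟩ := exists_aeval_eq_zero_iff_dvd (R := ℤ) ℚ δ
  obtain ⟨g, rfl⟩ := toPoly_surjective q
  exact ⟨g, fun l => by rw [← aeval_toPoly, hq]⟩

/-! ### Certificates for the sign -/

/-- The check that `k` codes a list `q` with `l = -g q`, which certifies that `g` divides `l`. -/
def zeroCert (g l : SignedSum) (k : ℕ) : Bool :=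
  ((Encodable.decode (α := SignedSum) k).map fun q =>
    decide (toPoly (l ++ mul g q) = 0)).getD false

theorem exists_zeroCert_iff (g l : SignedSum) :
    (∃ k, zeroCert g l k = true) ↔ toPoly g ∣ toPoly l := by
  have hmul (q : SignedSum) : toPoly (l ++ mul g q) = 0 ↔ toPoly l = toPoly g * -toPoly q := by
    rw [toPoly_append, toPoly_mul, mul_neg, eq_neg_iff_add_eq_zero]
  constructor
  · rintro ⟨k, hk⟩
    obtain ⟨q, -, hq⟩ : ∃ q, Encodable.decode (α := SignedSum) k = some q ∧
        toPoly (l ++ mul g q) = 0 := by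
      cases hd : Encodable.decode (α := SignedSum) k <;> simp_all [zeroCert]
    exact ⟨_, (hmul q).1 hq⟩
  · rintro ⟨r, hr⟩
    obtain ⟨q, hq⟩ := toPoly_surjective (-r)
    refine ⟨Encodable.encode q, ?_⟩
    rw [zeroCert, Encodable.encodek, Option.map_some, Option.getD_some, decide_eq_true_iff, hmul,
      hq, neg_neg, hr]

/-- The sum of the monomials of one sign, without the sign, at a real number. -/
def valPart (b : Bool) (y : ℝ) (l : SignedSum) : ℝ :=
  (l.map fun x => if x.1 = b then y ^ x.2 else 0).sum

theorem val_eq_sub (δ : ℝ) (l : SignedSum) :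
    val δ l = valPart true δ l - valPart false δ l := by
  simp only [valPart]
  induction l with
  | nil => simp
  | cons x l ih =>
    obtain ⟨b, j⟩ := x
    rw [val_cons, ih]
    cases b <;> simp [sgn] <;> ring

theorem valPart_le_valPart (b : Bool) {y z : ℝ} (hy : 0 ≤ y) (hyz : y ≤ z) (l : SignedSum) :
    valPart b y l ≤ valPart b z l := by
  refine List.sum_le_sum fun x _ => ?_
  split_ifs
  · exact pow_le_pow_left₀ hy hyz _
  · rfl

theorem continuous_valPart (b : Bool) (l : SignedSum) : Continuous fun y => valPart b y l := by
  simp only [valPart]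
  induction l with
  | nil => exact continuous_const
  | cons x l ih =>
    simp only [List.map_cons, List.sum_cons]
    split_ifs <;> fun_prop

/-- The sum of the exponents. It serves as an upper bound for each of them. -/
def deg (l : SignedSum) : ℕ := l.foldr (fun x n => x.2 + n) 0

theorem le_deg {l : SignedSum} {x : Bool × ℕ} (h : x ∈ l) : x.2 ≤ deg l := by
  induction l with
  | nil => simp at h
  | cons y l ih =>
    change x.2 ≤ y.2 + deg l
    rcases List.mem_cons.1 h with rfl | h
    · exact Nat.le_add_right _ _
    · exact (ih h).trans (Nat.le_add_left _ _)

/-- The sum of the monomials of one sign, homogenised to degree `D`, at the fraction `a / d`. -/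
def part (b : Bool) (D a d : ℕ) (l : SignedSum) : ℕ :=
  l.foldr (fun x n => (if x.1 = b then a ^ x.2 * d ^ (D - x.2) else 0) + n) 0

theorem cast_part (b : Bool) (D a : ℕ) {d : ℕ} (hd : 0 < d) {l : SignedSum}
    (hl : ∀ x ∈ l, x.2 ≤ D) : (part b D a d l : ℝ) = (d : ℝ) ^ D * valPart b (a / d) l := by
  simp only [valPart]
  induction l with
  | nil => simp [part]
  | cons x l ih =>
    have hcons : part b D a d (x :: l) =
      (if x.1 = b then a ^ x.2 * d ^ (D - x.2) else 0) + part b D a d l := rfl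
    rw [hcons, Nat.cast_add, ih fun y hy => hl y (List.mem_cons_of_mem _ hy), List.map_cons,
      List.sum_cons, mul_add]
    congr 1
    have hd0 : (d : ℝ) ≠ 0 := by positivity
    split_ifs
    · push_cast
      rw [pow_sub₀ _ hd0 (hl x List.mem_cons_self), div_pow]
      field_simp
    · simp

/-- The check that the negative part of `l` at `(a + 1) / 2 ^ k` is less than the positive part at
`(a - 1) / 2 ^ k`, with truncated subtraction. If `|2 ^ k δ - a| ≤ 1`, then it certifies that the
value at `δ` is positive. -/
def certPos (l : SignedSum) (k a : ℕ) : Bool :=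
  decide (part false (deg l) (a + 1) (2 ^ k) l < part true (deg l) (a - 1) (2 ^ k) l)

theorem certPos_iff (l : SignedSum) (k a : ℕ) : certPos l k a = true ↔
    valPart false (((a + 1 : ℕ) : ℝ) / 2 ^ k) l < valPart true (((a - 1 : ℕ) : ℝ) / 2 ^ k) l := by
  rw [certPos, decide_eq_true_iff, ← @Nat.cast_lt ℝ,
    cast_part _ _ _ (by positivity) fun _ => le_deg,
    cast_part _ _ _ (by positivity) fun _ => le_deg,
    mul_lt_mul_iff_right₀ (by positivity), Nat.cast_pow, Nat.cast_ofNat]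

theorem abs_cast_pred_sub_le {a : ℕ} {y : ℝ} (hy : 0 ≤ y) (ha : |y - a| ≤ 1) :
    ((a - 1 : ℕ) : ℝ) ≤ y ∧ |((a - 1 : ℕ) : ℝ) - y| ≤ 2 := by
  rw [abs_le] at ha ⊢
  rcases Nat.eq_zero_or_pos a with rfl | hpos
  · simp only [Nat.cast_zero, sub_zero, zero_le, Nat.sub_eq_zero_of_le] at ha ⊢
    exact ⟨hy, by linarith, by linarith⟩
  · rw [Nat.cast_sub hpos, Nat.cast_one]
    exact ⟨by linarith, by linarith, by linarith⟩

theorem abs_cast_succ_sub_le {a : ℕ} {y : ℝ} (ha : |y - a| ≤ 1) :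
    y ≤ ((a + 1 : ℕ) : ℝ) ∧ |((a + 1 : ℕ) : ℝ) - y| ≤ 2 := by
  rw [abs_le] at ha ⊢
  push_cast
  exact ⟨by linarith, by linarith, by linarith⟩

theorem val_pos_of_certPos {δ : ℝ} (hδ : 0 ≤ δ) {l : SignedSum} {k a : ℕ}
    (ha : |δ * 2 ^ k - a| ≤ 1) (h : certPos l k a = true) : 0 < val δ l := by
  have hpow : (0 : ℝ) < 2 ^ k := by positivity
  have hlower : ((a - 1 : ℕ) : ℝ) / 2 ^ k ≤ δ :=
    (div_le_iff₀ hpow).2 (abs_cast_pred_sub_le (by positivity) ha).1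
  have hupper : δ ≤ ((a + 1 : ℕ) : ℝ) / 2 ^ k := (le_div_iff₀ hpow).2 (abs_cast_succ_sub_le ha).1
  rw [val_eq_sub, sub_pos]
  calc valPart false δ l ≤ valPart false (((a + 1 : ℕ) : ℝ) / 2 ^ k) l :=
        valPart_le_valPart _ hδ hupper l
    _ < valPart true (((a - 1 : ℕ) : ℝ) / 2 ^ k) l := (certPos_iff l k a).1 h
    _ ≤ valPart true δ l := valPart_le_valPart _ (by positivity) hlower l

theorem tendsto_div_two_pow {r : ℕ → ℝ} {δ C : ℝ} (hr : ∀ k, |r k - δ * 2 ^ k| ≤ C) :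
    Tendsto (fun k => r k / 2 ^ k) atTop (𝓝 δ) := by
  have hzero : Tendsto (fun k : ℕ => C / 2 ^ k) atTop (𝓝 0) :=
    tendsto_const_nhds.div_atTop (tendsto_pow_atTop_atTop_of_one_lt one_lt_two)
  refine tendsto_iff_dist_tendsto_zero.2 (squeeze_zero (fun _ => dist_nonneg) (fun k => ?_) hzero)
  have hpow : (0 : ℝ) < 2 ^ k := by positivity
  have hsub : r k / 2 ^ k - δ = (r k - δ * 2 ^ k) / 2 ^ k := by field_simp
  rw [Real.dist_eq, hsub, abs_div, abs_of_pos hpow]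
  exact div_le_div_of_nonneg_right (hr k) hpow.le

theorem exists_certPos {δ : ℝ} (hδ : 0 ≤ δ) {a : ℕ → ℕ} (ha : ∀ k, |δ * 2 ^ k - a k| ≤ 1)
    {l : SignedSum} (h : 0 < val δ l) : ∃ k, certPos l k (a k) = true := by
  have hupper : Tendsto (fun k => ((a k + 1 : ℕ) : ℝ) / 2 ^ k) atTop (𝓝 δ) :=
    tendsto_div_two_pow fun k => (abs_cast_succ_sub_le (ha k)).2
  have hlower : Tendsto (fun k => ((a k - 1 : ℕ) : ℝ) / 2 ^ k) atTop (𝓝 δ) :=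
    tendsto_div_two_pow fun k => (abs_cast_pred_sub_le (by positivity) (ha k)).2
  rw [val_eq_sub, sub_pos] at h
  obtain ⟨k, hk⟩ := (Tendsto.eventually_lt (((continuous_valPart false l).tendsto δ).comp hupper)
    (((continuous_valPart true l).tendsto δ).comp hlower) h).exists
  exact ⟨k, (certPos_iff _ _ _).2 hk⟩

end SignedSum

/-! ### Computability of the sign -/

theorem primrec_nat_pow : Primrec₂ ((· ^ ·) : ℕ → ℕ → ℕ) :=
  Primrec₂.unpaired'.1 Nat.Primrec.pow

theorem primrec_int_toNat : Primrec Int.toNat := by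
  have h : Primrec fun z : ℤ =>
      bif (Encodable.encode z).bodd then 0 else (Encodable.encode z).div2 :=
    Primrec.cond (Primrec.nat_bodd.comp Primrec.encode) (Primrec.const 0)
      (Primrec.nat_div2.comp Primrec.encode)
  refine h.of_eq fun z => ?_
  rcases z with m | m
  · have hcode : Encodable.encode (Int.ofNat m) = 2 * m := rfl
    rw [hcode]
    simp
  · have hcode : Encodable.encode (Int.negSucc m) = 2 * m + 1 := rfl
    rw [hcode]
    simp

theorem primrec_list_count {α : Type*} [Primcodable α] [BEq α] [LawfulBEq α] :
    Primrec₂ fun (l : List α) (a : α) => l.count a := by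
  classical
  have h : Primrec₂ fun (l : List α) (a : α) =>
      l.foldr (fun x n => (if x = a then 1 else 0) + n) 0 :=
    Primrec.list_foldr
      (h := fun (p : List α × α) (x : α × ℕ) => (if x.1 = p.2 then 1 else 0) + x.2)
      Primrec.fst (Primrec.const 0)
      (Primrec.nat_add.comp (Primrec.ite (Primrec.eq.comp (Primrec.fst.comp Primrec.snd)
        (Primrec.snd.comp Primrec.fst)) (Primrec.const 1) (Primrec.const 0))
        (Primrec.snd.comp Primrec.snd)).to₂
  refine h.of_eq fun l a => ?_
  induction l with
  | nil => rfl
  | cons x l ih =>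
    rw [List.foldr_cons, ih, List.count_cons]
    by_cases h : x = a <;> simp [h, add_comm]

theorem exists_computable_search {α σ : Type*} [Primcodable α] [Primcodable σ]
    {f : α → ℕ → Option σ} (hf : Computable₂ f) (h : ∀ x, ∃ k, f x k ≠ none) :
    ∃ g : α → σ, Computable g ∧ ∀ x, ∃ k, f x k = some (g x) := by
  have hdom (x : α) : (Nat.rfindOpt (f x)).Dom := by
    obtain ⟨k, hk⟩ := h x
    obtain ⟨b, hb⟩ := Option.ne_none_iff_exists'.1 hk
    exact Nat.rfindOpt_dom.2 ⟨k, b, hb⟩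
  exact ⟨fun x => (Nat.rfindOpt (f x)).get (hdom x),
    (Partrec.rfindOpt hf).of_eq_tot fun x => Part.get_mem _,
    fun x => Nat.rfindOpt_spec (Part.get_mem (hdom x))⟩

namespace SignedSum

theorem primrec_deg : Primrec deg :=
  Primrec.list_foldr (h := fun _ (x : (Bool × ℕ) × ℕ) => x.1.2 + x.2) Primrec.id (Primrec.const 0)
    (Primrec.nat_add.comp (Primrec.snd.comp (Primrec.fst.comp Primrec.snd))
      (Primrec.snd.comp Primrec.snd)).to₂

theorem primrec_part (b : Bool) {α : Type*} [Primcodable α] {D a d : α → ℕ} {l : α → SignedSum}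
    (hD : Primrec D) (ha : Primrec a) (hd : Primrec d) (hl : Primrec l) :
    Primrec fun x => part b (D x) (a x) (d x) (l x) := by
  have hexp : Primrec fun z : α × (Bool × ℕ) × ℕ => z.2.1.2 :=
    Primrec.snd.comp (Primrec.fst.comp Primrec.snd)
  have hterm : Primrec fun z : α × (Bool × ℕ) × ℕ => a z.1 ^ z.2.1.2 * d z.1 ^ (D z.1 - z.2.1.2) :=
    Primrec.nat_mul.comp (primrec_nat_pow.comp (ha.comp Primrec.fst) hexp)
      (primrec_nat_pow.comp (hd.comp Primrec.fst)
        (Primrec.nat_sub.comp (hD.comp Primrec.fst) hexp))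
  exact Primrec.list_foldr (h := fun x (y : (Bool × ℕ) × ℕ) =>
      (if y.1.1 = b then a x ^ y.1.2 * d x ^ (D x - y.1.2) else 0) + y.2) hl (Primrec.const 0)
    (Primrec.nat_add.comp (Primrec.ite
      (Primrec.eq.comp (Primrec.fst.comp (Primrec.fst.comp Primrec.snd)) (Primrec.const b))
      hterm (Primrec.const 0)) (Primrec.snd.comp Primrec.snd)).to₂

theorem primrec_certPos : Primrec fun x : SignedSum × ℕ × ℕ => certPos x.1 x.2.1 x.2.2 := by
  have hpow : Primrec fun x : SignedSum × ℕ × ℕ => 2 ^ x.2.1 :=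
    primrec_nat_pow.comp (Primrec.const 2) (Primrec.fst.comp Primrec.snd)
  have ha : Primrec fun x : SignedSum × ℕ × ℕ => x.2.2 := Primrec.snd.comp Primrec.snd
  have hdeg : Primrec fun x : SignedSum × ℕ × ℕ => deg x.1 := primrec_deg.comp Primrec.fst
  exact (Primrec.nat_lt.comp (primrec_part false hdeg (Primrec.succ.comp ha) hpow Primrec.fst)
    (primrec_part true hdeg (Primrec.pred.comp ha) hpow Primrec.fst)).decide

theorem primrec_neg : Primrec neg :=
  Primrec.list_map Primrec.id (Primrec.pair (Primrec.not.comp (Primrec.fst.comp Primrec.snd))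
    (Primrec.snd.comp Primrec.snd)).to₂

theorem primrec_mul : Primrec₂ mul := by
  have hbeq : Primrec fun z : ((SignedSum × SignedSum) × (Bool × ℕ)) × (Bool × ℕ) =>
      z.1.2.1 == z.2.1 :=
    (Primrec.dom_finite fun x : Bool × Bool => x.1 == x.2).comp
      ((Primrec.fst.comp (Primrec.snd.comp Primrec.fst)).pair (Primrec.fst.comp Primrec.snd))
  have hadd : Primrec fun z : ((SignedSum × SignedSum) × (Bool × ℕ)) × (Bool × ℕ) =>
      z.1.2.2 + z.2.2 :=
    Primrec.nat_add.comp (Primrec.snd.comp (Primrec.snd.comp Primrec.fst))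
      (Primrec.snd.comp Primrec.snd)
  exact Primrec.list_flatMap (f := fun p : SignedSum × SignedSum => p.1) Primrec.fst
    (Primrec.list_map (Primrec.snd.comp Primrec.fst) (hbeq.pair hadd).to₂).to₂

theorem primrecPred_toPoly_eq_zero : PrimrecPred fun l : SignedSum => toPoly l = 0 := by
  have hcount (b : Bool) : Primrec₂ fun (x : Bool × ℕ) (l : SignedSum) => l.count (b, x.2) :=
    primrec_list_count.comp Primrec.snd ((Primrec.const b).pair (Primrec.snd.comp Primrec.fst))
  have hrel : PrimrecRel fun (x : Bool × ℕ) (l : SignedSum) =>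
      l.count (true, x.2) = l.count (false, x.2) :=
    Primrec.eq.comp (hcount true) (hcount false)
  exact ((PrimrecRel.forall_mem_list hrel).comp Primrec.id Primrec.id).of_eq
    fun l => (toPoly_eq_zero_iff l).symm

theorem primrec_zeroCert (g : SignedSum) : Primrec₂ (zeroCert g) := by
  have happend : Primrec₂ fun (x : SignedSum × ℕ) (q : SignedSum) => x.1 ++ mul g q :=
    Primrec.list_append.comp (Primrec.fst.comp Primrec.fst)
      (primrec_mul.comp (Primrec.const g) Primrec.snd)
  exact Primrec.option_getD.comp
    (Primrec.option_map (Primrec.decode.comp Primrec.snd)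
      (primrecPred_toPoly_eq_zero.comp happend).decide.to₂) (Primrec.const _)

/-- Stage `k` of the search for a certificate of the sign, where `a` approximates `2 ^ k δ` and `g`
generates the relations of `δ`: `some true` for a positive value, `some false` otherwise. -/
@[irreducible] def signStage (g l : SignedSum) (k a : ℕ) : Option Bool :=
  bif certPos l k a then some true else
    bif certPos (neg l) k a || zeroCert g l k then some false else none

theorem primrec_signStage (g : SignedSum) :
    Primrec fun x : SignedSum × ℕ × ℕ => signStage g x.1 x.2.1 x.2.2 := by
  have hneg : Primrec fun x : SignedSum × ℕ × ℕ => certPos (neg x.1) x.2.1 x.2.2 :=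
    primrec_certPos.comp ((primrec_neg.comp Primrec.fst).pair Primrec.snd)
  have hzero : Primrec fun x : SignedSum × ℕ × ℕ => zeroCert g x.1 x.2.1 :=
    (primrec_zeroCert g).comp Primrec.fst (Primrec.fst.comp Primrec.snd)
  unfold signStage
  exact Primrec.cond primrec_certPos (Primrec.const _)
    (Primrec.cond (Primrec.or.comp hneg hzero) (Primrec.const _) (Primrec.const _))

section Sign

variable {δ : ℝ} (hδ : 0 ≤ δ) {g : SignedSum} (hg : ∀ l, val δ l = 0 ↔ toPoly g ∣ toPoly l)
  {l : SignedSum}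

include hδ hg

theorem eq_true_iff_of_mem_signStage {k a : ℕ} (ha : |δ * 2 ^ k - a| ≤ 1) {b : Bool}
    (hb : b ∈ signStage g l k a) : b = true ↔ 0 < val δ l := by
  rw [signStage, Option.mem_def] at hb
  cases hpos : certPos l k a with
  | true =>
    obtain rfl : true = b := by simpa [hpos] using hb
    simpa using val_pos_of_certPos hδ ha hpos
  | false =>
    obtain ⟨hcert, rfl⟩ : (certPos (neg l) k a = true ∨ zeroCert g l k = true) ∧ false = b := by
      cases hneg : certPos (neg l) k a <;> cases hzero : zeroCert g l k <;> simp_all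
    have hle : val δ l ≤ 0 := by
      rcases hcert with hneg | hzero
      · have := val_pos_of_certPos hδ ha hneg
        rw [val_neg] at this
        linarith
      · exact ((hg l).2 ((exists_zeroCert_iff g l).1 ⟨k, hzero⟩)).le
    simpa using hle

theorem exists_signStage_ne_none {a : ℕ → ℕ} (ha : ∀ k, |δ * 2 ^ k - a k| ≤ 1) :
    ∃ k, signStage g l k (a k) ≠ none := by
  obtain ⟨k, hk⟩ : ∃ k, certPos l k (a k) = true ∨ certPos (neg l) k (a k) = true ∨
      zeroCert g l k = true := by
    rcases lt_trichotomy 0 (val δ l) with hpos | hzero | hneg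
    · exact (exists_certPos hδ ha hpos).imp fun _ => Or.inl
    · exact ((exists_zeroCert_iff g l).2 ((hg l).1 hzero.symm)).imp fun _ hk => Or.inr (Or.inr hk)
    · refine (exists_certPos hδ ha (l := neg l) ?_).imp fun _ hk => Or.inr (Or.inl hk)
      rw [val_neg]
      linarith
  refine ⟨k, ?_⟩
  rw [signStage]
  cases hpos : certPos l k (a k) <;> cases hneg : certPos (neg l) k (a k) <;> simp_all

end Sign

theorem exists_computable_approx {δ : ℝ} (hδ : 0 ≤ δ) (hc : IsComputableReal δ) :
    ∃ a : ℕ → ℕ, Computable a ∧ ∀ k, |δ * 2 ^ k - a k| ≤ 1 := by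
  obtain ⟨f, hf, hfδ⟩ := hc
  refine ⟨fun k => (f k).toNat, primrec_int_toNat.to_comp.comp hf, fun k => ?_⟩
  have hpow : (0 : ℝ) < 2 ^ k := by positivity
  have happrox : |δ * 2 ^ k - f k| ≤ 1 := by
    have hsub : δ - (f k : ℝ) / 2 ^ k = (δ * 2 ^ k - f k) / 2 ^ k := by field_simp
    have := hfδ k
    rwa [hsub, abs_div, abs_of_pos hpow, div_le_div_iff_of_pos_right hpow] at this
  have hcast : (((f k).toNat : ℕ) : ℝ) = max (f k : ℝ) 0 := by
    rw [← Int.cast_natCast, Int.toNat_eq_max, Int.cast_max, Int.cast_zero]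
  calc |δ * 2 ^ k - (f k).toNat| = |max (δ * 2 ^ k) 0 - max (f k : ℝ) 0| := by
        rw [hcast, max_eq_left (by positivity : 0 ≤ δ * 2 ^ k)]
    _ ≤ |δ * 2 ^ k - f k| := abs_max_sub_max_le_abs _ _ _
    _ ≤ 1 := happrox

/-- Positivity alone is only semidecidable. The search terminates in the case of value zero because
the relations of `δ` are the multiples of one polynomial, hence recursively enumerable. -/
theorem exists_computable_pos {δ : ℝ} (hδ : 0 ≤ δ) (hc : IsComputableReal δ) :
    ∃ pos : SignedSum → Bool, Computable pos ∧ ∀ l, pos l = true ↔ 0 < val δ l := by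
  obtain ⟨a, hac, ha⟩ := exists_computable_approx hδ hc
  obtain ⟨g, hg⟩ := exists_val_eq_zero_iff_dvd δ
  have hargs : Computable fun x : SignedSum × ℕ => (x.1, x.2, a x.2) :=
    Computable.fst.pair (Computable.snd.pair (hac.comp Computable.snd))
  have hstage : Computable₂ fun (l : SignedSum) (k : ℕ) => signStage g l k (a k) :=
    (primrec_signStage g).to_comp.comp hargs
  obtain ⟨pos, hpos, hspec⟩ :=
    exists_computable_search hstage fun _ => exists_signStage_ne_none hδ hg ha
  refine ⟨pos, hpos, fun l => ?_⟩
  obtain ⟨k, hk⟩ := hspec l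
  exact eq_true_iff_of_mem_signStage hδ hg (ha k) hk

end SignedSum

/-! ### Sparse programs -/

/-- The variables of a sparse program. Those with the bit `true` are written during a cycle and
rectified when they are read, those with the bit `false` hold the state at its beginning. -/
abbrev Var : Type := ℕ × Bool

/-- One unit of weight of a network of precision `δ`: the edge `(b, src, i)` adds `±δ` times what
is read from `src` to the variable `(i, true)`. -/
abbrev Edge : Type := Bool × Var × ℕ

/-- What is read from a variable with value `x`, where `r` says whether it is rectified. -/
def act (r : Bool) (x : ℝ) : ℝ := if r then max x 0 else x

/-- The effect of one edge on the values of the variables. -/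
def edgeStep (δ : ℝ) (Y : Var → ℝ) (e : Edge) : Var → ℝ :=
  fun v => Y v + if v = (e.2.2, true) then sgn e.1 * (δ * act e.2.1.2 (Y e.2.1)) else 0

/-- The initial values: the variable `(0, false)` is the constant `1`, which carries the biases. -/
def startState : Var → ℝ := fun v => if v = (0, false) then 1 else 0

/-- At the end of a cycle `(i, true)` is moved to `(i, false)`. -/
def nextState (Y : Var → ℝ) : Var → ℝ := fun v =>
  if v.2 then 0 else if v.1 = 0 then 1 else Y (v.1, true)

/-- The values of the variables after `t` cycles. -/
def sparseState (δ : ℝ) (E : List Edge) : ℕ → Var → ℝ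
  | 0 => startState
  | t + 1 => nextState (E.foldl (edgeStep δ) (sparseState δ E t))

/-- The output of a sparse program, for which the variables `1`, `2`, `3` are the channels. -/
def SparseOutputs (δ : ℝ) (E : List Edge) (s : List Bool) : Prop :=
  HaltsWith (fun t => sparseState δ E t (1, false)) (fun t => sparseState δ E t (2, false))
    (fun t => sparseState δ E t (3, false)) 1 s

/-- A finite description of the values of all variables as polynomials in `δ`: a list of signed
monomials, each of which is attributed to a variable. -/
abbrev Log : Type := List (Var × Bool × ℕ)

/-- The monomials attributed to a variable. -/
def collect (L : Log) (v : Var) : SignedSum :=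
  L.filterMap fun x => if x.1 = v then some x.2 else none

/-- The values of the variables described by a log. -/
def logVal (δ : ℝ) (L : Log) (v : Var) : ℝ := SignedSum.val δ (collect L v)

@[simp] theorem logVal_nil (δ : ℝ) (v : Var) : logVal δ [] v = 0 := rfl

theorem logVal_cons (δ : ℝ) (x : Var × Bool × ℕ) (L : Log) (v : Var) :
    logVal δ (x :: L) v = (if x.1 = v then (sgn x.2.1 : ℝ) * δ ^ x.2.2 else 0) + logVal δ L v := by
  by_cases h : x.1 = v <;> simp [logVal, collect, h]

theorem logVal_append (δ : ℝ) (L L' : Log) (v : Var) :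
    logVal δ (L ++ L') v = logVal δ L v + logVal δ L' v := by
  simp only [logVal, collect, List.filterMap_append, SignedSum.val_append]

/-- The effect of an edge on a log, given an oracle for positivity. -/
def logStep (pos : SignedSum → Bool) (L : Log) (e : Edge) : Log :=
  bif e.2.1.2 && !pos (collect L e.2.1) then L else
    L ++ (collect L e.2.1).map fun m => ((e.2.2, true), (m.1 == e.1, m.2 + 1))

theorem logVal_map (δ : ℝ) (l : SignedSum) (b : Bool) (w v : Var) :
    logVal δ (l.map fun m => (w, (m.1 == b, m.2 + 1))) v =
      if v = w then sgn b * (δ * SignedSum.val δ l) else 0 := by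
  induction l with
  | nil => simp
  | cons x l ih =>
    rw [List.map_cons, logVal_cons, ih, SignedSum.val_cons, sgn_beq]
    rcases eq_or_ne v w with rfl | h
    · simp only [if_true]
      push_cast
      ring
    · simp [h, h.symm]

/-- The log at the end of a cycle. -/
def logNext (L : Log) : Log :=
  ((0, false), (true, 0)) :: L.filterMap fun x =>
    if x.1.2 = true ∧ x.1.1 ≠ 0 then some ((x.1.1, false), x.2) else none

theorem logVal_logNext (δ : ℝ) (L : Log) : logVal δ (logNext L) = nextState (logVal δ L) := by
  have hmove (v : Var) : logVal δ (L.filterMap fun x =>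
      if x.1.2 = true ∧ x.1.1 ≠ 0 then some ((x.1.1, false), x.2) else none) v =
      if v.2 = false ∧ v.1 ≠ 0 then logVal δ L (v.1, true) else 0 := by
    obtain ⟨i, b⟩ := v
    induction L with
    | nil => simp
    | cons x L ih =>
      obtain ⟨⟨k, c⟩, m⟩ := x
      by_cases h : c = true ∧ k ≠ 0
      · rw [List.filterMap_cons_some (b := ((k, false), m)) (by simp [h]), logVal_cons, ih,
          logVal_cons]
        grind
      · rw [List.filterMap_cons_none (by simpa using h), ih, logVal_cons]
        grind
  funext ⟨i, b⟩
  rw [logNext, logVal_cons, hmove]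
  rcases b with _ | _ <;> rcases eq_or_ne i 0 with rfl | hi <;>
    simp_all [nextState, sgn, Ne.symm]

/-- The log after `t` cycles. -/
def logAt (pos : SignedSum → Bool) (E : List Edge) : ℕ → Log
  | 0 => [((0, false), (true, 0))]
  | t + 1 => logNext (E.foldl (logStep pos) (logAt pos E t))

section Oracle

variable {δ : ℝ} {pos : SignedSum → Bool} (hpos : ∀ l, pos l = true ↔ 0 < SignedSum.val δ l)
include hpos

theorem logVal_logStep (L : Log) (e : Edge) :
    logVal δ (logStep pos L e) = edgeStep δ (logVal δ L) e := by
  have hsrc : pos (collect L e.2.1) = true ↔ 0 < logVal δ L e.2.1 := hpos _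
  have hwrite (v : Var) : logVal δ (L ++ (collect L e.2.1).map fun m =>
      ((e.2.2, true), (m.1 == e.1, m.2 + 1))) v = logVal δ L v +
        if v = (e.2.2, true) then sgn e.1 * (δ * logVal δ L e.2.1) else 0 := by
    rw [logVal_append, logVal_map, ← logVal]
  funext v
  unfold logStep edgeStep act
  cases hrect : e.2.1.2 with
  | false => simpa using hwrite v
  | true =>
    cases hsign : pos (collect L e.2.1) with
    | true => simpa [max_eq_left (hsrc.1 hsign).le] using hwrite v
    | false =>
      have hle : logVal δ L e.2.1 ≤ 0 := not_lt.1 fun h => by simp [hsrc.2 h] at hsign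
      simp [max_eq_right hle]

theorem logVal_logAt (E : List Edge) (t : ℕ) : logVal δ (logAt pos E t) = sparseState δ E t := by
  have hfold (L : Log) : logVal δ (E.foldl (logStep pos) L) =
      E.foldl (edgeStep δ) (logVal δ L) :=
    (List.foldl_hom _ fun L e => (logVal_logStep hpos L e).symm).symm
  induction t with
  | zero =>
    funext v
    simp [logAt, logVal_cons, sparseState, startState, sgn, eq_comm]
  | succ t ih => rw [logAt, logVal_logNext, hfold, ih, sparseState]

end Oracle

/-! ### Running sparse programs -/

theorem computable₂_of_rec {α σ : Type*} [Primcodable α] [Primcodable σ] {f : α → ℕ → σ}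
    {g : α → σ} {h : α → ℕ × σ → σ} (hg : Computable g) (hh : Computable₂ h)
    (hzero : ∀ a, f a 0 = g a) (hsucc : ∀ a n, f a (n + 1) = h a (n, f a n)) : Computable₂ f := by
  have hrec : Computable fun x : α × ℕ => (Nat.rec (g x.1) (fun n s => h x.1 (n, s)) x.2 : σ) :=
    Computable.nat_rec Computable.snd (hg.comp Computable.fst)
      (hh.comp (Computable.fst.comp Computable.fst) Computable.snd).to₂
  refine hrec.of_eq fun ⟨a, n⟩ => ?_
  induction n with
  | zero => exact (hzero a).symm
  | succ n ih => exact (congrArg (fun s => h a (n, s)) ih).trans (hsucc a n).symm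

theorem computable_list_foldl {α β σ : Type*} [Primcodable α] [Primcodable β] [Primcodable σ]
    {f : α → List β} {g : α → σ} {h : α → σ × β → σ} (hf : Computable f) (hg : Computable g)
    (hh : Computable₂ h) : Computable fun a => (f a).foldl (fun s b => h a (s, b)) (g a) := by
  have hstep : Computable₂ fun (a : α) (p : ℕ × σ) =>
      (((f a)[p.1]?).map fun b => h a (p.2, b)).getD p.2 :=
    Computable.option_getD (Computable.option_map
      (Computable.list_getElem?.comp (hf.comp Computable.fst) (Computable.fst.comp Computable.snd))
      (hh.comp (Computable.fst.comp Computable.fst)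
        ((Computable.snd.comp (Computable.snd.comp Computable.fst)).pair Computable.snd)).to₂)
      (Computable.snd.comp Computable.snd)
  have htake : Computable₂ fun (a : α) (n : ℕ) =>
      ((f a).take n).foldl (fun s b => h a (s, b)) (g a) := by
    refine computable₂_of_rec hg hstep (fun a => rfl) fun a n => ?_
    rw [List.take_add_one, List.foldl_append]
    cases (f a)[n]? <;> rfl
  exact (htake.comp Computable.id (Computable.list_length.comp hf)).of_eq fun a => by simp

theorem primrec_collect : Primrec₂ collect :=
  Primrec.listFilterMap (f := fun x : Log × Var => x.1)
    (g := fun x y => if y.1 = x.2 then some y.2 else none) Primrec.fst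
    (Primrec.ite
      (Primrec.eq.comp (Primrec.fst.comp Primrec.snd) (Primrec.snd.comp Primrec.fst))
      (Primrec.option_some.comp (Primrec.snd.comp Primrec.snd)) (Primrec.const none)).to₂

theorem primrec_logNext : Primrec logNext := by
  have hwritten : PrimrecPred fun x : Log × Var × Bool × ℕ => x.2.1.2 = true :=
    Primrec.eq.comp (Primrec.snd.comp (Primrec.fst.comp Primrec.snd)) (Primrec.const true)
  have hconst : PrimrecPred fun x : Log × Var × Bool × ℕ => x.2.1.1 ≠ 0 :=
    (Primrec.eq.comp (Primrec.fst.comp (Primrec.fst.comp Primrec.snd)) (Primrec.const 0)).not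
  have hmove : Primrec fun x : Log × Var × Bool × ℕ =>
      (((x.2.1.1, false), x.2.2) : Var × Bool × ℕ) :=
    ((Primrec.fst.comp (Primrec.fst.comp Primrec.snd)).pair (Primrec.const false)).pair
      (Primrec.snd.comp Primrec.snd)
  exact Primrec.list_cons.comp (Primrec.const _) (Primrec.listFilterMap Primrec.id
    (Primrec.ite (hwritten.and hconst) (Primrec.option_some.comp hmove) (Primrec.const none)).to₂)

section Run

variable {pos : SignedSum → Bool} (hpos : Computable pos)

include hpos in
theorem computable_logStep : Computable₂ (logStep pos) := by
  have hsrc : Primrec fun x : Log × Edge => x.2.2.1 :=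
    Primrec.fst.comp (Primrec.snd.comp Primrec.snd)
  have hcollect : Primrec fun x : Log × Edge => collect x.1 x.2.2.1 :=
    primrec_collect.comp Primrec.fst hsrc
  have hidle : Computable fun x : Log × Edge => x.2.2.1.2 && !pos (collect x.1 x.2.2.1) :=
    Primrec.and.to_comp.comp (Primrec.snd.comp hsrc).to_comp
      (Primrec.not.to_comp.comp (hpos.comp hcollect.to_comp))
  have htarget : Primrec fun x : (Log × Edge) × Bool × ℕ => ((x.1.2.2.2, true) : Var) :=
    (Primrec.snd.comp (Primrec.snd.comp (Primrec.snd.comp Primrec.fst))).pair (Primrec.const true)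
  have hsign : Primrec fun x : (Log × Edge) × Bool × ℕ => x.2.1 == x.1.2.1 :=
    (Primrec.dom_finite fun x : Bool × Bool => x.1 == x.2).comp
      ((Primrec.fst.comp Primrec.snd).pair (Primrec.fst.comp (Primrec.snd.comp Primrec.fst)))
  have hexp : Primrec fun x : (Log × Edge) × Bool × ℕ => x.2.2 + 1 :=
    Primrec.succ.comp (Primrec.snd.comp Primrec.snd)
  exact Computable.cond hidle Computable.fst (Primrec.list_append.comp Primrec.fst
    (Primrec.list_map hcollect (htarget.pair (hsign.pair hexp)).to₂)).to_comp

include hpos in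
theorem computable_logAt : Computable₂ (logAt pos) := by
  have hfold : Computable fun z : List Edge × ℕ × Log => z.1.foldl (logStep pos) z.2.2 :=
    computable_list_foldl (h := fun _ y => logStep pos y.1 y.2) Computable.fst
      (Computable.snd.comp Computable.snd)
      ((computable_logStep hpos).comp (Computable.fst.comp Computable.snd)
        (Computable.snd.comp Computable.snd)).to₂
  exact computable₂_of_rec (g := fun _ => [((0, false), (true, 0))]) (Computable.const _)
    (primrec_logNext.to_comp.comp hfold).to₂ (fun _ => rfl) fun _ _ => rfl

variable (pos) in
/-- Whether the variable `(i, false)` is positive after `t` cycles. -/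
def channelPos (i : ℕ) (E : List Edge) (t : ℕ) : Bool := pos (collect (logAt pos E t) (i, false))

include hpos in
theorem computable_channelPos (i : ℕ) : Computable₂ (channelPos pos i) :=
  hpos.comp (primrec_collect.to_comp.comp (computable_logAt hpos) (Computable.const _))

theorem channelPos_iff {δ : ℝ} (hval : ∀ l, pos l = true ↔ 0 < SignedSum.val δ l) (i : ℕ)
    (E : List Edge) (t : ℕ) : channelPos pos i E t = true ↔ 0 < sparseState δ E t (i, false) := by
  rw [channelPos, hval, ← logVal_logAt hval, logVal]

variable (pos) in
/-- The bits emitted after the cycles `1, …, t`. -/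
def bitsUpto (E : List Edge) : ℕ → List Bool
  | 0 => []
  | t + 1 => bitsUpto E t ++
    bif channelPos pos 2 E (t + 1) then [channelPos pos 3 E (t + 1)] else []

include hpos in
theorem computable_bitsUpto : Computable₂ (bitsUpto pos) := by
  have hchannel (i : ℕ) : Computable₂ fun (E : List Edge) (p : ℕ × List Bool) =>
      channelPos pos i E (p.1 + 1) :=
    (computable_channelPos hpos i).comp Computable.fst
      (Computable.succ.comp (Computable.fst.comp Computable.snd))
  exact computable₂_of_rec (g := fun _ => []) (Computable.const _)
    (Computable.list_append.comp (Computable.snd.comp Computable.snd)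
      (Computable.cond (hchannel 2) (Computable.list_cons.comp (hchannel 3) (Computable.const []))
        (Computable.const []))).to₂ (fun _ => rfl) fun _ _ => rfl

theorem bitsUpto_eq_flatMap {δ : ℝ} (hval : ∀ l, pos l = true ↔ 0 < SignedSum.val δ l)
    (E : List Edge) (t : ℕ) :
    bitsUpto pos E t = (List.range' 1 t).flatMap (emittedAt
      (fun t => sparseState δ E t (2, false)) fun t => sparseState δ E t (3, false)) := by
  induction t with
  | zero => rfl
  | succ t ih =>
    have hbit : channelPos pos 3 E (t + 1) = decide (0 < sparseState δ E (t + 1) (3, false)) := by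
      rw [Bool.eq_iff_iff, channelPos_iff hval, decide_eq_true_iff]
    rw [bitsUpto, ih, List.range'_concat, List.flatMap_append, List.flatMap_singleton, one_mul,
      add_comm 1 t, emittedAt, hbit]
    simp only [← channelPos_iff hval 2, Bool.cond_eq_ite]

end Run

theorem exists_partrec_run {δ : ℝ} (hδ : 0 ≤ δ) (hc : IsComputableReal δ) :
    ∃ run : List Edge →. List Bool, Partrec run ∧ ∀ E s, SparseOutputs δ E s → s ∈ run E := by
  obtain ⟨pos, hpos, hval⟩ := SignedSum.exists_computable_pos hδ hc
  have hhalt : Computable₂ fun E t => channelPos pos 1 E (t + 1) :=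
    (computable_channelPos hpos 1).comp Computable.fst (Computable.succ.comp Computable.snd)
  refine ⟨fun E => (Nat.rfind fun t => Part.some (channelPos pos 1 E (t + 1))).map
    (bitsUpto pos E), (Partrec.rfind hhalt.partrec₂).map (computable_bitsUpto hpos), ?_⟩
  rintro E _ ⟨τ, hτ, hhalts, hruns, rfl⟩
  obtain ⟨t, rfl⟩ := Nat.exists_eq_add_of_le' hτ
  refine (Part.mem_map_iff _).2 ⟨t, Nat.mem_rfind.2 ⟨?_, fun {m} hm => ?_⟩, ?_⟩
  · exact Part.mem_some_iff.2 ((channelPos_iff hval _ _ _).2 hhalts).symm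
  · refine Part.mem_some_iff.2 (Bool.eq_false_iff.2 fun h => ?_).symm
    exact hruns (m + 1) (by omega) (by omega) ((channelPos_iff hval _ _ _).1 h)
  · rw [bitsUpto_eq_flatMap hval, Nat.add_sub_cancel]

/-! ### Sparse programs from networks -/

/-- What an edge adds to a variable. -/
def contribution (δ : ℝ) (Y : Var → ℝ) (v : Var) (e : Edge) : ℝ :=
  if v = (e.2.2, true) then sgn e.1 * (δ * act e.2.1.2 (Y e.2.1)) else 0

theorem foldl_edgeStep {δ : ℝ} {E : List Edge}
    (hE : ∀ e ∈ E, ∀ e' ∈ E, e.2.1 ≠ (e'.2.2, true)) (Y : Var → ℝ) (v : Var) :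
    E.foldl (edgeStep δ) Y v = Y v + (E.map (contribution δ Y v)).sum := by
  induction E generalizing Y with
  | nil => simp
  | cons e E ih =>
    have hunread : E.map (contribution δ (edgeStep δ Y e) v) = E.map (contribution δ Y v) :=
      List.map_congr_left fun a ha => by
        have hne := hE a (List.mem_cons_of_mem _ ha) e List.mem_cons_self
        simp [contribution, edgeStep, hne]
    rw [List.foldl_cons, ih fun a ha b hb => hE a (List.mem_cons_of_mem _ ha) b
      (List.mem_cons_of_mem _ hb), hunread, List.map_cons, List.sum_cons, ← add_assoc]
    rfl

/-- The unit edges that make up a weight. -/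
def weightEdges (δ w : ℝ) (src : Var) (tgt : ℕ) : List Edge :=
  List.replicate (round (w / δ)).natAbs (decide (0 ≤ round (w / δ)), src, tgt)

section Weight

variable {δ : ℝ}

theorem round_mul_intCast_div (hδ : 0 < δ) (k : ℤ) : round (δ * k / δ) = k := by
  rw [mul_div_cancel_left₀ _ hδ.ne', round_intCast]

theorem natAbs_mul_sgn (k : ℤ) : (k.natAbs : ℝ) * sgn (decide (0 ≤ k)) = k := by
  rw [Nat.cast_natAbs]
  rcases le_or_gt 0 k with h | h
  · simp [sgn, h, abs_of_nonneg h]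
  · simp [sgn, not_le.2 h, abs_of_neg h]

theorem sum_contribution_weightEdges (hδ : 0 < δ) {w : ℝ} (hw : ∃ k : ℤ, w = δ * k)
    (Y : Var → ℝ) (v src : Var) (tgt : ℕ) :
    ((weightEdges δ w src tgt).map (contribution δ Y v)).sum =
      if v = (tgt, true) then w * act src.2 (Y src) else 0 := by
  obtain ⟨k, rfl⟩ := hw
  rw [weightEdges, round_mul_intCast_div hδ, List.map_replicate, List.sum_replicate, contribution]
  split_ifs
  · rw [nsmul_eq_mul, ← mul_assoc, natAbs_mul_sgn]
    ring
  · exact smul_zero _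

theorem length_weightEdges_le (hδ : 0 < δ) {B w : ℝ} (hw : ∃ k : ℤ, w = δ * k) (hB : |w| ≤ B)
    (src : Var) (tgt : ℕ) :
    (weightEdges δ w src tgt).length ≤ ⌊B / δ⌋₊ * nonzeroCount w := by
  obtain ⟨k, rfl⟩ := hw
  rw [weightEdges, round_mul_intCast_div hδ, List.length_replicate]
  rcases eq_or_ne k 0 with rfl | hk
  · simp
  · have hcount : nonzeroCount (δ * (k : ℝ)) = 1 := by simp [nonzeroCount, hδ.ne', hk]
    rw [abs_mul, abs_of_pos hδ] at hB
    rw [hcount, mul_one]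
    refine Nat.le_floor ?_
    rwa [le_div_iff₀' hδ, Nat.cast_natAbs, Int.cast_abs]

end Weight

/-- The edges of an affine layer. -/
def layerEdges (δ : ℝ) {m n : ℕ} (A : Matrix (Fin n) (Fin m) ℝ) (b : Fin n → ℝ)
    (src : Fin m → Var) (tgt : Fin n → ℕ) : List Edge :=
  (List.finRange n).flatMap fun i =>
    ((List.finRange m).flatMap fun j => weightEdges δ (A i j) (src j) (tgt i)) ++
      weightEdges δ (b i) (0, false) (tgt i)

theorem sum_map_flatMap {α β M : Type*} [AddCommMonoid M] (l : List α) (f : α → List β)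
    (g : β → M) : ((l.flatMap f).map g).sum = (l.map fun a => ((f a).map g).sum).sum := by
  induction l with
  | nil => rfl
  | cons a l ih => simp [ih]

section Layer

variable {δ : ℝ} {m n : ℕ} {A : Matrix (Fin n) (Fin m) ℝ} {b : Fin n → ℝ}

theorem mem_layerEdges {src : Fin m → Var} {tgt : Fin n → ℕ} {e : Edge}
    (he : e ∈ layerEdges δ A b src tgt) :
    (e.2.1 = (0, false) ∨ ∃ j, e.2.1 = src j) ∧ ∃ i, e.2.2 = tgt i := by
  simp only [layerEdges, weightEdges, List.mem_flatMap, List.mem_finRange, List.mem_append,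
    List.mem_replicate, true_and] at he
  obtain ⟨i, ⟨j, -, rfl⟩ | ⟨-, rfl⟩⟩ := he
  · exact ⟨.inr ⟨j, rfl⟩, i, rfl⟩
  · exact ⟨.inl rfl, i, rfl⟩

theorem sum_map_layerEdges {M : Type*} [AddCommMonoid M] (g : Edge → M) (src : Fin m → Var)
    (tgt : Fin n → ℕ) : ((layerEdges δ A b src tgt).map g).sum =
      ∑ i, ((∑ j, ((weightEdges δ (A i j) (src j) (tgt i)).map g).sum) +
        ((weightEdges δ (b i) (0, false) (tgt i)).map g).sum) := by
  simp only [layerEdges, sum_map_flatMap, List.map_append, List.sum_append, Fin.sum_univ_def]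

theorem length_layerEdges_le (hδ : 0 < δ) {B : ℝ}
    (h : ∀ w ∈ layerParams A b, (∃ k : ℤ, w = δ * k) ∧ |w| ≤ B)
    (src : Fin m → Var) (tgt : Fin n → ℕ) :
    (layerEdges δ A b src tgt).length ≤
      ⌊B / δ⌋₊ * ((layerParams A b).map nonzeroCount).sum := by
  obtain ⟨hA, hb⟩ := forall_mem_layerParams.1 h
  have hsum := sum_map_layerEdges (δ := δ) (A := A) (b := b) (fun _ => 1) src tgt
  simp only [List.map_const', List.sum_replicate_nat, mul_one] at hsum
  rw [hsum, sum_map_layerParams, ← Finset.sum_add_distrib, Finset.mul_sum]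
  refine Finset.sum_le_sum fun i _ => ?_
  rw [mul_add, Finset.mul_sum]
  exact add_le_add
    (Finset.sum_le_sum fun j _ => length_weightEdges_le hδ (hA i j).1 (hA i j).2 _ _)
    (length_weightEdges_le hδ (hb i).1 (hb i).2 _ _)

theorem foldl_layerEdges (hδ : 0 < δ) (h : ∀ w ∈ layerParams A b, ∃ k : ℤ, w = δ * k)
    {src : Fin m → Var} {tgt : Fin n → ℕ} (hsep : ∀ j i, src j ≠ (tgt i, true))
    {Y : Var → ℝ} (hY : Y (0, false) = 1) {x : Fin m → ℝ}
    (hx : ∀ j, act (src j).2 (Y (src j)) = x j) (v : Var) :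
    (layerEdges δ A b src tgt).foldl (edgeStep δ) Y v =
      Y v + ∑ i, if v = (tgt i, true) then (A.mulVec x + b) i else 0 := by
  obtain ⟨hA, hb⟩ := forall_mem_layerParams.1 h
  have hunread : ∀ e ∈ layerEdges δ A b src tgt, ∀ e' ∈ layerEdges δ A b src tgt,
      e.2.1 ≠ (e'.2.2, true) := fun e he e' he' => by
    obtain ⟨i, hi⟩ := (mem_layerEdges he').2
    rcases (mem_layerEdges he).1 with h | ⟨j, h⟩
    · simp [h]
    · simpa only [h, hi] using hsep j i
  rw [foldl_edgeStep hunread, sum_map_layerEdges]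
  congr 1
  refine Finset.sum_congr rfl fun i _ => ?_
  simp only [sum_contribution_weightEdges hδ (hA i _), sum_contribution_weightEdges hδ (hb i),
    hY, hx]
  split_ifs
  · simp [act, Matrix.mulVec, dotProduct]
  · simp

end Layer

/-- The edges of a feedforward network, whose outputs are the variables `1`, …, `n` and whose
hidden units are named consecutively from `k` on. -/
def netEdges (δ : ℝ) : {m n : ℕ} → FFN m n → (Fin m → Var) → ℕ → List Edge
  | _, _, .last A b, src, _ => layerEdges δ A b src fun i => i + 1
  | _, _, .layer (h := h) A b N, src, k => layerEdges δ A b src (fun i => k + i) ++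
      netEdges δ N (fun i => (k + i, true)) (k + h)

theorem length_netEdges_le {δ B : ℝ} (hδ : 0 < δ) {m n : ℕ} (N : FFN m n)
    (h : ∀ w ∈ N.params, (∃ k : ℤ, w = δ * k) ∧ |w| ≤ B) (src : Fin m → Var) (k : ℕ) :
    (netEdges δ N src k).length ≤ ⌊B / δ⌋₊ * (N.params.map nonzeroCount).sum := by
  induction N generalizing k with
  | last A b => exact length_layerEdges_le hδ h _ _
  | layer A b N ih =>
    rw [netEdges, List.length_append, FFN.params, Multiset.map_add, Multiset.sum_add, mul_add]
    exact add_le_add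
      (length_layerEdges_le hδ (fun w hw => h w (Multiset.mem_add.2 (.inl hw))) _ _)
      (ih (fun w hw => h w (Multiset.mem_add.2 (.inr hw))) _ _)

theorem foldl_netEdges {δ : ℝ} (hδ : 0 < δ) {m n : ℕ} (N : FFN m n)
    (hN : ∀ w ∈ N.params, ∃ k : ℤ, w = δ * k) {k : ℕ} (hk : n < k) {src : Fin m → Var}
    (hsrc : ∀ j, (src j).2 = true → n < (src j).1 ∧ (src j).1 < k) {Y : Var → ℝ}
    (hconst : Y (0, false) = 1) (hzero : ∀ i, i ≤ n ∨ k ≤ i → Y (i, true) = 0) {x : Fin m → ℝ}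
    (hx : ∀ j, act (src j).2 (Y (src j)) = x j) (i : Fin n) :
    (netEdges δ N src k).foldl (edgeStep δ) Y (i + 1, true) = N.eval x i := by
  have hsep (j) (i : ℕ) (hi : i ≤ n ∨ k ≤ i) : src j ≠ (i, true) := fun h => by
    have := hsrc j (by rw [h])
    simp only [h] at this
    omega
  induction N generalizing k Y with
  | last A b =>
    rw [netEdges, FFN.eval, foldl_layerEdges hδ hN (fun j i => hsep j _ (.inl i.2)) hconst hx,
      hzero _ (.inl i.2)]
    simp [Fin.val_inj]
  | @layer m h n A b N ih =>
    have hlayer := foldl_layerEdges hδ (fun w hw => hN w (Multiset.mem_add.2 (.inl hw)))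
      (tgt := fun i => k + i) (fun j i => hsep j _ (.inr (Nat.le_add_right k i))) hconst hx
    rw [netEdges, FFN.eval, List.foldl_append]
    refine ih (fun w hw => hN w (Multiset.mem_add.2 (.inr hw))) (by omega)
      (fun j _ => ⟨by dsimp; omega, by dsimp; omega⟩) ?_ (fun l hl => ?_) (fun j => ?_) i ?_
    · simp [hlayer, hconst]
    · have hne (j : Fin h) : l ≠ k + j := by omega
      simp [hlayer, hzero l (by omega), hne]
    · simp [hlayer, hzero (k + j) (.inr (Nat.le_add_right k j)), act, relu, Fin.val_inj]
    · intro j l hl heq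
      rw [Prod.mk.injEq] at heq
      omega

/-- The sparse program of a looped network. -/
def LoopedNet.edges (θ : LoopedNet) (δ : ℝ) : List Edge :=
  netEdges δ θ.block (fun j => (j + 1, false)) (θ.n + 1)

section Looped

variable {δ : ℝ} (hδ : 0 < δ) (θ : LoopedNet) (hθ : ∀ w ∈ θ.block.params, ∃ k : ℤ, w = δ * k)
include hδ hθ

theorem LoopedNet.sparseState_edges (t : ℕ) (i : Fin θ.n) :
    sparseState δ (θ.edges δ) t (i + 1, false) = θ.state t i := by
  have hconst (t) : sparseState δ (θ.edges δ) t (0, false) = 1 := by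
    rcases t with _ | t <;> simp [sparseState, startState, nextState]
  have hzero (t k) : sparseState δ (θ.edges δ) t (k, true) = 0 := by
    rcases t with _ | t <;> simp [sparseState, startState, nextState]
  induction t generalizing i with
  | zero => simp [sparseState, startState, LoopedNet.state]
  | succ t ih =>
    rw [LoopedNet.state, Function.iterate_succ_apply', sparseState, nextState]
    simp only [Bool.false_eq_true, if_false, Nat.add_eq_zero_iff, one_ne_zero, and_false]
    exact foldl_netEdges hδ θ.block hθ θ.n.lt_succ_self (src := fun j => (j + 1, false)) (by simp)
      (hconst t) (fun i _ => hzero t i) (fun j => ih j) i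

theorem LoopedNet.sparseOutputs_edges {s : List Bool} :
    SparseOutputs δ (θ.edges δ) s ↔ θ.Outputs s := by
  have hn := θ.three_le
  have hchannel (i : ℕ) (hi : i < θ.n) :
      (fun t => sparseState δ (θ.edges δ) t (i + 1, false)) = fun t => θ.state t ⟨i, hi⟩ :=
    funext fun t => θ.sparseState_edges hδ hθ t ⟨i, hi⟩
  rw [LoopedNet.outputs_iff, SparseOutputs, hchannel 0 (by omega), hchannel 1 (by omega),
    hchannel 2 (by omega)]
  rfl

end Looped

/-! ### Renaming variables -/

/-- An edge with renamed variables. -/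
def Edge.rename (ρ : ℕ → ℕ) (e : Edge) : Edge := (e.1, (ρ e.2.1.1, e.2.1.2), ρ e.2.2)

section Rename

variable {δ : ℝ} {E : List Edge} {S : Set ℕ} {ρ : ℕ → ℕ} (hρ : S.InjOn ρ)
  (hE : ∀ e ∈ E, e.2.1.1 ∈ S ∧ e.2.2 ∈ S)
include hρ hE

theorem foldl_edgeStep_rename {Y Y' : Var → ℝ} (hY : ∀ i ∈ S, ∀ b, Y' (ρ i, b) = Y (i, b)) :
    ∀ i ∈ S, ∀ b, (E.map (Edge.rename ρ)).foldl (edgeStep δ) Y' (ρ i, b) =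
      E.foldl (edgeStep δ) Y (i, b) := by
  induction E generalizing Y Y' with
  | nil => exact hY
  | cons e E ih =>
    obtain ⟨hsrc, htgt⟩ := hE e List.mem_cons_self
    refine ih (fun e he => hE e (List.mem_cons_of_mem _ he)) fun i hi b => ?_
    simp only [edgeStep, Edge.rename, hY i hi, hY _ hsrc, Prod.mk.injEq, hρ.eq_iff hi htgt,
      Prod.mk.eta]

theorem sparseState_rename (h0 : 0 ∈ S) (hρ0 : ρ 0 = 0) (t : ℕ) :
    ∀ i ∈ S, ∀ b, sparseState δ (E.map (Edge.rename ρ)) t (ρ i, b) =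
      sparseState δ E t (i, b) := by
  have hzero (i) (hi : i ∈ S) : ρ i = 0 ↔ i = 0 := by rw [← hρ.eq_iff hi h0, hρ0]
  induction t with
  | zero => simp +contextual [sparseState, startState, hzero]
  | succ t ih =>
    intro i hi b
    simp only [sparseState, nextState, hzero i hi, foldl_edgeStep_rename hρ hE ih i hi true]

theorem SparseOutputs.rename (hS : ∀ i < 4, i ∈ S) (hfix : ∀ i < 4, ρ i = i) {s : List Bool}
    (h : SparseOutputs δ E s) : SparseOutputs δ (E.map (Edge.rename ρ)) s := by
  have hchannel (i : ℕ) (hi : i < 4) :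
      (fun t => sparseState δ (E.map (Edge.rename ρ)) t (i, false)) =
        fun t => sparseState δ E t (i, false) := funext fun t => by
    simpa only [hfix i hi] using sparseState_rename hρ hE (hS 0 four_pos) (hfix 0 four_pos) t i
      (hS i hi) false
  rwa [SparseOutputs, hchannel 1 (by omega), hchannel 2 (by omega), hchannel 3 (by omega)]

end Rename

/-- The variables of a program, and the four reserved ones. -/
def names (E : List Edge) : Finset ℕ :=
  Finset.range 4 ∪ (E.map fun e => e.2.1.1).toFinset ∪ (E.map fun e => e.2.2).toFinset

theorem card_names_le (E : List Edge) : (names E).card ≤ 2 * E.length + 4 := by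
  have hunion := Finset.card_union_le (Finset.range 4) (E.map fun e => e.2.1.1).toFinset
  have hsrc := List.toFinset_card_le (E.map fun e => e.2.1.1)
  have htgt := List.toFinset_card_le (E.map fun e => e.2.2)
  simp only [List.length_map, Finset.card_range] at hunion hsrc htgt
  refine (Finset.card_union_le _ _).trans ?_
  omega

theorem count_mem_lt_card {S : Finset ℕ} {i : ℕ} (hi : i ∈ S) :
    Nat.count (· ∈ S) i < S.card := by
  simpa using Nat.count_lt_card (p := (· ∈ S)) S.finite_toSet hi

theorem exists_rename (δ : ℝ) (E : List Edge) : ∃ E' : List Edge, E'.length = E.length ∧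
    (∀ e ∈ E', e.2.1.1 < 2 * E.length + 4 ∧ e.2.2 < 2 * E.length + 4) ∧
    ∀ s, SparseOutputs δ E s → SparseOutputs δ E' s := by
  have hreserved : ∀ i < 4, i ∈ names E := fun i hi => by simp [names, hi]
  have hE : ∀ e ∈ E, e.2.1.1 ∈ names E ∧ e.2.2 ∈ names E := fun e he => by
    simp only [names, Finset.mem_union, List.mem_toFinset]
    exact ⟨.inl (.inr (List.mem_map_of_mem he)), .inr (List.mem_map_of_mem he)⟩
  have hinj : Set.InjOn (Nat.count (· ∈ names E)) (names E) :=
    fun i hi j hj h => Nat.count_injective hi hj h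
  have hfix : ∀ i < 4, Nat.count (· ∈ names E) i = i := fun i hi =>
    Nat.count_iff_forall.2 fun j hj => hreserved j (hj.trans hi)
  have hlt (i) (hi : i ∈ names E) : Nat.count (· ∈ names E) i < 2 * E.length + 4 :=
    (count_mem_lt_card hi).trans_le (card_names_le E)
  refine ⟨E.map (Edge.rename (Nat.count (· ∈ names E))), List.length_map _, ?_,
    fun s => SparseOutputs.rename hinj hE hreserved hfix⟩
  exact List.forall_mem_map.2 fun e he => ⟨hlt _ (hE e he).1, hlt _ (hE e he).2⟩

theorem LoopedNet.exists_program {δ B : ℝ} (hδ : 0 < δ) (θ : LoopedNet)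
    (hθ : θ.HasPrecision δ B) {s : List Bool} (hs : θ.Outputs s) :
    ∃ E : List Edge, E.length ≤ ⌊B / δ⌋₊ * θ.l0 ∧
      (∀ e ∈ E, e.2.1.1 < 2 * E.length + 4 ∧ e.2.2 < 2 * E.length + 4) ∧
      SparseOutputs δ E s := by
  obtain ⟨E, hlength, hnames, hout⟩ := exists_rename δ (θ.edges δ)
  refine ⟨E, ?_, hlength ▸ hnames,
    hout s ((θ.sparseOutputs_edges hδ fun w hw => (hθ w hw).1).2 hs)⟩
  rw [hlength, LoopedNet.l0_eq_sum]
  exact length_netEdges_le hδ θ.block hθ _ _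

/-! ### Self-delimiting codes -/

/-- Every output of `φ` is an output of `U` for a program longer by at most a constant. -/
def Simulates (U φ : List Bool →. List Bool) : Prop :=
  ∃ c : ℕ, ∀ p s : List Bool, s ∈ φ p → ∃ q : List Bool, s ∈ U q ∧ q.length ≤ p.length + c

/-- The number of leading ones of a word. -/
def leadingOnes (p : List Bool) : ℕ := (p.takeWhile id).length

theorem leadingOnes_replicate_append (b : ℕ) (w : List Bool) :
    leadingOnes (List.replicate b true ++ false :: w) = b := by
  simp [leadingOnes]

theorem leadingOnes_eq_of_prefix {p q : List Bool} (h : p <+: q)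
    (hp : leadingOnes p < p.length) : leadingOnes p = leadingOnes q := by
  obtain ⟨r, rfl⟩ := h
  unfold leadingOnes at *
  rw [List.takeWhile_append, if_neg hp.ne]

theorem primrec_leadingOnes : Primrec leadingOnes :=
  Primrec.list_length.comp (Primrec.list_takeWhile Primrec.id)

/-- The machine that accepts the programs `1^b 0 w` for which `w` has length `L b`, and then runs
`g` on `b` and `w`. -/
def selfDelimited (g : ℕ × List Bool →. List Bool) (L : ℕ → ℕ) : List Bool →. List Bool := fun p =>
  bif decide (p.length = leadingOnes p + 1 + L (leadingOnes p)) then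
    g (leadingOnes p, p.drop (leadingOnes p + 1))
  else Part.none

section SelfDelimited

variable {g : ℕ × List Bool →. List Bool} {L : ℕ → ℕ}

theorem partrec_selfDelimited (hg : Partrec g) (hL : Primrec L) :
    Partrec (selfDelimited g L) := by
  have hlength : Primrec fun p : List Bool => leadingOnes p + 1 :=
    Primrec.succ.comp primrec_leadingOnes
  have haccept : Primrec fun p : List Bool =>
      decide (p.length = leadingOnes p + 1 + L (leadingOnes p)) :=
    (Primrec.eq.comp Primrec.list_length
      (Primrec.nat_add.comp hlength (hL.comp primrec_leadingOnes))).decide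
  exact Partrec.cond haccept.to_comp (hg.comp
    (primrec_leadingOnes.pair (Primrec.list_drop.comp hlength Primrec.id)).to_comp) Partrec.none

theorem isPrefixFree_selfDelimited : IsPrefixFree (selfDelimited g L) := by
  have hlength (p) (hp : (selfDelimited g L p).Dom) :
      p.length = leadingOnes p + 1 + L (leadingOnes p) := by
    by_contra h
    rw [selfDelimited, decide_eq_false h] at hp
    exact hp
  intro p q hp hq hpq
  refine hpq.eq_of_length ?_
  rw [hlength p hp, hlength q hq, leadingOnes_eq_of_prefix hpq (by have := hlength p hp; omega)]

theorem mem_selfDelimited {b : ℕ} {w s : List Bool} (hw : w.length = L b) (hs : s ∈ g (b, w)) :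
    s ∈ selfDelimited g L (List.replicate b true ++ false :: w) := by
  have haccept : (List.replicate b true ++ false :: w).length = b + 1 + L b := by
    simp only [List.length_append, List.length_replicate, List.length_cons, hw]
    omega
  have hdrop : (List.replicate b true ++ false :: w).drop (b + 1) = w := by
    simp [List.drop_append]
  rwa [selfDelimited, leadingOnes_replicate_append, decide_eq_true haccept, hdrop]

end SelfDelimited

section Universal

variable {U : List Bool →. List Bool} (hU : ∀ φ, Partrec φ → IsPrefixFree φ → Simulates U φ)
include hU

theorem exists_program_length_le {g : ℕ × List Bool →. List Bool} (hg : Partrec g) {L : ℕ → ℕ}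
    (hL : Primrec L) : ∃ c : ℕ, ∀ b w s, w.length = L b → s ∈ g (b, w) →
      ∃ q, s ∈ U q ∧ q.length ≤ b + 1 + L b + c := by
  obtain ⟨c, hc⟩ := hU _ (partrec_selfDelimited hg hL) isPrefixFree_selfDelimited
  refine ⟨c, fun b w s hw hs => ?_⟩
  obtain ⟨q, hq, hlength⟩ := hc _ _ (mem_selfDelimited hw hs)
  refine ⟨q, hq, hlength.trans ?_⟩
  simp only [List.length_append, List.length_replicate, List.length_cons, hw]
  omega

theorem exists_program (s : List Bool) : ∃ q, s ∈ U q := by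
  have hdecode : Partrec fun x : ℕ × List Bool =>
      (Encodable.decode (α := List Bool) x.1 : Part (List Bool)) :=
    Computable.ofOption (Computable.decode.comp Computable.fst)
  obtain ⟨c, hc⟩ := exists_program_length_le hU hdecode (Primrec.const 0)
  obtain ⟨q, hq, -⟩ := hc (Encodable.encode s) [] s rfl (by simp)
  exact ⟨q, hq⟩

end Universal

/-- The number with the given binary digits, least significant first. -/
def bitsNum (w : List Bool) : ℕ := w.foldr (fun b n => 2 * n + b.toNat) 0

theorem exists_bitsNum_eq {b n : ℕ} (hn : n < 2 ^ b) :
    ∃ w : List Bool, w.length = b ∧ bitsNum w = n := by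
  induction b generalizing n with
  | zero => exact ⟨[], rfl, by simp_all [bitsNum]⟩
  | succ b ih =>
    obtain ⟨w, hw, hnum⟩ := ih (n := n / 2) (by rw [pow_succ] at hn; omega)
    refine ⟨decide (n % 2 = 1) :: w, by rw [List.length_cons, hw], ?_⟩
    change 2 * bitsNum w + (decide (n % 2 = 1)).toNat = n
    rcases Nat.mod_two_eq_zero_or_one n with h | h <;> simp [hnum, h] <;> omega

theorem primrec_bitsNum : Primrec bitsNum :=
  Primrec.list_foldr (h := fun _ (x : Bool × ℕ) => 2 * x.2 + x.1.toNat) Primrec.id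
    (Primrec.const 0)
    (Primrec.nat_add.comp (Primrec.nat_mul.comp (Primrec.const 2) (Primrec.snd.comp Primrec.snd))
      ((Primrec.dom_bool Bool.toNat).comp (Primrec.fst.comp Primrec.snd))).to₂

/-! ### Coding sparse programs -/

/-- The optional edge, with names below `2 ^ b`, coded by the first `2 * b + 3` bits of a word. -/
def decodeEdge (b : ℕ) (w : List Bool) : Option Edge :=
  if w.getD 0 false = true then
    some (w.getD 1 false, (bitsNum ((w.drop 3).take b), w.getD 2 false),
      bitsNum ((w.drop (b + 3)).take b))
  else none

theorem exists_decodeEdge_append_eq {b : ℕ} {o : Option Edge}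
    (ho : ∀ e ∈ o, e.2.1.1 < 2 ^ b ∧ e.2.2 < 2 ^ b) :
    ∃ v : List Bool, v.length = 2 * b + 3 ∧ ∀ w, decodeEdge b (v ++ w) = o := by
  rcases o with _ | ⟨c, ⟨i, r⟩, j⟩
  · exact ⟨List.replicate (2 * b + 3) false, List.length_replicate, fun w => by
      simp [decodeEdge, List.replicate_succ]⟩
  · obtain ⟨hi, hj⟩ := ho _ rfl
    obtain ⟨x, hx, rfl⟩ := exists_bitsNum_eq hi
    obtain ⟨y, hy, rfl⟩ := exists_bitsNum_eq hj
    refine ⟨true :: c :: r :: (x ++ y), by simp [hx, hy]; omega, fun w => ?_⟩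
    have hword : true :: c :: r :: (x ++ y) ++ w = true :: c :: r :: (x ++ (y ++ w)) := by simp
    rw [hword, decodeEdge]
    simp only [if_true, List.getD_cons_succ, List.getD_cons_zero, List.drop_succ_cons,
      List.drop_zero, List.take_left' hx, List.drop_left' hx, List.take_left' hy]

/-- The program with at most `2 ^ b` edges coded by a word. -/
def decodeEdges (b : ℕ) (w : List Bool) : List Edge :=
  (List.range (2 ^ b)).filterMap fun i => decodeEdge b (w.drop ((2 * b + 3) * i))

theorem exists_filterMap_drop_eq {α : Type*} {f : List Bool → Option α} {k : ℕ} {P : α → Prop}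
    (hf : ∀ o : Option α, (∀ a ∈ o, P a) →
      ∃ v : List Bool, v.length = k ∧ ∀ w, f (v ++ w) = o)
    (N : ℕ) {l : List α} (hl : ∀ a ∈ l, P a) (hN : l.length ≤ N) :
    ∃ w : List Bool, w.length = k * N ∧
      (List.range N).filterMap (fun i => f (w.drop (k * i))) = l := by
  induction N generalizing l with
  | zero => exact ⟨[], rfl, (List.eq_nil_of_length_eq_zero (Nat.le_zero.1 hN)).symm⟩
  | succ N ih =>
    obtain ⟨v, hv, hhead⟩ := hf l.head? fun a ha => hl a (List.mem_of_head? ha)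
    obtain ⟨w, hw, htail⟩ := ih (l := l.tail) (fun a ha => hl a (List.mem_of_mem_tail ha))
      (by rw [List.length_tail]; omega)
    have hdrop (i : ℕ) : (v ++ w).drop (k * (i + 1)) = w.drop (k * i) := by
      rw [mul_add_one, ← hv, add_comm, List.drop_length_add_append]
    refine ⟨v ++ w, by rw [List.length_append, hv, hw, mul_add_one, add_comm], ?_⟩
    rw [List.range_succ_eq_map, List.filterMap_cons, List.filterMap_map, mul_zero, List.drop_zero,
      hhead]
    simp only [Function.comp_def, Nat.succ_eq_add_one, hdrop, htail]
    cases l <;> rfl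

theorem exists_decodeEdges_eq {b : ℕ} {E : List Edge}
    (hE : ∀ e ∈ E, e.2.1.1 < 2 ^ b ∧ e.2.2 < 2 ^ b) (hlength : E.length ≤ 2 ^ b) :
    ∃ w : List Bool, w.length = (2 * b + 3) * 2 ^ b ∧ decodeEdges b w = E :=
  exists_filterMap_drop_eq (fun _ => exists_decodeEdge_append_eq) _ hE hlength

theorem primrec_decodeEdge : Primrec₂ decodeEdge := by
  have hbit (i : ℕ) : Primrec fun x : ℕ × List Bool => x.2.getD i false :=
    (Primrec.list_getD false).comp Primrec.snd (Primrec.const i)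
  have hnum {f : ℕ × List Bool → ℕ} (hf : Primrec f) :
      Primrec fun x : ℕ × List Bool => bitsNum ((x.2.drop (f x)).take x.1) :=
    primrec_bitsNum.comp
      (Primrec.list_take.comp Primrec.fst (Primrec.list_drop.comp hf Primrec.snd))
  exact Primrec.ite (Primrec.eq.comp (hbit 0) (Primrec.const true))
    (Primrec.option_some.comp ((hbit 1).pair (((hnum (Primrec.const 3)).pair (hbit 2)).pair
      (hnum (Primrec.nat_add.comp Primrec.fst (Primrec.const 3)))))) (Primrec.const none)

theorem primrec_mul_two_add_three : Primrec fun b : ℕ => 2 * b + 3 :=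
  Primrec.nat_add.comp (Primrec.nat_mul.comp (Primrec.const 2) Primrec.id) (Primrec.const 3)

theorem primrec_two_pow : Primrec fun b : ℕ => 2 ^ b :=
  primrec_nat_pow.comp (Primrec.const 2) Primrec.id

theorem primrec_decodeEdges : Primrec₂ decodeEdges := by
  have hb : Primrec fun x : (ℕ × List Bool) × ℕ => x.1.1 := Primrec.fst.comp Primrec.fst
  exact Primrec.listFilterMap (f := fun x : ℕ × List Bool => List.range (2 ^ x.1))
    (Primrec.list_range.comp (primrec_two_pow.comp Primrec.fst))
    (primrec_decodeEdge.comp hb (Primrec.list_drop.comp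
      (Primrec.nat_mul.comp (primrec_mul_two_add_three.comp hb) Primrec.snd)
      (Primrec.snd.comp Primrec.fst)))

theorem exists_program_of_net {δ B : ℝ} (hδ : 0 < δ) (hc : IsComputableReal δ)
    {U : List Bool →. List Bool} (hU : ∀ φ, Partrec φ → IsPrefixFree φ → Simulates U φ) :
    ∃ c : ℕ, ∀ (θ : LoopedNet) (s : List Bool), θ.HasPrecision δ B → θ.Outputs s →
      ∀ b : ℕ, 2 * (⌊B / δ⌋₊ * θ.l0) + 4 ≤ 2 ^ b →
        ∃ q, s ∈ U q ∧ q.length ≤ b + 1 + (2 * b + 3) * 2 ^ b + c := by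
  obtain ⟨run, hrun, hspec⟩ := exists_partrec_run hδ.le hc
  have hdecoded : Partrec fun x : ℕ × List Bool => run (decodeEdges x.1 x.2) :=
    hrun.comp primrec_decodeEdges.to_comp
  obtain ⟨c, hprogram⟩ := exists_program_length_le hU hdecoded
    (Primrec.nat_mul.comp primrec_mul_two_add_three primrec_two_pow)
  refine ⟨c, fun θ s hθ hs b hb => ?_⟩
  obtain ⟨E, hlength, hnames, hout⟩ := θ.exists_program hδ hθ hs
  have hbound : 2 * E.length + 4 ≤ 2 ^ b := by omega
  obtain ⟨w, hw, rfl⟩ := exists_decodeEdges_eq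
    (fun e he => ⟨(hnames e he).1.trans_le hbound, (hnames e he).2.trans_le hbound⟩) (by omega)
  exact hprogram b w s hw (hspec _ _ hout)

/-! ### Norms of the parameter vector -/

theorem rpow_mul_nonzeroCount_le {δ p w : ℝ} (hδ : 0 ≤ δ) (hp : 0 < p)
    (hw : ∃ k : ℤ, w = δ * k) : δ ^ p * (nonzeroCount w : ℝ) ≤ |w| ^ p := by
  rcases eq_or_ne w 0 with rfl | h
  · simp [nonzeroCount, hp.ne']
  · obtain ⟨k, rfl⟩ := hw
    have hk : (1 : ℝ) ≤ |(k : ℝ)| := by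
      exact_mod_cast Int.one_le_abs fun h0 : k = 0 => h (by simp [h0])
    have hle : δ ≤ |δ * k| := by
      rw [abs_mul, abs_of_nonneg hδ]
      exact le_mul_of_one_le_right hδ hk
    simpa [nonzeroCount, h] using Real.rpow_le_rpow hδ hle hp.le

theorem rpow_abs_le_mul_nonzeroCount {B p w : ℝ} (hp : 0 < p) (hw : |w| ≤ B) :
    |w| ^ p ≤ B ^ p * (nonzeroCount w : ℝ) := by
  rcases eq_or_ne w 0 with rfl | h
  · simp [nonzeroCount, hp.ne']
  · simpa [nonzeroCount, h] using Real.rpow_le_rpow (abs_nonneg w) hw hp.le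

namespace LoopedNet

theorem natCast_l0 (θ : LoopedNet) :
    (θ.l0 : ℝ) = (θ.block.params.map fun w => (nonzeroCount w : ℝ)).sum := by
  rw [l0_eq_sum, Nat.cast_multiset_sum, Multiset.map_map]
  rfl

theorem rpow_mul_l0_le_lpPow {δ B p : ℝ} (hδ : 0 ≤ δ) (hp : 0 < p) {θ : LoopedNet}
    (hθ : θ.HasPrecision δ B) : δ ^ p * (θ.l0 : ℝ) ≤ θ.lpPow p := by
  rw [natCast_l0, ← Multiset.sum_map_mul_left, lpPow]
  exact Multiset.sum_map_le_sum_map _ _ fun w hw => rpow_mul_nonzeroCount_le hδ hp (hθ w hw).1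

theorem lpPow_le_rpow_mul_l0 {δ B p : ℝ} (hp : 0 < p) {θ : LoopedNet}
    (hθ : θ.HasPrecision δ B) : θ.lpPow p ≤ B ^ p * (θ.l0 : ℝ) := by
  rw [natCast_l0, ← Multiset.sum_map_mul_left, lpPow]
  exact Multiset.sum_map_le_sum_map _ _ fun w hw => rpow_abs_le_mul_nonzeroCount hp (hθ w hw).2

theorem lpPow_nonneg (θ : LoopedNet) (p : ℝ) : 0 ≤ θ.lpPow p :=
  Multiset.sum_nonneg <| Multiset.forall_mem_map_iff.2 fun w _ => Real.rpow_nonneg (abs_nonneg w) p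

theorem lpNorm_nonneg (θ : LoopedNet) (p : ℝ) : 0 ≤ θ.lpNorm p :=
  Real.rpow_nonneg (θ.lpPow_nonneg p) _

theorem lpNorm_rpow (θ : LoopedNet) {p : ℝ} (hp : p ≠ 0) : θ.lpNorm p ^ p = θ.lpPow p := by
  rw [lpNorm, one_div, Real.rpow_inv_rpow (θ.lpPow_nonneg p) hp]

end LoopedNet

theorem FFN.eval_eq_zero {m n : ℕ} (N : FFN m n) (h : ∀ w ∈ N.params, w = 0) (x : Fin m → ℝ) :
    N.eval x = 0 := by
  induction N with
  | last A b =>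
    obtain ⟨hA, hb⟩ := forall_mem_layerParams.1 h
    have hA : A = 0 := Matrix.ext hA
    have hb : b = 0 := funext hb
    simp [FFN.eval, hA, hb]
  | layer A b N ih => exact ih (fun w hw => h w (Multiset.mem_add.2 (.inr hw))) _

theorem LoopedNet.Outputs.one_le_l0 {θ : LoopedNet} {s : List Bool} (hs : θ.Outputs s) :
    1 ≤ θ.l0 := by
  by_contra! h
  have hzero : ∀ w ∈ θ.block.params, w = 0 := by
    rw [Nat.lt_one_iff, LoopedNet.l0, Multiset.card_eq_zero, Multiset.filter_eq_nil] at h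
    simpa using h
  obtain ⟨τ, hτ, hhalt, -⟩ := hs
  obtain ⟨t, rfl⟩ := Nat.exists_eq_add_of_le' hτ
  rw [LoopedNet.haltCh, LoopedNet.state, Function.iterate_succ_apply',
    FFN.eval_eq_zero _ hzero] at hhalt
  exact lt_irrefl _ hhalt

section Infima

variable {δ B p : ℝ} {s : List Bool}

theorem lpComplexity_nonneg : 0 ≤ lpComplexity δ B p s :=
  Real.sInf_nonneg (by rintro _ ⟨θ, -, -, rfl⟩; exact θ.lpNorm_nonneg p)

theorem lpComplexity_rpow_le (hp : 0 < p) {θ : LoopedNet} (hθ : θ.HasPrecision δ B)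
    (hs : θ.Outputs s) : lpComplexity δ B p s ^ p ≤ B ^ p * (θ.l0 : ℝ) := by
  have hbdd : BddBelow {r : ℝ | ∃ θ : LoopedNet,
      θ.HasPrecision δ B ∧ θ.Outputs s ∧ θ.lpNorm p = r} :=
    ⟨0, by rintro _ ⟨θ, -, -, rfl⟩; exact θ.lpNorm_nonneg p⟩
  calc lpComplexity δ B p s ^ p ≤ θ.lpNorm p ^ p :=
        Real.rpow_le_rpow lpComplexity_nonneg (csInf_le hbdd ⟨θ, hθ, hs, rfl⟩) hp.le
    _ = θ.lpPow p := θ.lpNorm_rpow hp.ne'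
    _ ≤ B ^ p * (θ.l0 : ℝ) := LoopedNet.lpPow_le_rpow_mul_l0 hp hθ

theorem le_lpComplexity_rpow (hδ : 0 ≤ δ) (hp : 0 < p) {N : ℕ}
    (hne : ∃ θ : LoopedNet, θ.HasPrecision δ B ∧ θ.Outputs s)
    (hmin : ∀ θ : LoopedNet, θ.HasPrecision δ B ∧ θ.Outputs s → N ≤ θ.l0) :
    δ ^ p * N ≤ lpComplexity δ B p s ^ p := by
  have hnonneg : 0 ≤ δ ^ p * (N : ℝ) := by positivity
  rw [← Real.rpow_inv_le_iff_of_pos hnonneg lpComplexity_nonneg hp]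
  obtain ⟨θ, hθ, hs⟩ := hne
  refine le_csInf ⟨_, θ, hθ, hs, rfl⟩ ?_
  rintro _ ⟨θ, hθ, hs, rfl⟩
  rw [Real.rpow_inv_le_iff_of_pos hnonneg (θ.lpNorm_nonneg p) hp, θ.lpNorm_rpow hp.ne']
  calc δ ^ p * (N : ℝ) ≤ δ ^ p * θ.l0 := by gcongr; exact hmin θ ⟨hθ, hs⟩
    _ ≤ θ.lpPow p := LoopedNet.rpow_mul_l0_le_lpPow hδ hp hθ

theorem mul_logb_le_mul_logb {x y : ℝ} (hx : 1 ≤ x) (hxy : x ≤ y) :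
    x * Real.logb 2 x ≤ y * Real.logb 2 y :=
  mul_le_mul hxy (Real.logb_le_logb_of_le one_lt_two (by linarith) hxy)
    (Real.logb_nonneg one_lt_two hx) (by linarith)

theorem mul_logb_le_lpComplexity (hδ : 0 < δ) (hp : 0 < p) {θ : LoopedNet}
    (hθ : θ.HasPrecision δ B) (hs : θ.Outputs s)
    (hmin : ∀ θ' : LoopedNet, θ'.HasPrecision δ B ∧ θ'.Outputs s → θ.l0 ≤ θ'.l0) :
    θ.l0 * Real.logb 2 θ.l0 ≤ lpComplexity δ B p s ^ p *
      Real.logb 2 (lpComplexity δ B p s ^ p / δ ^ p) / δ ^ p := by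
  have hl0 : (θ.l0 : ℝ) ≤ lpComplexity δ B p s ^ p / δ ^ p := by
    rw [le_div_iff₀' (Real.rpow_pos_of_pos hδ p)]
    exact le_lpComplexity_rpow hδ.le hp ⟨θ, hθ, hs⟩ hmin
  rw [mul_div_right_comm]
  exact mul_logb_le_mul_logb (by exact_mod_cast hs.one_le_l0) hl0

end Infima

/-! ### Lengths of codes -/

theorem two_pow_clog_le {n : ℕ} (hn : n ≠ 0) : 2 ^ Nat.clog 2 n ≤ 2 * n := by
  rcases Nat.lt_or_ge 1 n with h | h
  · have hlt := Nat.pow_pred_clog_lt_self one_lt_two h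
    have hpos : 0 < Nat.clog 2 n := Nat.clog_pos one_lt_two h
    calc 2 ^ Nat.clog 2 n = 2 * 2 ^ (Nat.clog 2 n).pred := by
          rw [← pow_succ', Nat.pred_eq_sub_one, Nat.sub_add_cancel hpos]
      _ ≤ 2 * n := by gcongr
  · rw [Nat.clog_of_right_le_one h]
    omega

theorem natCast_le_mul_logb_add_one (N : ℕ) : (N : ℝ) ≤ N * Real.logb 2 N + 1 := by
  rcases Nat.lt_or_ge 1 N with h | h
  · have hlogb : 1 ≤ Real.logb 2 N := by
      rw [Real.le_logb_iff_rpow_le one_lt_two (by positivity), Real.rpow_one]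
      exact_mod_cast h
    linarith [le_mul_of_one_le_right N.cast_nonneg hlogb]
  · interval_cases N <;> simp

theorem code_length_le (b c : ℕ) :
    b + 1 + (2 * b + 3) * 2 ^ b + c ≤ (3 * b + (4 + c)) * 2 ^ b := by
  nlinarith [Nat.one_le_two_pow (n := b)]

theorem exists_code_length_le (C c : ℕ) : ∃ A : ℝ, 0 ≤ A ∧ ∀ N : ℕ, 1 ≤ N → ∃ b : ℕ,
    2 * (C * N) + 4 ≤ 2 ^ b ∧
      ((b + 1 + (2 * b + 3) * 2 ^ b + c : ℕ) : ℝ) ≤ A * (N * Real.logb 2 N) + A := by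
  set X : ℝ := 4 * C + 8 with hX
  have hlogX : 0 ≤ Real.logb 2 X :=
    Real.logb_nonneg one_lt_two (by rw [hX]; linarith [C.cast_nonneg (α := ℝ)])
  refine ⟨(3 * Real.logb 2 X + (7 + c)) * X, by positivity, fun N hN => ?_⟩
  have hN' : (1 : ℝ) ≤ N := by exact_mod_cast hN
  set g : ℝ := Real.logb 2 N
  have hg0 : 0 ≤ g := Real.logb_nonneg one_lt_two hN'
  refine ⟨Nat.clog 2 (2 * (C * N) + 4), Nat.le_pow_clog one_lt_two _, ?_⟩
  set b := Nat.clog 2 (2 * (C * N) + 4)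
  have hpow : (2 : ℝ) ^ b ≤ X * N := by
    have h : (2 : ℝ) ^ b ≤ 2 * (2 * (C * N) + 4) := by
      exact_mod_cast two_pow_clog_le (n := 2 * (C * N) + 4) (by omega)
    rw [hX]
    linarith
  have hb : (b : ℝ) ≤ Real.logb 2 X + g := by
    rw [← Real.logb_mul (by positivity) (by positivity),
      Real.le_logb_iff_rpow_le one_lt_two (by positivity), Real.rpow_natCast]
    exact hpow
  calc ((b + 1 + (2 * b + 3) * 2 ^ b + c : ℕ) : ℝ) ≤ (3 * b + (4 + c)) * 2 ^ b := by
        exact_mod_cast code_length_le b c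
    _ ≤ (3 * (Real.logb 2 X + g) + (4 + c)) * (X * N) := by gcongr
    _ = (3 * Real.logb 2 X + (4 + c)) * X * N + 3 * X * (N * g) := by ring
    _ ≤ (3 * Real.logb 2 X + (4 + c)) * X * (N * g + 1) + 3 * X * (N * g + 1) := by
        gcongr
        · exact natCast_le_mul_logb_add_one N
        · linarith
    _ = (3 * Real.logb 2 X + (7 + c)) * X * (N * g) + (3 * Real.logb 2 X + (7 + c)) * X := by ring

theorem exists_program_length_le_mul_logb {δ B : ℝ} (hδ : 0 < δ) (hc : IsComputableReal δ)
    {U : List Bool →. List Bool} (hU : ∀ φ, Partrec φ → IsPrefixFree φ → Simulates U φ) :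
    ∃ A : ℝ, 0 ≤ A ∧ ∀ (θ : LoopedNet) (s : List Bool), θ.HasPrecision δ B → θ.Outputs s →
      ∃ q, s ∈ U q ∧ (q.length : ℝ) ≤ A * (θ.l0 * Real.logb 2 θ.l0) + A := by
  obtain ⟨c, hprogram⟩ := exists_program_of_net (B := B) hδ hc hU
  obtain ⟨A, hA, hlength⟩ := exists_code_length_le ⌊B / δ⌋₊ c
  refine ⟨A, hA, fun θ s hθ hs => ?_⟩
  obtain ⟨b, hb, hle⟩ := hlength θ.l0 hs.one_le_l0
  obtain ⟨q, hq, hqb⟩ := hprogram θ s hθ hs b hb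
  exact ⟨q, hq, le_trans (by exact_mod_cast hqb) hle⟩

theorem exists_iInf_natCast_eq {α : Type*} {P : α → Prop} (f : α → ℕ) (h : ∃ a, P a) :
    ∃ a, P a ∧ (⨅ (a : α) (_ : P a), (f a : ℕ∞)) = f a ∧ ∀ b, P b → f a ≤ f b := by
  obtain ⟨a, ha, hmin⟩ := exists_minimalFor_of_wellFoundedLT P f h
  have hle (b) (hb : P b) : f a ≤ f b := (le_total _ _).elim id (hmin hb)
  exact ⟨a, ha, le_antisymm (iInf₂_le a ha) (le_iInf₂ fun b hb => by exact_mod_cast hle b hb), hle⟩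

end LoopedReLU

end

theorem theorem1_general (δ M : ℝ) (hδ : 0 < δ) (hδM : δ ≤ M)
    (hδc : LoopedReLU.IsComputableReal δ) (U : List Bool →. List Bool) (hU : Partrec U)
    (hsim : ∀ φ, Partrec φ → LoopedReLU.IsPrefixFree φ → LoopedReLU.Simulates U φ) :
    (∀ θ : LoopedReLU.LoopedNet, θ.HasPrecision δ M → ∀ p : ℝ, 0 < p →
      δ ^ p * (θ.l0 : ℝ) ≤ θ.lpPow p ∧ θ.lpPow p ≤ M ^ p * (θ.l0 : ℝ)) ∧
    ∃ c_U c_d : ℝ, 0 ≤ c_U ∧ 0 ≤ c_d ∧ ∀ s : List Bool,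
      ∃ K N : ℕ, LoopedReLU.kolmogorov U s = (K : ℕ∞) ∧
        LoopedReLU.neuralComplexity δ M s = (N : ℕ∞) ∧
        (N : ℝ) ≤ K + c_U ∧
        (K : ℝ) ≤ c_d * (N * Real.logb 2 N) + c_d ∧
        ∀ p : ℝ, 0 < p →
          LoopedReLU.lpComplexity δ M p s ^ p ≤ M ^ p * (K + c_U) ∧
          (K : ℝ) ≤ c_d / δ ^ p * (LoopedReLU.lpComplexity δ M p s ^ p *
            Real.logb 2 (LoopedReLU.lpComplexity δ M p s ^ p / δ ^ p)) + c_d := by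
  have hM : 0 ≤ M := hδ.le.trans hδM
  refine ⟨fun θ hθ p hp => ⟨LoopedReLU.LoopedNet.rpow_mul_l0_le_lpPow hδ.le hp hθ,
    LoopedReLU.LoopedNet.lpPow_le_rpow_mul_l0 hp hθ⟩, ?_⟩
  obtain ⟨c, hnet⟩ := LoopedReLU.exists_net_of_program hδ hδM hU
  obtain ⟨A, hA, hprogram⟩ := LoopedReLU.exists_program_length_le_mul_logb (B := M) hδ hδc hsim
  refine ⟨c, A, c.cast_nonneg, hA, fun s => ?_⟩
  obtain ⟨q, hq, hK, hqmin⟩ :=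
    LoopedReLU.exists_iInf_natCast_eq List.length (LoopedReLU.exists_program hsim s)
  obtain ⟨θ₁, hθ₁, hs₁, hle₁⟩ := hnet q s hq
  obtain ⟨θ, ⟨hθ, hs⟩, hN, hmin⟩ := LoopedReLU.exists_iInf_natCast_eq
    (P := fun θ => θ.HasPrecision δ M ∧ θ.Outputs s) LoopedReLU.LoopedNet.l0 ⟨θ₁, hθ₁, hs₁⟩
  obtain ⟨r, hr, hrle⟩ := hprogram θ s hθ hs
  have hNK : (θ.l0 : ℝ) ≤ q.length + c := by exact_mod_cast (hmin θ₁ ⟨hθ₁, hs₁⟩).trans hle₁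
  have hKN := (Nat.cast_le (α := ℝ).2 (hqmin r hr)).trans hrle
  refine ⟨q.length, θ.l0, hK, hN, hNK, hKN, fun p hp => ⟨?_, ?_⟩⟩
  · exact (LoopedReLU.lpComplexity_rpow_le hp hθ hs).trans (by gcongr)
  · rw [div_mul_eq_mul_div, ← mul_div_assoc']
    exact hKN.trans <| by gcongr; exact LoopedReLU.mul_logb_le_lpComplexity hδ hp hθ hs hmin

theorem theorem1 (δ M : ℝ) (hδ : 0 < δ) (hδM : δ ≤ M)
    (hδc : LoopedReLU.IsComputableReal δ)
    (U : List Bool →. List Bool) (hU : LoopedReLU.IsUniversalPrefixMachine U) :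
    (∀ θ : LoopedReLU.LoopedNet, θ.HasPrecision δ M → ∀ p : ℝ, 1 ≤ p →
      δ ^ p * (θ.l0 : ℝ) ≤ θ.lpPow p ∧ θ.lpPow p ≤ M ^ p * (θ.l0 : ℝ)) ∧
    ∃ c_U c_d : ℝ, 0 ≤ c_U ∧ 0 ≤ c_d ∧ ∀ s : List Bool,
      ∃ K N : ℕ, LoopedReLU.kolmogorov U s = (K : ℕ∞) ∧
        LoopedReLU.neuralComplexity δ M s = (N : ℕ∞) ∧
        (N : ℝ) ≤ K + c_U ∧
        (K : ℝ) ≤ c_d * (N * Real.logb 2 N) + c_d ∧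
        ∀ p : ℝ, 1 ≤ p →
          LoopedReLU.lpComplexity δ M p s ^ p ≤ M ^ p * (K + c_U) ∧
          (K : ℝ) ≤ c_d / δ ^ p * (LoopedReLU.lpComplexity δ M p s ^ p *
            Real.logb 2 (LoopedReLU.lpComplexity δ M p s ^ p / δ ^ p)) + c_d := by
  obtain ⟨hnorm, c_U, c_d, hcU, hcd, h⟩ :=
    theorem1_general δ M hδ hδM hδc U hU.partrec hU.universal
  exact ⟨fun θ hθ p hp => hnorm θ hθ p (by linarith), c_U, c_d, hcU, hcd, fun s =>
    let ⟨K, N, hK, hN, hNK, hKN, hp⟩ := h s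
    ⟨K, N, hK, hN, hNK, hKN, fun p h1 => hp p (by linarith)⟩⟩
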